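/- Let $k=\mathbb F_q$ be a finite field with $q$ elements and let $Q$ be a quiver whose underlying graph is a simply laced Dynkin diagram (a finite disjoint union of diagrams of type $A_n$, $D_n$, $E_6,E_7,E_8$, with arbitrary orientation). Let $\mathrm{Rep}(Q)$ be the abelian category of finite-dimensional representations of $Q$ over $k$ and let $K=K_0(\mathrm{Rep}(Q))$ be its Grothendieck group. Then all $\mathrm{Ext}^i(M,N)$ in $\mathrm{Rep}(Q)$ are finite-dimensional over $k$ and vanish for $i\ge 2$, and there is a bilinear form $\langle\cdot,\cdot\rangle\colon K\times K\to\mathbb Z$ (necessarily unique) with $$\langle [M],[N]\rangle=\sum_{i\ge 0}(-1)^i\dim_k\mathrm{Ext}^i(M,N)\qquad\text{for all representations } M,N .$$ Let $\mathrm{Vect}^K$ be the category of $K$-graded real vector spaces and grade-preserving linear maps, with the usual tensor product, graded by $(V\otimes W)_d=\bigoplus_{n+m=d}V_n\otimes W_m$, and with the braiding $v\otimes w\mapsto q^{-\langle n,m\rangle}\,w\otimes v$ for $v\in V_n$, $w\in W_m$. For representations $M,N,E$ let $P^E_{MN}$ be the number of pairs $(f,g)$ for which $0\to N\xrightarrow{f}E\xrightarrow{g}M\to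 0$ is exact, and let $\mathrm{aut}(M)=|\mathrm{Aut}(M)|$. Let $\mathcal H$ be the real vector space with basis the isomorphism classes $[M]$ of representations, the degree of $[M]$ being the class of $M$ in $K$. Then $\mathcal H$ is a Hopf algebra object in the braided monoidal category $\mathrm{Vect}^K$, with multiplication and comultiplication $$[M]\cdot[N]=\sum_{[E]}\frac{P^E_{MN}}{\mathrm{aut}(M)\,\mathrm{aut}(N)}\,[E],\qquad \Delta([E])=\sum_{[M],[N]}\frac{P^E_{MN}}{\mathrm{aut}(E)}\,[N]\otimes[M]$$ (both sums being finite), unit $[0]$, and counit $\varepsilon([M])=1$ if $M=0$ and $\varepsilon([M])=0$ otherwise. Its antipode $S$ satisfies $S([M])=-[M]$ for every simple representation $M$. -/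

import Mathlib

open CategoryTheory MonoidalCategory
open scoped TensorProduct

universe u v w

noncomputable section

/-! ### Graded vector spaces with a braiding twisted by a bilinear form -/

/-- A real vector space `V = ⨁ n : K, V_n` graded by an abelian group `K`. The bilinear form `χ` and
the nonzero scalar `q` do not enter the data of an object; they are parameters of the type because
the braiding of the category depends on them. -/
structure KVect {K : Type w} [AddCommGroup K] (χ : K →+ K →+ ℤ) (q : ℝˣ) where
  carrier : Type w
  [addCommGroup : AddCommGroup carrier]
  [module : Module ℝ carrier]
  /-- the homogeneous pieces -/
  piece : K → Submodule ℝ carrier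
  indep : iSupIndep piece
  iSup_eq_top : iSup piece = ⊤

namespace KVect

attribute [instance] KVect.addCommGroup KVect.module

section Criterion

variable {K : Type w} {V : Type w} [AddCommGroup V] [Module ℝ V]

theorem iSupIndep_of_coaction (P : K → Submodule ℝ V) (δ : V →ₗ[ℝ] (K →₀ V))
    (h : ∀ n, ∀ x ∈ P n, δ x = Finsupp.single n x) : iSupIndep P := by
  intro n
  rw [Submodule.disjoint_def]
  intro x hx hx'
  have key : (⨆ (j) (_ : j ≠ n), P j) ≤ LinearMap.ker (Finsupp.lapply n ∘ₗ δ) := by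
    refine iSup₂_le fun j hj y hy => ?_
    simp [h j y hy, hj]
  have := key hx'
  simpa [h n x hx] using this

end Criterion

variable {K : Type w} [AddCommGroup K] {χ : K →+ K →+ ℤ} {q : ℝˣ}

open Classical in
theorem isInternal (V : KVect χ q) : DirectSum.IsInternal V.piece :=
  (DirectSum.isInternal_submodule_iff_iSupIndep_and_iSup_eq_top _).2 ⟨V.indep, V.iSup_eq_top⟩

open Classical in
/-- The map that sends a vector to the family of its homogeneous components. -/
def components (V : KVect χ q) : V.carrier →ₗ[ℝ] (K →₀ V.carrier) :=
  (DirectSum.toModule ℝ K (K →₀ V.carrier)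
      fun n => Finsupp.lsingle n ∘ₗ (V.piece n).subtype) ∘ₗ
    (LinearEquiv.ofBijective (DirectSum.coeLinearMap V.piece) V.isInternal).symm.toLinearMap

theorem components_of_mem (V : KVect χ q) {n : K} {x : V.carrier} (hx : x ∈ V.piece n) :
    V.components x = Finsupp.single n x := by
  classical
  have : (LinearEquiv.ofBijective (DirectSum.coeLinearMap V.piece) V.isInternal).symm x
      = DirectSum.lof ℝ K (fun i => V.piece i) n ⟨x, hx⟩ := by
    rw [LinearEquiv.symm_apply_eq]
    exact (DirectSum.coeLinearMap_lof V.piece n ⟨x, hx⟩).symm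
  have h2 : V.components x = (DirectSum.toModule ℝ K (K →₀ V.carrier)
      fun n => Finsupp.lsingle n ∘ₗ (V.piece n).subtype)
      ((LinearEquiv.ofBijective (DirectSum.coeLinearMap V.piece) V.isInternal).symm x) := by
    unfold components
    rw [LinearMap.comp_apply]
    congr!
  rw [h2, this, DirectSum.toModule_lof]
  rfl

theorem homogeneous_induction (V : KVect χ q) {p : V.carrier → Prop} (x : V.carrier)
    (hom : ∀ n, ∀ y ∈ V.piece n, p y) (zero : p 0) (add : ∀ y z, p y → p z → p (y + z)) : p x :=
  Submodule.iSup_induction V.piece (motive := p)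
    (by rw [V.iSup_eq_top]; trivial) hom zero add

theorem lin_ext {V : KVect χ q} {M : Type*} [AddCommGroup M] [Module ℝ M]
    {f g : V.carrier →ₗ[ℝ] M} (h : ∀ n, ∀ x ∈ V.piece n, f x = g x) : f = g := by
  ext x
  refine V.homogeneous_induction x h (by simp) fun y z hy hz => by simp [hy, hz]

/-- A morphism of graded vector spaces: a linear map that preserves the grading. -/
@[ext]
structure Hom (V W : KVect χ q) where
  lin : V.carrier →ₗ[ℝ] W.carrier
  map_mem : ∀ n, ∀ x ∈ V.piece n, lin x ∈ W.piece n

instance : Category (KVect χ q) where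
  Hom := Hom
  id V := ⟨LinearMap.id, fun _ _ h => h⟩
  comp f g := ⟨g.lin ∘ₗ f.lin, fun n x h => g.map_mem n _ (f.map_mem n x h)⟩

/-- The linear map underlying a morphism. -/
abbrev lin {V W : KVect χ q} (f : V ⟶ W) : V.carrier →ₗ[ℝ] W.carrier := Hom.lin f

theorem hom_ext {V W : KVect χ q} {f g : V ⟶ W} (h : lin f = lin g) : f = g := Hom.ext h

theorem lin_comp {V W U : KVect χ q} (f : V ⟶ W) (g : W ⟶ U) :
    lin (f ≫ g) = lin g ∘ₗ lin f := rfl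

theorem lin_id (V : KVect χ q) : lin (𝟙 V) = LinearMap.id := rfl

/-- `(V ⊗ W)_d` is spanned by the `v ⊗ w` with `v ∈ V_n`, `w ∈ W_m`, `n + m = d`. -/
def tensorPiece (V W : KVect χ q) (d : K) : Submodule ℝ (V.carrier ⊗[ℝ] W.carrier) :=
  Submodule.span ℝ {t | ∃ n m : K, n + m = d ∧ ∃ x ∈ V.piece n, ∃ y ∈ W.piece m, t = x ⊗ₜ[ℝ] y}

theorem tmul_mem_tensorPiece {V W : KVect χ q} {n m : K} {x : V.carrier} {y : W.carrier}
    (hx : x ∈ V.piece n) (hy : y ∈ W.piece m) : x ⊗ₜ[ℝ] y ∈ tensorPiece V W (n + m) :=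
  Submodule.subset_span ⟨n, m, rfl, x, hx, y, hy, rfl⟩

theorem mapsTo_of_tmul {V W : KVect χ q} {M : Type*} [AddCommGroup M] [Module ℝ M]
    (f : V.carrier ⊗[ℝ] W.carrier →ₗ[ℝ] M) (P : K → Submodule ℝ M)
    (h : ∀ n m, ∀ x ∈ V.piece n, ∀ y ∈ W.piece m, f (x ⊗ₜ y) ∈ P (n + m)) (d : K) :
    ∀ t ∈ tensorPiece V W d, f t ∈ P d := by
  intro t ht
  have : tensorPiece V W d ≤ (P d).comap f := by
    refine Submodule.span_le.2 ?_
    rintro _ ⟨n, m, rfl, x, hx, y, hy, rfl⟩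
    exact h n m x hx y hy
  exact this ht

/-- Bihomogeneous components of a tensor. -/
def components₂ (V W : KVect χ q) :
    V.carrier ⊗[ℝ] W.carrier →ₗ[ℝ] (K × K →₀ V.carrier ⊗[ℝ] W.carrier) :=
  (finsuppTensorFinsupp ℝ ℝ V.carrier W.carrier K K).toLinearMap ∘ₗ
    TensorProduct.map V.components W.components

theorem components₂_tmul {V W : KVect χ q} {n m : K} {x : V.carrier} {y : W.carrier}
    (hx : x ∈ V.piece n) (hy : y ∈ W.piece m) :
    components₂ V W (x ⊗ₜ y) = Finsupp.single (n, m) (x ⊗ₜ y) := by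
  simp [components₂, components_of_mem _ hx, components_of_mem _ hy]

theorem tmul_induction {V W : KVect χ q} {p : V.carrier ⊗[ℝ] W.carrier → Prop}
    (t : V.carrier ⊗[ℝ] W.carrier)
    (hom : ∀ n m, ∀ x ∈ V.piece n, ∀ y ∈ W.piece m, p (x ⊗ₜ y)) (zero : p 0)
    (add : ∀ s t, p s → p t → p (s + t)) : p t := by
  induction t with
  | zero => exact zero
  | add s t hs ht => exact add s t hs ht
  | tmul x y =>
    refine V.homogeneous_induction (p := fun x => p (x ⊗ₜ y)) x (fun n x hx => ?_) (by simpa using zero)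
      (fun a b ha hb => by rw [TensorProduct.add_tmul]; exact add _ _ ha hb)
    refine W.homogeneous_induction (p := fun y => p (x ⊗ₜ y)) y (fun m y hy => hom n m x hx y hy) (by simpa using zero)
      (fun a b ha hb => by rw [TensorProduct.tmul_add]; exact add _ _ ha hb)

/-- The tensor product of graded vector spaces. -/
@[reducible]
def tensor (V W : KVect χ q) : KVect χ q where
  carrier := V.carrier ⊗[ℝ] W.carrier
  piece := tensorPiece V W
  indep := by
    refine iSupIndep_of_coaction _
      (Finsupp.lmapDomain _ ℝ (fun p : K × K => p.1 + p.2) ∘ₗ components₂ V W) ?_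
    intro d t ht
    have : tensorPiece V W d ≤ LinearMap.eqLocus
        (Finsupp.lmapDomain _ ℝ (fun p : K × K => p.1 + p.2) ∘ₗ components₂ V W)
        (Finsupp.lsingle d) := by
      refine Submodule.span_le.2 ?_
      rintro _ ⟨n, m, rfl, x, hx, y, hy, rfl⟩
      simp [components₂_tmul hx hy]
    exact this ht
  iSup_eq_top := by
    rw [eq_top_iff]
    rintro t -
    exact tmul_induction t
      (fun n m x hx y hy => Submodule.mem_iSup_of_mem (n + m) (tmul_mem_tensorPiece hx hy))
      (zero_mem _) (fun _ _ => add_mem)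

/-- The unit object: the ground field, in degree `0`. -/
@[reducible]
def unit : KVect χ q where
  carrier := ULift.{w} ℝ
  piece n := ⨆ _ : n = 0, ⊤
  indep := by
    refine iSupIndep_of_coaction _ (Finsupp.lsingle 0) ?_
    intro n x hx
    by_cases h : n = 0
    · subst h; rfl
    · have : x = 0 := by simpa [h] using hx
      simp [this]
  iSup_eq_top := by simp

/-- A graded linear isomorphism gives an isomorphism of graded vector spaces. -/
def mkIso {V W : KVect χ q} (e : V.carrier ≃ₗ[ℝ] W.carrier)
    (h : ∀ n, ∀ x ∈ V.piece n, e x ∈ W.piece n)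
    (h' : ∀ n, ∀ x ∈ W.piece n, e.symm x ∈ V.piece n) : V ≅ W where
  hom := ⟨e.toLinearMap, h⟩
  inv := ⟨e.symm.toLinearMap, h'⟩
  hom_inv_id := hom_ext (LinearMap.ext fun x => e.symm_apply_apply x)
  inv_hom_id := hom_ext (LinearMap.ext fun x => e.apply_symm_apply x)

/-- The tensor product of two morphisms. -/
def tensorMap {V V' W W' : KVect χ q} (f : V ⟶ V') (g : W ⟶ W') : tensor V W ⟶ tensor V' W' :=
  ⟨TensorProduct.map (lin f) (lin g), mapsTo_of_tmul (V := V) (W := W) _ (tensorPiece V' W')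
    fun n m x hx y hy => tmul_mem_tensorPiece (f.map_mem n x hx) (g.map_mem m y hy)⟩

/-- The associativity constraint `(x ⊗ y) ⊗ z ↦ x ⊗ (y ⊗ z)`. -/
def assocIso (V W U : KVect χ q) : tensor (tensor V W) U ≅ tensor V (tensor W U) :=
  mkIso (V := tensor (tensor V W) U) (W := tensor V (tensor W U))
    (TensorProduct.assoc ℝ V.carrier W.carrier U.carrier)
    (by
      refine mapsTo_of_tmul (V := tensor V W) (W := U) _ (tensorPiece V (tensor W U)) ?_
      intro d p t ht z hz
      refine mapsTo_of_tmul (V := V) (W := W)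
        ((TensorProduct.assoc ℝ V.carrier W.carrier U.carrier).toLinearMap ∘ₗ
          (TensorProduct.mk ℝ _ _).flip z)
        (fun d => tensorPiece V (tensor W U) (d + p)) ?_ d t ht
      intro n m x hx y hy
      rw [add_assoc]
      exact tmul_mem_tensorPiece (W := tensor W U) hx (tmul_mem_tensorPiece hy hz))
    (by
      refine mapsTo_of_tmul (V := V) (W := tensor W U)
        (TensorProduct.assoc ℝ V.carrier W.carrier U.carrier).symm.toLinearMap
        (tensorPiece (tensor V W) U) ?_
      intro n d x hx t ht
      refine mapsTo_of_tmul (V := W) (W := U)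
        ((TensorProduct.assoc ℝ V.carrier W.carrier U.carrier).symm.toLinearMap ∘ₗ
          TensorProduct.mk ℝ _ _ x)
        (fun d => tensorPiece (tensor V W) U (n + d)) ?_ d t ht
      intro m p y hy z hz
      rw [← add_assoc]
      exact tmul_mem_tensorPiece (V := tensor V W) (tmul_mem_tensorPiece hx hy) hz)

theorem mem_unit_piece_zero (x : (unit : KVect χ q).carrier) :
    x ∈ (unit : KVect χ q).piece 0 := by
  change x ∈ ⨆ _ : (0 : K) = 0, (⊤ : Submodule ℝ (ULift.{w} ℝ))
  rw [iSup_pos rfl]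
  trivial

theorem unit_piece_of_ne {n : K} (h : n ≠ 0) : (unit : KVect χ q).piece n = ⊥ := by
  change (⨆ _ : n = 0, (⊤ : Submodule ℝ (ULift.{w} ℝ))) = ⊥
  rw [iSup_neg h]

/-- The linear map `a ⊗ x ↦ a • x`. -/
def leftLin (V : KVect χ q) : (unit : KVect χ q).carrier ⊗[ℝ] V.carrier ≃ₗ[ℝ] V.carrier :=
  (TensorProduct.congr ULift.moduleEquiv (LinearEquiv.refl ℝ V.carrier)).trans
    (TensorProduct.lid ℝ V.carrier)

/-- The linear map `x ⊗ a ↦ a • x`. -/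
def rightLin (V : KVect χ q) : V.carrier ⊗[ℝ] (unit : KVect χ q).carrier ≃ₗ[ℝ] V.carrier :=
  (TensorProduct.congr (LinearEquiv.refl ℝ V.carrier) ULift.moduleEquiv).trans
    (TensorProduct.rid ℝ V.carrier)

/-- The left unit constraint. -/
def leftIso (V : KVect χ q) : tensor unit V ≅ V :=
  mkIso (V := tensor unit V) (W := V) (leftLin V)
    (by
      refine mapsTo_of_tmul (V := unit) (W := V) (leftLin V).toLinearMap V.piece ?_
      intro n m x hx y hy
      by_cases h : n = 0
      · subst h
        rw [zero_add]
        exact (V.piece m).smul_mem _ hy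
      · rw [unit_piece_of_ne h, Submodule.mem_bot] at hx
        subst hx
        rw [TensorProduct.zero_tmul, map_zero]
        exact zero_mem _)
    (by
      intro n x hx
      have := tmul_mem_tensorPiece (V := unit) (W := V)
        (mem_unit_piece_zero (ULift.up (1 : ℝ))) hx
      rw [zero_add] at this
      exact this)

/-- The right unit constraint. -/
def rightIso (V : KVect χ q) : tensor V unit ≅ V :=
  mkIso (V := tensor V unit) (W := V) (rightLin V)
    (by
      refine mapsTo_of_tmul (V := V) (W := unit) (rightLin V).toLinearMap V.piece ?_
      intro n m x hx y hy
      by_cases h : m = 0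
      · subst h
        rw [add_zero]
        exact (V.piece n).smul_mem _ hx
      · rw [unit_piece_of_ne h, Submodule.mem_bot] at hy
        subst hy
        rw [TensorProduct.tmul_zero, map_zero]
        exact zero_mem _)
    (by
      intro n x hx
      have := tmul_mem_tensorPiece (V := V) (W := unit) hx
        (mem_unit_piece_zero (ULift.up (1 : ℝ)))
      rw [add_zero] at this
      exact this)

instance : MonoidalCategoryStruct (KVect χ q) where
  tensorObj := tensor
  whiskerLeft V _ _ f := tensorMap (𝟙 V) f
  whiskerRight f W := tensorMap f (𝟙 W)
  tensorHom f g := tensorMap f g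
  tensorUnit := unit
  associator := assocIso
  leftUnitor := leftIso
  rightUnitor := rightIso

instance : MonoidalCategory (KVect χ q) where
  tensorHom_def _ _ := hom_ext (TensorProduct.ext' fun _ _ => rfl)
  id_tensorHom_id _ _ := hom_ext (TensorProduct.ext' fun _ _ => rfl)
  tensorHom_comp_tensorHom _ _ _ _ := hom_ext (TensorProduct.ext' fun _ _ => rfl)
  whiskerLeft_id _ _ := hom_ext (TensorProduct.ext' fun _ _ => rfl)
  id_whiskerRight _ _ := hom_ext (TensorProduct.ext' fun _ _ => rfl)
  associator_naturality _ _ _ := hom_ext (TensorProduct.ext_threefold fun _ _ _ => rfl)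
  leftUnitor_naturality f := hom_ext (TensorProduct.ext' fun a x =>
    ((lin f).map_smul (ULift.down a) x).symm)
  rightUnitor_naturality f := hom_ext (TensorProduct.ext' fun x a =>
    ((lin f).map_smul (ULift.down a) x).symm)
  pentagon _ _ _ _ := hom_ext (TensorProduct.ext_fourfold fun _ _ _ _ => rfl)
  triangle _ _ := hom_ext (TensorProduct.ext_threefold fun x a y =>
    (TensorProduct.smul_tmul (ULift.down a) x y).symm)

/-- The linear map underlying the braiding; see `braidLin_tmul`. -/
def braidLin (b : K → K → ℝ) (V W : KVect χ q) :
    V.carrier ⊗[ℝ] W.carrier →ₗ[ℝ] W.carrier ⊗[ℝ] V.carrier :=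
  Finsupp.lsum ℝ (fun p : K × K =>
    b p.1 p.2 • (TensorProduct.comm ℝ V.carrier W.carrier).toLinearMap) ∘ₗ components₂ V W

theorem braidLin_tmul (b : K → K → ℝ) {V W : KVect χ q} {n m : K} {x : V.carrier} {y : W.carrier}
    (hx : x ∈ V.piece n) (hy : y ∈ W.piece m) :
    braidLin b V W (x ⊗ₜ y) = b n m • (y ⊗ₜ x) := by
  simp [braidLin, components₂_tmul hx hy]

theorem tmul_ext {V W : KVect χ q} {M : Type*} [AddCommGroup M] [Module ℝ M]
    {f g : V.carrier ⊗[ℝ] W.carrier →ₗ[ℝ] M}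
    (h : ∀ n m, ∀ x ∈ V.piece n, ∀ y ∈ W.piece m, f (x ⊗ₜ y) = g (x ⊗ₜ y)) : f = g :=
  LinearMap.ext fun t => tmul_induction (p := fun t => f t = g t) t h (by simp)
    (fun s t hs ht => by simp only [map_add, hs, ht])

theorem tmul_ext₃ {V W U : KVect χ q} {M : Type*} [AddCommGroup M] [Module ℝ M]
    {f g : (V.carrier ⊗[ℝ] W.carrier) ⊗[ℝ] U.carrier →ₗ[ℝ] M}
    (h : ∀ n m p, ∀ x ∈ V.piece n, ∀ y ∈ W.piece m, ∀ z ∈ U.piece p,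
      f ((x ⊗ₜ y) ⊗ₜ z) = g ((x ⊗ₜ y) ⊗ₜ z)) : f = g := by
  refine TensorProduct.ext (tmul_ext fun n m x hx y hy => lin_ext fun p z hz => ?_)
  exact h n m p x hx y hy z hz

theorem tmul_ext₃' {V W U : KVect χ q} {M : Type*} [AddCommGroup M] [Module ℝ M]
    {f g : V.carrier ⊗[ℝ] (W.carrier ⊗[ℝ] U.carrier) →ₗ[ℝ] M}
    (h : ∀ n m p, ∀ x ∈ V.piece n, ∀ y ∈ W.piece m, ∀ z ∈ U.piece p,
      f (x ⊗ₜ (y ⊗ₜ z)) = g (x ⊗ₜ (y ⊗ₜ z))) : f = g := by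
  refine TensorProduct.ext (lin_ext fun n x hx => tmul_ext fun m p y hy z hz => ?_)
  exact h n m p x hx y hy z hz

theorem braidLin_mem (b : K → K → ℝ) (V W : KVect χ q) (d : K)
    (t : V.carrier ⊗[ℝ] W.carrier) (ht : t ∈ tensorPiece V W d) :
    braidLin b V W t ∈ tensorPiece W V d := by
  refine mapsTo_of_tmul (braidLin b V W) (tensorPiece W V) (fun n m x hx y hy => ?_) d t ht
  rw [braidLin_tmul _ hx hy, add_comm]
  exact Submodule.smul_mem _ _ (tmul_mem_tensorPiece hy hx)

theorem braidLin_comp (b c : K → K → ℝ) (h : ∀ n m, b n m * c m n = 1) (V W : KVect χ q) :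
    braidLin c W V ∘ₗ braidLin b V W = LinearMap.id :=
  tmul_ext fun n m x hx y hy => by
    rw [LinearMap.comp_apply, braidLin_tmul _ hx hy, map_smul, braidLin_tmul _ hy hx, smul_smul,
      h, one_smul, LinearMap.id_apply]

variable (χ q) in
/-- The coefficient `q ^ (-χ(n, m))`. -/
def braidCoeff (n m : K) : ℝ := ((q ^ (-χ n m) : ℝˣ) : ℝ)

variable (χ q) in
/-- The coefficient `q ^ χ(n, m)` of the inverse braiding. -/
def braidCoeffInv (m n : K) : ℝ := ((q ^ χ n m : ℝˣ) : ℝ)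

theorem braidCoeff_mul (n m : K) : braidCoeff χ q n m * braidCoeffInv χ q m n = 1 := by
  rw [braidCoeff, braidCoeffInv, ← Units.val_mul, ← zpow_add, neg_add_cancel, zpow_zero,
    Units.val_one]

theorem braidCoeffInv_mul (m n : K) : braidCoeffInv χ q m n * braidCoeff χ q n m = 1 := by
  rw [mul_comm, braidCoeff_mul]

/-- The braiding `v ⊗ w ↦ q ^ (-χ(n, m)) • w ⊗ v` for `v ∈ V_n`, `w ∈ W_m`;
its inverse is `w ⊗ v ↦ q ^ χ(n, m) • v ⊗ w`. -/
def braidIso (V W : KVect χ q) : tensor V W ≅ tensor W V where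
  hom := ⟨braidLin (braidCoeff χ q) V W, braidLin_mem (braidCoeff χ q) V W⟩
  inv := ⟨braidLin (braidCoeffInv χ q) W V, braidLin_mem (braidCoeffInv χ q) W V⟩
  hom_inv_id := hom_ext (braidLin_comp (braidCoeff χ q) (braidCoeffInv χ q) braidCoeff_mul V W)
  inv_hom_id := hom_ext
    (braidLin_comp (braidCoeffInv χ q) (braidCoeff χ q) braidCoeffInv_mul W V)

theorem braidIso_tmul {V W : KVect χ q} {n m : K} {x : V.carrier} {y : W.carrier}
    (hx : x ∈ V.piece n) (hy : y ∈ W.piece m) :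
    lin (braidIso V W).hom (x ⊗ₜ y) = ((q ^ (-χ n m) : ℝˣ) : ℝ) • (y ⊗ₜ x) :=
  braidLin_tmul _ hx hy

instance : BraidedCategory (KVect χ q) where
  braiding := braidIso
  braiding_naturality_right V W W' f := hom_ext (tmul_ext fun n m x hx y hy => by
    change lin (braidIso V W').hom (x ⊗ₜ lin f y) =
      TensorProduct.map (lin f) LinearMap.id (lin (braidIso V W).hom (x ⊗ₜ y))
    rw [braidIso_tmul hx hy, braidIso_tmul hx (f.map_mem _ _ hy), map_smul]
    rfl)
  braiding_naturality_left f W := hom_ext (tmul_ext fun n m x hx y hy => by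
    change lin (braidIso _ W).hom (lin f x ⊗ₜ y) =
      TensorProduct.map LinearMap.id (lin f) (lin (braidIso _ W).hom (x ⊗ₜ y))
    rw [braidIso_tmul hx hy, braidIso_tmul (f.map_mem _ _ hx) hy, map_smul]
    rfl)
  hexagon_forward V W U := hom_ext (tmul_ext₃ fun n m p x hx y hy z hz => by
    change TensorProduct.assoc ℝ W.carrier U.carrier V.carrier
        (lin (braidIso V (tensor W U)).hom (x ⊗ₜ (y ⊗ₜ z))) =
      TensorProduct.map LinearMap.id (lin (braidIso V U).hom)
        (TensorProduct.assoc ℝ W.carrier V.carrier U.carrier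
          (lin (braidIso V W).hom (x ⊗ₜ y) ⊗ₜ z))
    rw [braidIso_tmul (W := tensor W U) hx (tmul_mem_tensorPiece hy hz), braidIso_tmul hx hy,
      map_smul, ← TensorProduct.smul_tmul', map_smul, map_smul, TensorProduct.assoc_tmul,
      TensorProduct.assoc_tmul, TensorProduct.map_tmul, braidIso_tmul hx hz,
      TensorProduct.tmul_smul, smul_smul, ← Units.val_mul, ← zpow_add, map_add, neg_add]
    rfl)
  hexagon_reverse V W U := hom_ext (tmul_ext₃' fun n m p x hx y hy z hz => by
    change (TensorProduct.assoc ℝ U.carrier V.carrier W.carrier).symm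
        (lin (braidIso (tensor V W) U).hom ((x ⊗ₜ y) ⊗ₜ z)) =
      TensorProduct.map (lin (braidIso V U).hom) LinearMap.id
        ((TensorProduct.assoc ℝ V.carrier U.carrier W.carrier).symm
          (x ⊗ₜ lin (braidIso W U).hom (y ⊗ₜ z)))
    rw [braidIso_tmul (V := tensor V W) (tmul_mem_tensorPiece hx hy) hz, braidIso_tmul hy hz,
      map_smul, TensorProduct.tmul_smul, map_smul, map_smul, TensorProduct.assoc_symm_tmul,
      TensorProduct.assoc_symm_tmul, TensorProduct.map_tmul, braidIso_tmul hx hz,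
      ← TensorProduct.smul_tmul', smul_smul, ← Units.val_mul, ← zpow_add, map_add,
      AddMonoidHom.add_apply, neg_add, add_comm (-(χ m) p)]
    rfl)

end KVect

/-! ### Isomorphism classes, the Grothendieck group and the Hall algebra -/

section Hall

variable (C : Type w) [Category.{v} C]

/-- The set of isomorphism classes of objects. -/
abbrev IsoClass : Type w := Quotient (isIsomorphicSetoid C)

variable {C} in
/-- The isomorphism class of an object. -/
abbrev isoClass (M : C) : IsoClass C := Quotient.mk (isIsomorphicSetoid C) M

variable [Abelian C]

/-- The Grothendieck group: the abelian group generated by the isomorphism classes of objects, with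
a relation `[S₂] = [S₁] + [S₃]` for each short exact sequence `0 ⟶ S₁ ⟶ S₂ ⟶ S₃ ⟶ 0`. -/
abbrev K0 : Type w :=
  FreeAbelianGroup (IsoClass C) ⧸ AddSubgroup.closure
    {x | ∃ S : ShortComplex C, S.ShortExact ∧
      x = FreeAbelianGroup.of (isoClass S.X₁) + FreeAbelianGroup.of (isoClass S.X₃) -
        FreeAbelianGroup.of (isoClass S.X₂)}

variable {C}

/-- The image in the Grothendieck group of an isomorphism class. -/
def K0.ofClass (x : IsoClass C) : K0 C := QuotientAddGroup.mk (FreeAbelianGroup.of x)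

/-- The class in the Grothendieck group of an object. -/
def K0.of (M : C) : K0 C := K0.ofClass (isoClass M)

/-- The number of pairs `(f, g)` such that `0 ⟶ N ⟶ E ⟶ M ⟶ 0`, with maps `f` and `g`, is exact. -/
def hallP (M N E : C) : ℕ :=
  Nat.card {p : (N ⟶ E) × (E ⟶ M) //
    ∃ h : p.1 ≫ p.2 = 0, (ShortComplex.mk p.1 p.2 h).ShortExact}

/-- The number of automorphisms of an object. -/
def autCard (M : C) : ℕ := Nat.card (Aut M)

theorem components_supported (x : IsoClass C →₀ ℝ) (d : K0 C)
    (hx : x ∈ Finsupp.supported ℝ ℝ {c : IsoClass C | K0.ofClass c = d}) :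
    Finsupp.lsum ℝ (fun c => (Finsupp.lsingle (K0.ofClass c) :
        (IsoClass C →₀ ℝ) →ₗ[ℝ] (K0 C →₀ (IsoClass C →₀ ℝ))) ∘ₗ Finsupp.lsingle c) x =
      Finsupp.single d x := by
  rw [Finsupp.supported_eq_span_single] at hx
  have : Submodule.span ℝ ((fun i => Finsupp.single i (1 : ℝ)) ''
      {c : IsoClass C | K0.ofClass c = d}) ≤ LinearMap.eqLocus
        (Finsupp.lsum ℝ (fun c => (Finsupp.lsingle (K0.ofClass c) :
          (IsoClass C →₀ ℝ) →ₗ[ℝ] (K0 C →₀ (IsoClass C →₀ ℝ))) ∘ₗ Finsupp.lsingle c))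
        (Finsupp.lsingle d) := by
    refine Submodule.span_le.2 ?_
    rintro _ ⟨c, rfl, rfl⟩
    simp
  exact this hx

/-- The vector space with basis the isomorphism classes of objects, in which the basis vector of
`M` has as its degree the class of `M` in the Grothendieck group. -/
@[reducible]
def hallObj (χ : K0 C →+ K0 C →+ ℤ) (q : ℝˣ) : KVect χ q where
  carrier := IsoClass C →₀ ℝ
  piece d := Finsupp.supported ℝ ℝ {c | K0.ofClass c = d}
  indep := KVect.iSupIndep_of_coaction _ _ fun d x hx => components_supported x d hx
  iSup_eq_top := by
    rw [← Finsupp.supported_iUnion, ← Finsupp.supported_univ]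
    congr 1
    ext c
    simp

/-- The basis vector of the Hall algebra given by an object. -/
def hallBasis (M : C) : IsoClass C →₀ ℝ := Finsupp.single (isoClass M) 1

end Hall

/-! ### Quivers and their representations -/

/-- The connected simply laced Dynkin diagrams. -/
inductive ADEType
  | A (n : ℕ) (hn : 1 ≤ n)
  | D (n : ℕ) (hn : 4 ≤ n)
  | E₆
  | E₇
  | E₈

/-- The number of vertices. -/
def ADEType.rank : ADEType → ℕ
  | .A n _ => n
  | .D n _ => n
  | .E₆ => 6
  | .E₇ => 7
  | .E₈ => 8

/-- The Cartan matrix. -/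
def ADEType.cartan : (t : ADEType) → Matrix (Fin t.rank) (Fin t.rank) ℤ
  | .A n _ => CartanMatrix.A n
  | .D n _ => CartanMatrix.D n
  | .E₆ => CartanMatrix.E₆
  | .E₇ => CartanMatrix.E₇
  | .E₈ => CartanMatrix.E₈

/-- The underlying graph of the quiver is a finite disjoint union of Dynkin diagrams of type
`A`, `D`, `E`: there are no loops, and the number of arrows, in either direction, between
two distinct vertices is the negative of the entry of the Cartan matrix. -/
def IsSimplyLacedDynkin (V : Type u) [Quiver.{u} V] : Prop :=
  (∀ x y : V, Finite (x ⟶ y)) ∧ (∀ x : V, IsEmpty (x ⟶ x)) ∧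
    ∃ (r : ℕ) (t : Fin r → ADEType) (e : V ≃ Σ i, Fin (t i).rank), ∀ x y : V, x ≠ y →
      (Nat.card (x ⟶ y) + Nat.card (y ⟶ x) : ℤ) =
        -Matrix.blockDiagonal' (fun i => (t i).cartan) (e x) (e y)

/-- Finite-dimensional representations of a quiver: functors from its path category to
finite-dimensional vector spaces. -/
abbrev QuiverRep (k : Type u) [Field k] (V : Type u) [Quiver.{u} V] : Type (u + 1) :=
  Paths V ⥤ FGModuleCat.{u} k

section Euler

variable {k : Type u} [Field k] {V : Type u} [Quiver.{u} V]

instance QuiverRep.hasExt : HasExt.{u + 1} (QuiverRep k V) := HasExt.standard _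

/-- The `k`-vector space `Ext^i(M, N)` in the category of representations. -/
abbrev repExt (M N : QuiverRep k V) (i : ℕ) : Type (u + 1) := Abelian.Ext.{u + 1} M N i

/-- The Euler form `∑ i, (-1)^i dim Ext^i(M, N)`. -/
def eulerForm (M N : QuiverRep k V) : ℤ :=
  ∑ᶠ i : ℕ, (-1) ^ i * (Module.finrank k (repExt M N i) : ℤ)

variable (k) in
/-- The number of elements of a finite field, as a nonzero real number. -/
def cardUnit [Finite k] : ℝˣ := Units.mk0 (Nat.card k : ℝ) (Nat.cast_ne_zero.2 Nat.card_pos.ne')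

end Euler

end

/-! ### Quivers of Dynkin type are finite and acyclic -/

/-! Only one consequence of the Dynkin condition is used: the diagram is a finite forest, so the
quiver has finitely many vertices and finitely many paths between any two of them. Hence every
representation embeds in an injective one. Because the path category is free, quotients of
injectives are injective, and Ext vanishes from degree 2 on (`Paths.hasInjectiveDimensionLT_two`).
Finiteness of k makes Hom, Ext¹ and the sets of subobjects finite. Long exact sequences, read as
identities between powers of q, then show that the Euler form is additive, so it descends to the
Grothendieck group.

The identities between Hall numbers rest on one principle: the sum of |Iso(X, E)| / aut(E) over
isomorphism classes [E] is 1. A sum over middle terms E weighted by 1 / aut(E) therefore counts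
configurations from which E has been eliminated. For associativity (`hallP_assoc`) both sides count
two-step filtrations of the big object.

Compatibility of product and coproduct is Green's formula (`hallP_green`), a double count of three
by three diagrams. Two short exact sequences through the same E determine the four outer sequences
up to unique isomorphisms of the corners (`nonempty_frame_equiv`). Conversely, once the outer
sequences are fixed, Riedtmann's formula and Ext² = 0 give the weighted number of completions as
|Ext¹(A₁, B₂)| / |Hom(A₁, B₂)| (`sum_card_compat_cross`). This equals q^(-⟨A₁, B₂⟩), which is the
factor the braiding produces when [A₁] moves past [B₂].

The rest is formal. The coproduct is the transpose of the product for the form with ([M], [M]) = 1 /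
aut(M), so the coalgebra axioms are dual to the algebra axioms. Total dimension is additive and
vanishes only on 0, so left and right convolution inverses of the identity can be solved for
recursively, and they coincide. A simple object is primitive, hence S acts on it by -1. -/

theorem ADEType.exists_order (t : ADEType) :
    ∃ o : Fin t.rank → ℕ, Function.Injective o ∧
      (∀ j i₁ i₂, o i₁ < o j → o i₂ < o j → t.cartan i₁ j ≠ 0 → t.cartan i₂ j ≠ 0 → i₁ = i₂) ∧
      ∀ i j, i ≠ j → -1 ≤ t.cartan i j := by
  cases t with
  | A n hn =>
    -- In the usual numbering each vertex is joined to at most one earlier vertex. The order thus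
    -- exhibits the diagram as a forest, and the bound -1 says that edges are simple.
    refine ⟨fun i => i.val, Fin.val_injective, ?_, ?_⟩
    · change ∀ j i₁ i₂ : Fin n, i₁.val < j.val → i₂.val < j.val →
        CartanMatrix.A n i₁ j ≠ 0 → CartanMatrix.A n i₂ j ≠ 0 → i₁ = i₂
      intro j i₁ i₂ h₁ h₂ h₃ h₄
      simp only [CartanMatrix.A, Matrix.of_apply] at h₃ h₄
      ext
      grind
    · change ∀ i j : Fin n, i ≠ j → -1 ≤ CartanMatrix.A n i j
      intro i j h
      simp only [CartanMatrix.A, Matrix.of_apply]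
      grind
  | D n hn =>
    refine ⟨fun i => i.val, Fin.val_injective, ?_, ?_⟩
    · change ∀ j i₁ i₂ : Fin n, i₁.val < j.val → i₂.val < j.val →
        CartanMatrix.D n i₁ j ≠ 0 → CartanMatrix.D n i₂ j ≠ 0 → i₁ = i₂
      intro j i₁ i₂ h₁ h₂ h₃ h₄
      simp only [CartanMatrix.D, Matrix.of_apply] at h₃ h₄
      ext
      grind
    · change ∀ i j : Fin n, i ≠ j → -1 ≤ CartanMatrix.D n i j
      intro i j h
      simp only [CartanMatrix.D, Matrix.of_apply]
      grind
  | E₆ =>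
    -- The numbering is reversed because the branch vertex of a diagram of type E has two smaller
    -- neighbours in the standard numbering, but only one larger.
    refine ⟨fun i => (Fin.rev (n := 6) i).val, fun i j h => Fin.rev_injective (Fin.ext h), ?_, ?_⟩
    · change ∀ j i₁ i₂ : Fin 6, i₁.rev.val < j.rev.val → i₂.rev.val < j.rev.val →
        CartanMatrix.E₆ i₁ j ≠ 0 → CartanMatrix.E₆ i₂ j ≠ 0 → i₁ = i₂
      decide
    · change ∀ i j : Fin 6, i ≠ j → -1 ≤ CartanMatrix.E₆ i j
      intro i j _
      fin_cases i <;> fin_cases j <;> simp [CartanMatrix.E₆]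
  | E₇ =>
    refine ⟨fun i => (Fin.rev (n := 7) i).val, fun i j h => Fin.rev_injective (Fin.ext h), ?_, ?_⟩
    · change ∀ j i₁ i₂ : Fin 7, i₁.rev.val < j.rev.val → i₂.rev.val < j.rev.val →
        CartanMatrix.E₇ i₁ j ≠ 0 → CartanMatrix.E₇ i₂ j ≠ 0 → i₁ = i₂
      decide
    · change ∀ i j : Fin 7, i ≠ j → -1 ≤ CartanMatrix.E₇ i j
      intro i j _
      fin_cases i <;> fin_cases j <;> simp [CartanMatrix.E₇]
  | E₈ =>
    refine ⟨fun i => (Fin.rev (n := 8) i).val, fun i j h => Fin.rev_injective (Fin.ext h), ?_, ?_⟩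
    · change ∀ j i₁ i₂ : Fin 8, i₁.rev.val < j.rev.val → i₂.rev.val < j.rev.val →
        CartanMatrix.E₈ i₁ j ≠ 0 → CartanMatrix.E₈ i₂ j ≠ 0 → i₁ = i₂
      decide
    · change ∀ i j : Fin 8, i ≠ j → -1 ≤ CartanMatrix.E₈ i j
      intro i j _
      fin_cases i <;> fin_cases j <;> simp [CartanMatrix.E₈]

section Quiver

variable {V : Type u} [Quiver.{u} V]

theorem IsSimplyLacedDynkin.finite_vertices (hQ : IsSimplyLacedDynkin V) : Finite V := by
  obtain ⟨-, -, r, t, e, -⟩ := hQ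
  exact Finite.of_equiv _ e.symm

/-- A quiver with an order of its vertices in which every vertex has at most one arrow to or from
smaller vertices has a potential that increases by one along each arrow. -/
theorem exists_potential (o : V → ℕ) (ho : ∀ x y : V, (x ⟶ y) → o x ≠ o y)
    (hs : ∀ x y : V, (x ⟶ y) → (y ⟶ x) → False)
    (hu : ∀ x₁ x₂ y : V, o x₁ < o y → o x₂ < o y → (Nonempty (x₁ ⟶ y) ∨ Nonempty (y ⟶ x₁)) →
      (Nonempty (x₂ ⟶ y) ∨ Nonempty (y ⟶ x₂)) → x₁ = x₂) :
    ∃ h : V → ℤ, ∀ x y : V, (x ⟶ y) → h y = h x + 1 := by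
  classical
  -- Well-founded recursion along the order: a vertex takes its height from its only earlier
  -- neighbour, one higher or one lower according to the direction of the arrow. A vertex without
  -- earlier neighbours gets height 0.
  let F : ∀ y : V, (∀ x : V, o x < o y → ℤ) → ℤ := fun y ih =>
    if hy : ∃ x : V, o x < o y ∧ (Nonempty (x ⟶ y) ∨ Nonempty (y ⟶ x)) then
      ih hy.choose hy.choose_spec.1 + if Nonempty (hy.choose ⟶ y) then 1 else -1
    else 0
  let h : V → ℤ := (measure o).wf.fix F
  have key : ∀ x y : V, o x < o y → (Nonempty (x ⟶ y) ∨ Nonempty (y ⟶ x)) →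
      h y = h x + if Nonempty (x ⟶ y) then 1 else -1 := by
    intro x y hxy hadj
    have hy : ∃ x : V, o x < o y ∧ (Nonempty (x ⟶ y) ∨ Nonempty (y ⟶ x)) := ⟨x, hxy, hadj⟩
    have hx : hy.choose = x := hu _ _ y hy.choose_spec.1 hxy hy.choose_spec.2 hadj
    have h1 : h y = F y fun z _ => h z := (measure o).wf.fix_eq F y
    rw [h1]
    simp only [F, dif_pos hy, hx]
  refine ⟨h, fun x y f => ?_⟩
  rcases lt_or_gt_of_ne (ho x y f) with hlt | hlt
  · rw [key x y hlt (.inl ⟨f⟩), if_pos ⟨f⟩]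
  · rw [key y x hlt (.inr ⟨f⟩), if_neg fun ⟨g⟩ => hs x y f g]
    ring

/-- An oriented forest has no cycles, even unoriented ones, so heights can be propagated edge by
edge without conflict. Distinct blocks of the Cartan matrix share no edges, so the orders of the
components need not be compared. -/
theorem IsSimplyLacedDynkin.exists_potential (hQ : IsSimplyLacedDynkin V) :
    ∃ h : V → ℤ, ∀ x y : V, (x ⟶ y) → h y = h x + 1 := by
  classical
  obtain ⟨hfin, hloop, r, t, e, hc⟩ := hQ
  choose o ho_inj ho_uniq ho_ge using fun i => (t i).exists_order
  have hne : ∀ x y : V, (x ⟶ y) → x ≠ y := by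
    rintro x _ f rfl
    exact (hloop x).false f
  have hpos : ∀ x y : V, (x ⟶ y) → 0 < Nat.card (x ⟶ y) := fun x y f =>
    have := hfin x y
    have : Nonempty (x ⟶ y) := ⟨f⟩
    Nat.card_pos
  have hadj : ∀ x y : V, (Nonempty (x ⟶ y) ∨ Nonempty (y ⟶ x)) → x ≠ y ∧
      Matrix.blockDiagonal' (fun i => (t i).cartan) (e x) (e y) ≠ 0 := by
    intro x y h
    have hxy : x ≠ y := by
      rcases h with ⟨⟨f⟩⟩ | ⟨⟨f⟩⟩
      exacts [hne _ _ f, (hne _ _ f).symm]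
    refine ⟨hxy, fun h0 => ?_⟩
    have := hc x y hxy
    rcases h with ⟨⟨f⟩⟩ | ⟨⟨f⟩⟩ <;> have := hpos _ _ f <;> omega
  have hblock : ∀ p p' : Σ i, Fin (t i).rank,
      Matrix.blockDiagonal' (fun i => (t i).cartan) p p' ≠ 0 →
      ∃ (i : Fin r) (a b : Fin (t i).rank), p = ⟨i, a⟩ ∧ p' = ⟨i, b⟩ ∧
        Matrix.blockDiagonal' (fun i => (t i).cartan) p p' = (t i).cartan a b := by
    rintro ⟨i, a⟩ ⟨i', b⟩ h
    by_cases hii : i = i'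
    · subst hii
      exact ⟨i, a, b, rfl, rfl, Matrix.blockDiagonal'_apply_eq _ _ _ _⟩
    · exact absurd (Matrix.blockDiagonal'_apply_ne _ _ _ hii) h
  refine _root_.exists_potential (fun x => o (e x).1 (e x).2) ?_ ?_ ?_
  · intro x y f heq
    obtain ⟨hxy, h0⟩ := hadj x y (.inl ⟨f⟩)
    obtain ⟨i, a, b, hx, hy, -⟩ := hblock _ _ h0
    rw [hx, hy] at heq
    have hab : a = b := ho_inj i heq
    exact hxy (e.injective (by rw [hx, hy, hab]))
  · intro x y f g
    obtain ⟨hxy, h0⟩ := hadj x y (.inl ⟨f⟩)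
    obtain ⟨i, a, b, hx, hy, hv⟩ := hblock _ _ h0
    have h1 := hc x y hxy
    rw [hv] at h1
    have hab : a ≠ b := by
      rintro rfl
      exact hxy (e.injective (by rw [hx, hy]))
    have := ho_ge i a b hab
    have := hpos _ _ f
    have := hpos _ _ g
    omega
  · intro x₁ x₂ y h₁ h₂ a₁ a₂
    obtain ⟨-, h01⟩ := hadj _ _ a₁
    obtain ⟨-, h02⟩ := hadj _ _ a₂
    obtain ⟨i, a, b, hx, hy, hv⟩ := hblock _ _ h01
    obtain ⟨i', a', b', hx', hy', hv'⟩ := hblock _ _ h02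
    obtain ⟨rfl, hb⟩ := Sigma.mk.inj (hy.symm.trans hy')
    obtain rfl := eq_of_heq hb
    rw [hv] at h01
    rw [hv'] at h02
    rw [hx, hy] at h₁
    rw [hx', hy] at h₂
    have haa : a = a' := ho_uniq i b a a' h₁ h₂ h01 h02
    exact e.injective (by rw [hx, hx', haa])

/-- Removing the last arrow of a path lowers the potential difference by one, and a negative
difference admits no path. Hence there is an induction on a strict bound for that difference. -/
theorem finite_path_of_potential [Finite V] [∀ x y : V, Finite (x ⟶ y)] (h : V → ℤ)
    (hh : ∀ x y : V, (x ⟶ y) → h y = h x + 1) (x y : V) : Finite (Quiver.Path x y) := by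
  have mono : ∀ {a b : V} (p : Quiver.Path a b), h a ≤ h b := by
    intro a b p
    induction p with
    | nil => exact le_rfl
    | cons p f ih => rw [hh _ _ f]; omega
  suffices H : ∀ (n : ℕ) (y : V), h y - h x < n → Finite (Quiver.Path x y) from
    H ((h y - h x).toNat + 1) y (by omega)
  intro n
  induction n with
  | zero =>
    intro y hy
    have : IsEmpty (Quiver.Path x y) := ⟨fun p => by have := mono p; omega⟩
    infer_instance
  | succ n ih =>
    intro y hy
    have hz : ∀ z : {z : V // Nonempty (z ⟶ y)}, Finite (Quiver.Path x z.1) := by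
      rintro ⟨z, ⟨f⟩⟩
      exact ih z (by have := hh _ _ f; push_cast at hy; omega)
    let Φ : (PLift (x = y) ⊕ Σ z : {z : V // Nonempty (z ⟶ y)}, Quiver.Path x z.1 × (z.1 ⟶ y)) →
        Quiver.Path x y := Sum.elim (fun e => e.down ▸ Quiver.Path.nil) fun s => s.2.1.cons s.2.2
    refine Finite.of_surjective Φ ?_
    rintro (_ | ⟨p, f⟩)
    · exact ⟨.inl ⟨rfl⟩, rfl⟩
    · exact ⟨.inr ⟨⟨_, ⟨f⟩⟩, p, f⟩, rfl⟩

theorem IsSimplyLacedDynkin.finite_path (hQ : IsSimplyLacedDynkin V) (x y : V) :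
    Finite (Quiver.Path x y) := by
  have := hQ.finite_vertices
  have := hQ.1
  obtain ⟨h, hh⟩ := hQ.exists_potential
  exact finite_path_of_potential h hh x y

end Quiver

/-! ### Representations of a quiver form a hereditary category -/

section FGModule

variable {k : Type u} [Field k]

theorem FGModuleCat.injective_of_mono {A B : FGModuleCat.{u} k} (f : A ⟶ B) [Mono f] :
    Function.Injective f.hom.hom := by
  have : Mono ((forget₂ (FGModuleCat k) (ModuleCat.{u} k)).map f) := inferInstance
  exact (ModuleCat.mono_iff_injective _).1 this

theorem FGModuleCat.surjective_of_epi {A B : FGModuleCat.{u} k} (f : A ⟶ B) [Epi f] :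
    Function.Surjective f.hom.hom := by
  have : Epi ((forget₂ (FGModuleCat k) (ModuleCat.{u} k)).map f) := inferInstance
  exact (ModuleCat.epi_iff_surjective _).1 this

instance FGModuleCat.injective (W : FGModuleCat.{u} k) : Injective W where
  factors {A B} g f hf := by
    obtain ⟨r, hr⟩ := LinearMap.exists_leftInverse_of_injective f.hom.hom
      (LinearMap.ker_eq_bot.2 (FGModuleCat.injective_of_mono f))
    refine ⟨ObjectProperty.homMk (ModuleCat.ofHom (g.hom.hom ∘ₗ r)), ?_⟩
    ext x
    exact congrArg g.hom.hom (LinearMap.congr_fun hr x)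

instance FGModuleCat.projective (W : FGModuleCat.{u} k) : Projective W where
  factors {A B} g f hf := by
    obtain ⟨s, hs⟩ := Module.projective_lifting_property f.hom.hom g.hom.hom
      (FGModuleCat.surjective_of_epi f)
    refine ⟨ObjectProperty.homMk (ModuleCat.ofHom s), ?_⟩
    ext x
    exact LinearMap.congr_fun hs x

end FGModule

/-! ### Functors on a path category have injective dimension at most one. -/

section PathFunctor

open Limits

variable {V : Type u} [Quiver.{u} V] {D : Type v} [Category.{w} D] [Abelian D]

/-- In terms of extensions: for the cokernel C of u, Ext¹(C, I) → Ext¹(C, Q) is onto, because an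
extension is a choice of one off-diagonal map per arrow, subject to no relation, and these maps lift
through p. Since Ext¹(C, I) = 0, the extension given by u splits. -/
theorem Paths.isSplitMono_of_injective_of_epi [∀ X : D, Projective X] {I Q E : Paths V ⥤ D}
    (p : I ⟶ Q) [Epi p] [Injective I] (u : Q ⟶ E) [Mono u] : ∃ r : E ⟶ Q, u ≫ r = 𝟙 Q := by
  let S : ShortComplex (Paths V ⥤ D) := ShortComplex.mk u (cokernel.π u) (cokernel.condition u)
  have hS : S.ShortExact := ShortComplex.ShortExact.mk'
    (ShortComplex.exact_cokernel u) inferInstance inferInstance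
  let Sx (x : Paths V) : ShortComplex D := S.map ((evaluation _ _).obj x)
  have hSx (x : Paths V) : (Sx x).ShortExact := hS.map_of_exact _
  let σ (x : Paths V) : (Sx x).Splitting :=
    have := (hSx x).epi_g
    ShortComplex.Splitting.ofExactOfSection _ (hSx x).exact
      (Projective.factorThru (𝟙 _) (Sx x).g) (Projective.factorThru_comp _ _) (hSx x).mono_f
  let C := cokernel u
  let π : E ⟶ C := cokernel.π u
  let s (x : Paths V) : C.obj x ⟶ E.obj x := (σ x).s
  let ρ (x : Paths V) : E.obj x ⟶ Q.obj x := (σ x).r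
  have hs (x) : s x ≫ π.app x = 𝟙 _ := (σ x).s_g
  have huρ (x) : u.app x ≫ ρ x = 𝟙 _ := (σ x).f_r
  have hid (x) : ρ x ≫ u.app x + π.app x ≫ s x = 𝟙 _ := (σ x).id
  have huπ (x) : u.app x ≫ π.app x = 0 := (Sx x).zero
  have hsρ (x) : s x ≫ ρ x = 0 := (σ x).s_r
  have hpx (x : Paths V) : Epi (p.app x) := inferInstance
  let arr {x y : Paths V} (a : @Quiver.Hom V _ x y) : x ⟶ y := Quiver.Hom.toPath (V := V) a
  -- In the vertexwise splitting E = Q ⊕ C, the arrow a acts by a triangular matrix. Its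
  -- off-diagonal entry C x ⟶ Q y is lifted to I y.
  let θ {x y : Paths V} (a : @Quiver.Hom V _ x y) : C.obj x ⟶ I.obj y :=
    Projective.factorThru (s x ≫ E.map (arr a) ≫ ρ y) (p.app y)
  have hθ {x y : Paths V} (a : @Quiver.Hom V _ x y) :
      θ a ≫ p.app y = s x ≫ E.map (arr a) ≫ ρ y :=
    Projective.factorThru_comp _ _
  let φ {x y : Paths V} (a : @Quiver.Hom V _ x y) : I.obj x ⊞ C.obj x ⟶ I.obj y ⊞ C.obj y :=
    biprod.desc (I.map (arr a) ≫ biprod.inl) (biprod.lift (θ a) (C.map (arr a)))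
  -- Freeness of the path category enters here: arbitrary maps on arrows define a functor. It is an
  -- extension of C by I that maps onto E.
  let E' : Paths V ⥤ D := Paths.lift
    { obj := fun x => I.obj x ⊞ C.obj x
      map := fun a => φ a }
  have hE' {x y : Paths V} (a : @Quiver.Hom V _ x y) : E'.map (arr a) = φ a :=
    Paths.lift_toPath _ a
  have hsE {x y : Paths V} (a : @Quiver.Hom V _ x y) : s x ≫ E.map (arr a) =
      θ a ≫ p.app y ≫ u.app y + C.map (arr a) ≫ s y := by
    have h1 := congrArg (fun t => s x ≫ E.map (arr a) ≫ t) (hid y)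
    simp only [Preadditive.comp_add, Category.comp_id] at h1
    rw [← h1, reassoc_of% (hθ a)]
    congr 1
    rw [π.naturality_assoc, ← Category.assoc, hs, Category.id_comp]
  have hι {x y : Paths V} (a : @Quiver.Hom V _ x y) :
      I.map (arr a) ≫ (biprod.inl : I.obj y ⟶ I.obj y ⊞ C.obj y) =
        (biprod.inl : I.obj x ⟶ I.obj x ⊞ C.obj x) ≫ E'.map (arr a) := by
    rw [hE']
    exact biprod.inl_desc _ _ |>.symm
  have hv {x y : Paths V} (a : @Quiver.Hom V _ x y) :
      E'.map (arr a) ≫ (biprod.desc (p.app y ≫ u.app y) (s y) : I.obj y ⊞ C.obj y ⟶ E.obj y) =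
        (biprod.desc (p.app x ≫ u.app x) (s x) : I.obj x ⊞ C.obj x ⟶ E.obj x) ≫
          E.map (arr a) := by
    rw [hE']
    change φ a ≫ biprod.desc (p.app y ≫ u.app y) (s y) = _
    refine biprod.hom_ext' _ _ ?_ ?_
    · simp [φ]
    · simp [φ, hsE, biprod.lift_desc]
  let ι : I ⟶ E' := Paths.liftNatTrans
    (fun x => (biprod.inl : I.obj x ⟶ I.obj x ⊞ C.obj x)) (fun a => hι a)
  let v : E' ⟶ E := Paths.liftNatTrans
    (fun x => (biprod.desc (p.app x ≫ u.app x) (s x) : I.obj x ⊞ C.obj x ⟶ E.obj x))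
    (fun a => hv a)
  obtain ⟨r, hr⟩ : ∃ r : E' ⟶ I, ι ≫ r = 𝟙 I := by
    have : Mono ι := by
      have : ∀ x, Mono (ι.app x) := fun x =>
        inferInstanceAs (Mono (biprod.inl : I.obj x ⟶ I.obj x ⊞ C.obj x))
      exact NatTrans.mono_of_mono_app ι
    exact ⟨Injective.factorThru (𝟙 I) ι, Injective.comp_factorThru _ _⟩
  let inl (x : Paths V) : I.obj x ⟶ E'.obj x := (biprod.inl : I.obj x ⟶ I.obj x ⊞ C.obj x)
  let inr (x : Paths V) : C.obj x ⟶ E'.obj x := (biprod.inr : C.obj x ⟶ I.obj x ⊞ C.obj x)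
  have hext (x : Paths V) {Z : D} {f g : E'.obj x ⟶ Z} (h₁ : inl x ≫ f = inl x ≫ g)
      (h₂ : inr x ≫ f = inr x ≫ g) : f = g := biprod.hom_ext' _ _ h₁ h₂
  have hlr (x : Paths V) : inl x ≫ r.app x = 𝟙 _ := congrArg (fun t => NatTrans.app t x) hr
  have hlv (x : Paths V) : inl x ≫ v.app x = p.app x ≫ u.app x := biprod.inl_desc _ _
  have hrv (x : Paths V) : inr x ≫ v.app x = s x := biprod.inr_desc _ _
  -- The vertexwise retraction ρ corrected by r on the C-summand. It is the map induced by `r ≫ p`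
  -- along the epimorphism v, which is why it is natural.
  let t (x : Paths V) : E.obj x ⟶ Q.obj x := ρ x + π.app x ≫ inr x ≫ r.app x ≫ p.app x
  have ht (x : Paths V) : v.app x ≫ t x = r.app x ≫ p.app x := by
    refine hext x ?_ ?_
    · rw [reassoc_of% (hlr x), reassoc_of% (hlv x)]
      simp [t, huρ, reassoc_of% (huπ x)]
    · rw [reassoc_of% (hrv x)]
      simp [t, hsρ, reassoc_of% (hs x)]
  have hepi (x : Paths V) : Epi (v.app x) := by
    refine Preadditive.epi_of_cancel_zero _ fun {Z} h hz => ?_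
    have h1 : u.app x ≫ h = 0 := by
      have := inl x ≫= hz
      rw [reassoc_of% (hlv x), comp_zero] at this
      exact zero_of_epi_comp _ this
    have h2 : s x ≫ h = 0 := by
      have := inr x ≫= hz
      rwa [reassoc_of% (hrv x), comp_zero] at this
    rw [← Category.id_comp h, ← hid x]
    simp [h1, h2]
  refine ⟨{ app := t, naturality := fun x y f => ?_ }, ?_⟩
  · have := hepi x
    rw [← cancel_epi (v.app x), ← v.naturality_assoc, ht, reassoc_of% (ht x), r.naturality_assoc,
      p.naturality]
  · ext x
    simp [t, huρ, reassoc_of% (huπ x)]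

/-- Extending g along f amounts to splitting the pushout of f along g, a monomorphism out of Q. -/
theorem Paths.injective_of_epi [∀ X : D, Projective X] {I Q : Paths V ⥤ D}
    (p : I ⟶ Q) [Epi p] [Injective I] : Injective Q where
  factors {A B} g f hf := by
    obtain ⟨r, hr⟩ := Paths.isSplitMono_of_injective_of_epi p (pushout.inl g f)
    exact ⟨pushout.inr g f ≫ r, by rw [← pushout.condition_assoc, hr, Category.comp_id]⟩

/-- The right adjoint of evaluation at x sends W to y ↦ W^Hom(y, x), which exists because there are
finitely many paths. It preserves injectives, and M embeds in the product over x of the objects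
cofreely generated by M x. -/
theorem Paths.exists_mono_injective [Finite V] [hV : ∀ x y : V, Finite (Quiver.Path x y)]
    [∀ X : D, Injective X] (M : Paths V ⥤ D) :
    ∃ (I : Paths V ⥤ D) (i : M ⟶ I), Injective I ∧ Mono i := by
  have : ∀ a b : Paths V, Finite (a ⟶ b) := hV
  have : Finite (Paths V) := inferInstanceAs (Finite V)
  let J (x : Paths V) : Paths V ⥤ D := (evaluationRightAdjoint D x).obj (M.obj x)
  have hJ (x : Paths V) : Injective (J x) :=
    Injective.injective_of_adjoint (evaluationAdjunctionLeft D x) _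
  let η (x : Paths V) : M ⟶ J x := (evaluationAdjunctionLeft D x).unit.app M
  refine ⟨∏ᶜ J, Pi.lift η, inferInstance, ?_⟩
  refine Preadditive.mono_of_cancel_zero _ fun {T} g hg => ?_
  ext x
  have h1 : g ≫ η x = 0 := by
    have := hg =≫ Pi.π J x
    simpa using this
  -- By the triangle identity the unit for the vertex x is a split monomorphism at x itself, so g
  -- vanishes there.
  have h2 := (evaluationAdjunctionLeft D x).left_triangle_components M
  have h3 : g.app x ≫ (η x).app x = 0 := congrArg (fun t => NatTrans.app t x) h1
  have h4 := g.app x ≫= h2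
  erw [← Category.assoc, h3] at h4
  rw [zero_comp] at h4
  exact ((Category.comp_id (g.app x)).symm.trans h4.symm)

theorem Paths.hasInjectiveDimensionLT_two [Finite V] [∀ x y : V, Finite (Quiver.Path x y)]
    [∀ X : D, Injective X] [∀ X : D, Projective X] (M : Paths V ⥤ D) :
    HasInjectiveDimensionLT M 2 := by
  obtain ⟨I, i, hI, hi⟩ := Paths.exists_mono_injective M
  have hS : (ShortComplex.mk i (cokernel.π i) (cokernel.condition i)).ShortExact :=
    ShortComplex.ShortExact.mk' (ShortComplex.exact_cokernel i) hi inferInstance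
  have : Injective (cokernel i) := Paths.injective_of_epi (cokernel.π i)
  exact (hS.hasInjectiveDimensionLT_X₃_iff 0 hI).1 (inferInstanceAs (HasInjectiveDimensionLT (cokernel i) 1))

end PathFunctor

/-! ### Short exact sequences with given end terms -/

section Extensions

open Limits Abelian

variable {C : Type u} [Category.{v} C] [Abelian C]

/-- The sequence `0 ⟶ N ⟶ E ⟶ M ⟶ 0` with maps `f` and `g` is exact. -/
def IsExt {N E M : C} (f : N ⟶ E) (g : E ⟶ M) : Prop :=
  ∃ h : f ≫ g = 0, (ShortComplex.mk f g h).ShortExact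

/-- The set of pairs `(f, g)` that make `0 ⟶ N ⟶ E ⟶ M ⟶ 0` exact. -/
abbrev HallPair (M N E : C) : Type v := {p : (N ⟶ E) × (E ⟶ M) // IsExt p.1 p.2}

namespace IsExt

variable {N E M : C} {f : N ⟶ E} {g : E ⟶ M}

theorem zero (h : IsExt f g) : f ≫ g = 0 := h.1

theorem shortExact (h : IsExt f g) : (ShortComplex.mk f g h.zero).ShortExact := h.2

theorem mono (h : IsExt f g) : Mono f := h.2.mono_f

theorem epi (h : IsExt f g) : Epi g := h.2.epi_g

theorem exists_lift (h : IsExt f g) {T : C} (t : T ⟶ E) (ht : t ≫ g = 0) :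
    ∃ s : T ⟶ N, s ≫ f = t :=
  have := h.mono
  ⟨h.2.exact.lift t ht, h.2.exact.lift_f t ht⟩

theorem exists_desc (h : IsExt f g) {T : C} (t : E ⟶ T) (ht : f ≫ t = 0) :
    ∃ s : M ⟶ T, g ≫ s = t :=
  have := h.epi
  ⟨h.2.exact.desc t ht, h.2.exact.g_desc t ht⟩

/-- With `of_desc`, this reduces exactness to the existence of factorizations; uniqueness is
automatic as f is mono and g is epi. -/
theorem of_lift (hz : f ≫ g = 0) (hf : Mono f) (hg : Epi g)
    (hl : ∀ (T : C) (t : T ⟶ E), t ≫ g = 0 → ∃ s : T ⟶ N, s ≫ f = t) : IsExt f g := by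
  refine ⟨hz, ShortComplex.ShortExact.mk' ?_ hf hg⟩
  rw [ShortComplex.exact_iff_exact_up_to_refinements]
  intro A t ht
  obtain ⟨s, hs⟩ := hl A t ht
  exact ⟨A, 𝟙 A, inferInstance, s, by simp [hs]⟩

theorem of_desc (hz : f ≫ g = 0) (hf : Mono f) (hg : Epi g)
    (hl : ∀ (T : C) (t : E ⟶ T), f ≫ t = 0 → ∃ s : M ⟶ T, g ≫ s = t) : IsExt f g := by
  refine of_lift hz hf hg fun T t ht => ?_
  obtain ⟨s, hs⟩ := hl _ (cokernel.π f) (cokernel.condition f)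
  have : t ≫ cokernel.π f = 0 := by rw [← hs, reassoc_of% ht, zero_comp]
  exact ⟨Abelian.monoLift f t this, Abelian.monoLift_comp _ _ _⟩

theorem of_mono (f : N ⟶ E) [Mono f] : IsExt f (cokernel.π f) :=
  ⟨cokernel.condition f, ShortComplex.ShortExact.mk' (ShortComplex.exact_cokernel f) inferInstance
    inferInstance⟩

theorem of_epi (g : E ⟶ M) [Epi g] : IsExt (kernel.ι g) g :=
  ⟨kernel.condition g, ShortComplex.ShortExact.mk' (ShortComplex.exact_kernel g) inferInstance
    inferInstance⟩

theorem comp_isos {N' E' M' : C} (h : IsExt f g) (a : N' ≅ N) (e : E ≅ E') (b : M ≅ M') :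
    IsExt (a.hom ≫ f ≫ e.hom) (e.inv ≫ g ≫ b.hom) := by
  have := h.mono
  have := h.epi
  refine of_lift (by simp [reassoc_of% h.zero]) inferInstance inferInstance fun T t ht => ?_
  obtain ⟨s, hs⟩ := h.exists_lift (t ≫ e.inv) (by
    rw [← cancel_mono b.hom]
    simpa using ht)
  exact ⟨s ≫ a.inv, by simp [reassoc_of% hs]⟩

theorem iso_left {N' : C} (h : IsExt f g) (a : N' ≅ N) : IsExt (a.hom ≫ f) g := by
  simpa using h.comp_isos a (Iso.refl _) (Iso.refl _)

theorem iso_right {M' : C} (h : IsExt f g) (b : M ≅ M') : IsExt f (g ≫ b.hom) := by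
  simpa using h.comp_isos (Iso.refl _) (Iso.refl _) b

theorem iso_middle {E' : C} (h : IsExt f g) (e : E ≅ E') : IsExt (f ≫ e.hom) (e.inv ≫ g) := by
  simpa using h.comp_isos (Iso.refl _) e (Iso.refl _)

theorem exists_iso_left {N' : C} {f' : N' ⟶ E} (h : IsExt f g) (h' : IsExt f' g) :
    ∃ a : N' ≅ N, a.hom ≫ f = f' := by
  have := h.mono
  have := h'.mono
  obtain ⟨s, hs⟩ := h.exists_lift f' h'.zero
  obtain ⟨t, ht⟩ := h'.exists_lift f h.zero
  exact ⟨⟨s, t, by rw [← cancel_mono f']; simp [ht, hs], by rw [← cancel_mono f]; simp [ht, hs]⟩, hs⟩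

theorem exists_iso_right {M' : C} {g' : E ⟶ M'} (h : IsExt f g) (h' : IsExt f g') :
    ∃ b : M ≅ M', g ≫ b.hom = g' := by
  have := h.epi
  have := h'.epi
  obtain ⟨s, hs⟩ := h.exists_desc g' h'.zero
  obtain ⟨t, ht⟩ := h'.exists_desc g h.zero
  exact ⟨⟨s, t, by rw [← cancel_epi g]; simp [ht, reassoc_of% hs],
    by rw [← cancel_epi g']; simp [hs, reassoc_of% ht]⟩, hs⟩

end IsExt

/-! ### Maps of extensions and their classes in Ext¹. -/

section Classes

/-- The maps of extensions over the identity of the quotient and a given map of the subobjects. -/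
def ExtHom {M N N' E E' : C} (z : HallPair M N E) (z' : HallPair M N' E') (c : N ⟶ N') : Type v :=
  {p : E ⟶ E' // z.1.1 ≫ p = c ≫ z'.1.1 ∧ p ≫ z'.1.2 = z.1.2}

variable {M N N' E E' : C} (z : HallPair M N E) (z' : HallPair M N' E') (c : N ⟶ N')

/-- Once nonempty, this set is a torsor under Hom(M, N'): two such maps differ by a map that kills N
and lands in N', that is, by `g ≫ h ≫ f'`. -/
theorem ExtHom.card_eq (h : Nonempty (ExtHom z z' c)) :
    Nat.card (ExtHom z z' c) = Nat.card (M ⟶ N') := by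
  obtain ⟨p, hp₁, hp₂⟩ := h
  obtain ⟨⟨f, g⟩, hz⟩ := z
  obtain ⟨⟨f', g'⟩, hz'⟩ := z'
  dsimp only at hz hz' hp₁ hp₂
  have := hz.epi
  have := hz'.mono
  symm
  refine Nat.card_congr (Equiv.ofBijective (fun h => ⟨p + g ≫ h ≫ f', ?_, ?_⟩) ⟨?_, ?_⟩)
  · simp [hp₁, reassoc_of% hz.zero]
  · simp [hp₂, hz'.zero]
  · intro h h' heq
    have := congrArg Subtype.val heq
    simpa [cancel_epi, cancel_mono] using this
  · rintro ⟨p', h₁, h₂⟩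
    dsimp only at h₁ h₂
    obtain ⟨t, ht⟩ := hz.exists_desc (p' - p) (by simp [h₁, hp₁])
    obtain ⟨s, hs⟩ := hz'.exists_lift t (by
      rw [← cancel_epi g, reassoc_of% ht]
      simp [h₂, hp₂])
    exact ⟨s, Subtype.ext (by simp [hs, ht])⟩

/-- The short five lemma, with identities on both ends. -/
theorem HallPair.isIso_of_comp {z : HallPair M N E} {z' : HallPair M N E'} (p : E ⟶ E')
    (h₁ : z.1.1 ≫ p = z'.1.1) (h₂ : p ≫ z'.1.2 = z.1.2) : IsIso p := by
  let φ : ShortComplex.mk _ _ z.2.zero ⟶ ShortComplex.mk _ _ z'.2.zero :=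
    { τ₁ := 𝟙 N, τ₂ := p, τ₃ := 𝟙 M
      comm₁₂ := by simpa using h₁.symm
      comm₂₃ := by simpa using h₂ }
  have : IsIso φ.τ₁ := inferInstanceAs (IsIso (𝟙 N))
  have : IsIso φ.τ₃ := inferInstanceAs (IsIso (𝟙 M))
  exact ShortComplex.isIso₂_of_shortExact_of_isIso₁₃ φ z.2.shortExact z'.2.shortExact

variable [HasExt.{w} C]

/-- The class in `Ext¹` of a short exact sequence. -/
noncomputable def HallPair.cls {M N E : C} (z : HallPair M N E) : Ext.{w} M N 1 :=
  z.2.shortExact.extClass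

theorem ExtHom.cls_eq {z : HallPair M N E} {z' : HallPair M N' E'} {c : N ⟶ N'}
    (p : ExtHom z z' c) : z.cls.comp (Ext.mk₀ c) (add_zero 1) = z'.cls := by
  have := ShortComplex.ShortExact.extClass_naturality z.2.shortExact z'.2.shortExact
    { τ₁ := c, τ₂ := p.1, τ₃ := 𝟙 M
      comm₁₂ := p.2.1.symm
      comm₂₃ := by simpa using p.2.2 }
  exact this.trans (Ext.mk₀_id_comp _)

/-- The obstruction to extending `c ≫ f'` from N to E is the pushforward of the class of z' along
f', which is zero. The extension p so obtained may induce some m other than the identity on M, and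
this is then corrected. -/
theorem ExtHom.nonempty (h : z.cls.comp (Ext.mk₀ c) (add_zero 1) = z'.cls) :
    Nonempty (ExtHom z z' c) := by
  obtain ⟨⟨f, g⟩, hz⟩ := z
  obtain ⟨⟨f', g'⟩, hz'⟩ := z'
  dsimp only [HallPair.cls] at h hz hz'
  have := hz.epi
  obtain ⟨x, hx⟩ := Ext.contravariant_sequence_exact₁ hz.shortExact _
    (Ext.mk₀ (c ≫ f')) (add_zero 1) (by
      rw [← Ext.mk₀_comp_mk₀, ← Ext.comp_assoc_of_second_deg_zero, h]
      exact hz'.shortExact.extClass_comp)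
  obtain ⟨p, rfl⟩ := Ext.homEquiv₀.symm.surjective x
  have hp : f ≫ p = c ≫ f' := by
    apply Ext.homEquiv₀.symm.injective
    simpa using hx
  obtain ⟨m, hm⟩ := hz.exists_desc (p ≫ g') (by rw [reassoc_of% hp, hz'.zero, comp_zero])
  have nat := ShortComplex.ShortExact.extClass_naturality hz.shortExact hz'.shortExact
    { τ₁ := c, τ₂ := p, τ₃ := m
      comm₁₂ := hp.symm
      comm₂₃ := hm.symm }
  dsimp only at nat
  rw [h] at nat
  -- By naturality, pulling back the class of z' along m leaves it unchanged, so `m - 𝟙 M` kills it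
  -- and lifts to some s : M ⟶ E'. Subtracting `g ≫ s` from p makes the induced map the identity.
  obtain ⟨y, hy⟩ := Ext.covariant_sequence_exact₃ _ hz'.shortExact (Ext.mk₀ (m - 𝟙 M))
    (zero_add 1) (by
      have hadd : Ext.mk₀ m = Ext.mk₀ (m - 𝟙 M) + Ext.mk₀ (𝟙 M) := by
        rw [← Ext.mk₀_add, sub_add_cancel]
      rw [hadd, Ext.add_comp, Ext.mk₀_id_comp] at nat
      exact left_eq_add.1 (nat.trans (add_comm _ _)))
  obtain ⟨s, rfl⟩ := Ext.homEquiv₀.symm.surjective y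
  have hs : s ≫ g' = m - 𝟙 M := by
    apply Ext.homEquiv₀.symm.injective
    simpa using hy
  exact ⟨⟨p - g ≫ s, by simp [hp, reassoc_of% hz.zero], by simp [hs, hm]⟩⟩

theorem ExtHom.card_eq_ite [Finite (M ⟶ N')]
    [Decidable (z.cls.comp (Ext.mk₀ c) (add_zero 1) = z'.cls)] :
    Nat.card (ExtHom z z' c) =
      if z.cls.comp (Ext.mk₀ c) (add_zero 1) = z'.cls then Nat.card (M ⟶ N') else 0 := by
  split_ifs with h
  · exact ExtHom.card_eq z z' c (ExtHom.nonempty z z' c h)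
  · have : IsEmpty (ExtHom z z' c) := ⟨fun p => h p.cls_eq⟩
    exact Nat.card_of_isEmpty

/-- Isomorphisms of the middle term of an extension correspond to extensions of the same class
together with a map of extensions. -/
noncomputable def HallPair.isoEquiv (z : HallPair M N E) (E' : C) :
    (E ≅ E') ≃ Σ z' : {z' : HallPair M N E' // z'.cls = z.cls}, ExtHom z z'.1 (𝟙 N) where
  toFun e :=
    have h : IsExt (z.1.1 ≫ e.hom) (e.inv ≫ z.1.2) := z.2.iso_middle e
    let p : ExtHom z ⟨(_, _), h⟩ (𝟙 N) := ⟨e.hom, by simp, by simp⟩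
    ⟨⟨⟨(_, _), h⟩, by rw [← p.cls_eq, Ext.comp_mk₀_id]⟩, p⟩
  invFun s :=
    have := HallPair.isIso_of_comp (z := z) (z' := s.1.1) s.2.1 (by simpa using s.2.2.1) s.2.2.2
    asIso s.2.1
  left_inv e := by ext; rfl
  right_inv := by
    rintro ⟨⟨⟨⟨f, g⟩, h⟩, hc⟩, ⟨p, h₁, h₂⟩⟩
    dsimp only at h₁ h₂
    have := HallPair.isIso_of_comp (z := z) (z' := ⟨(f, g), h⟩) p (by simpa using h₁) h₂
    have hf : f = z.1.1 ≫ p := by simpa using h₁.symm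
    have hg : g = inv p ≫ z.1.2 := by simp [← h₂]
    subst hf
    subst hg
    rfl

/-- Embed N in an injective I. The class comes from a map h : M ⟶ I/N under the connecting map, and
the pullback of I along h realizes it. -/
theorem HallPair.exists_cls_eq [EnoughInjectives C] (ξ : Ext.{w} M N 1) :
    ∃ (E : C) (z : HallPair M N E), z.cls = ξ := by
  let i : N ⟶ Injective.under N := Injective.ι N
  have hS := (IsExt.of_mono i).shortExact
  obtain ⟨x, hx⟩ := Ext.covariant_sequence_exact₁ _ hS ξ (Ext.eq_zero_of_injective _) (zero_add 1)
  obtain ⟨h, rfl⟩ := Ext.homEquiv₀.symm.surjective x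
  let f : N ⟶ pullback (cokernel.π i) h := pullback.lift i 0 (by simp)
  have hf : f ≫ pullback.fst _ _ = i := pullback.lift_fst _ _ _
  have hfg : f ≫ pullback.snd _ _ = 0 := pullback.lift_snd _ _ _
  have hm : Mono f := by
    have : Mono (f ≫ pullback.fst _ _) := by rw [hf]; infer_instance
    exact mono_of_mono f (pullback.fst _ _)
  have hz : IsExt f (pullback.snd (cokernel.π i) h) := by
    refine IsExt.of_lift hfg hm inferInstance fun T t ht => ?_
    obtain ⟨s, hs⟩ := (IsExt.of_mono i).exists_lift (t ≫ pullback.fst _ _) (by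
      rw [Category.assoc, pullback.condition, reassoc_of% ht, zero_comp])
    refine ⟨s, pullback.hom_ext ?_ ?_⟩
    · rw [Category.assoc, hf, hs]
    · rw [Category.assoc, hfg, ht, comp_zero]
  refine ⟨_, ⟨(f, pullback.snd _ _), hz⟩, ?_⟩
  have := ShortComplex.ShortExact.extClass_naturality hz.shortExact hS
    { τ₁ := 𝟙 N, τ₂ := pullback.fst _ _, τ₃ := h
      comm₁₂ := by simpa using hf.symm
      comm₂₃ := pullback.condition }
  exact (Ext.comp_mk₀_id _).symm.trans (this.trans hx)

end Classes

end Extensions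

/-! ### Counting over isomorphism classes -/

section Counting

open Limits Abelian

variable {C : Type u} [Category.{v} C]

theorem isoClass_eq_iff {X Y : C} : isoClass X = isoClass Y ↔ Nonempty (X ≅ Y) := by
  rw [isoClass, isoClass, Quotient.eq]
  rfl

theorem isoClass_out (e : IsoClass C) : isoClass e.out = e := Quotient.out_eq e

theorem nonempty_iso_out (X : C) : Nonempty ((isoClass X).out ≅ X) :=
  isoClass_eq_iff.1 (isoClass_out _)

/-- Composition with an isomorphism, on sets of isomorphisms. -/
def isoCongr {X X' Y Y' : C} (a : X ≅ X') (b : Y ≅ Y') : (X ≅ Y) ≃ (X' ≅ Y') where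
  toFun e := a.symm ≪≫ e ≪≫ b
  invFun e := a ≪≫ e ≪≫ b.symm
  left_inv e := by ext; simp
  right_inv e := by ext; simp

theorem autCard_congr {X Y : C} (e : X ≅ Y) : autCard X = autCard Y :=
  Nat.card_congr (isoCongr e e)

section Abelian

variable [Abelian C]

theorem hallP_eq (M N E : C) : hallP M N E = Nat.card (HallPair M N E) := rfl

theorem hallP_congr {M M' N N' E E' : C} (a : M ≅ M') (b : N ≅ N') (c : E ≅ E') :
    hallP M N E = hallP M' N' E' := by
  refine Nat.card_congr
    { toFun := fun z => ⟨(b.inv ≫ z.1.1 ≫ c.hom, c.inv ≫ z.1.2 ≫ a.hom),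
        IsExt.comp_isos z.2 b.symm c a⟩
      invFun := fun z => ⟨(b.hom ≫ z.1.1 ≫ c.inv, c.hom ≫ z.1.2 ≫ a.inv),
        IsExt.comp_isos z.2 b c.symm a.symm⟩
      left_inv := fun z => by ext <;> simp
      right_inv := fun z => by ext <;> simp }

theorem exists_of_hallP_ne_zero {M N E : C} (h : hallP M N E ≠ 0) : Nonempty (HallPair M N E) :=
  (Nat.card_ne_zero.1 h).1

/-! ### Associativity -/

section Assoc

variable (M N L F : C)

/-- Composable pairs of a monomorphism and an epimorphism with zero composition. -/
abbrev MonoEpi : Type v :=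
  {p : (L ⟶ F) × (F ⟶ M) // Mono p.1 ∧ Epi p.2 ∧ p.1 ≫ p.2 = 0}

variable {M L F}

/-- The ways to identify `N` with the subquotient, embedded in the cokernel. -/
abbrev SubCoker (s : MonoEpi M L F) : Type v :=
  {f : N ⟶ cokernel s.1.1 // IsExt f (cokernel.desc s.1.1 s.1.2 s.2.2.2)}

/-- The ways to identify `N` with the subquotient, as a quotient of the kernel. -/
abbrev QuotKer (s : MonoEpi M L F) : Type v :=
  {g : kernel s.1.2 ⟶ N // IsExt (kernel.lift s.1.2 s.1.1 s.2.2.2) g}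

/-- The isomorphism between ker(F ⟶ M) / L and ker(F / L ⟶ M). An identification f of N with the
latter determines one, g, with the former by requiring that `g ≫ f` be the canonical map from the
kernel to the cokernel. -/
theorem exists_quotKer_of_subCoker {s : MonoEpi M L F} (f : SubCoker N s) :
    ∃ g : QuotKer N s, g.1 ≫ f.1 = kernel.ι s.1.2 ≫ cokernel.π s.1.1 := by
  obtain ⟨⟨⟨a, b⟩, ha, hb, hab⟩, f, hf⟩ := s, f
  dsimp only at ha hb hab f hf ⊢
  have := hf.mono
  obtain ⟨g, hg⟩ := hf.exists_lift (kernel.ι b ≫ cokernel.π a) (by simp)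
  refine ⟨⟨g, IsExt.of_lift ?_ ?_ ?_ fun T t ht => ?_⟩, hg⟩
  · rw [← cancel_mono f, Category.assoc, hg]
    simp
  · exact mono_of_mono_fac (kernel.lift_ι b a hab)
  · rw [epi_iff_surjective_up_to_refinements]
    intro A y
    obtain ⟨A', π, hπ, x, hx⟩ := surjective_up_to_refinements_of_epi (cokernel.π a) (y ≫ f)
    have hxb : x ≫ b = 0 := by
      rw [← cokernel.π_desc a b hab, ← reassoc_of% hx, hf.zero]
      simp
    refine ⟨A', π, hπ, kernel.lift b x hxb, ?_⟩
    rw [← cancel_mono f, Category.assoc, Category.assoc, hg, kernel.lift_ι_assoc, hx]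
  · obtain ⟨r, hr⟩ := (IsExt.of_mono a).exists_lift (t ≫ kernel.ι b) (by
      rw [Category.assoc, ← hg, reassoc_of% ht, zero_comp])
    exact ⟨r, by rw [← cancel_mono (kernel.ι b), Category.assoc, kernel.lift_ι, hr]⟩

theorem exists_subCoker_of_quotKer {s : MonoEpi M L F} (g : QuotKer N s) :
    ∃ f : SubCoker N s, g.1 ≫ f.1 = kernel.ι s.1.2 ≫ cokernel.π s.1.1 := by
  obtain ⟨⟨⟨a, b⟩, ha, hb, hab⟩, g, hg⟩ := s, g
  dsimp only at ha hb hab g hg ⊢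
  have := hg.epi
  obtain ⟨f, hf⟩ := hg.exists_desc (kernel.ι b ≫ cokernel.π a) (by simp)
  refine ⟨⟨f, IsExt.of_desc ?_ ?_ ?_ fun T t ht => ?_⟩, hf⟩
  · rw [← cancel_epi g, reassoc_of% hf]
    simp
  · refine Preadditive.mono_of_cancel_zero _ fun {T} t ht => ?_
    obtain ⟨A', π, hπ, x, hx⟩ := surjective_up_to_refinements_of_epi g t
    obtain ⟨r, hr⟩ := (IsExt.of_mono a).exists_lift (x ≫ kernel.ι b) (by
      rw [Category.assoc, ← hf, ← reassoc_of% hx, ht, comp_zero])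
    have hx' : x = r ≫ kernel.lift b a hab := by
      rw [← cancel_mono (kernel.ι b), Category.assoc, kernel.lift_ι, hr]
    rw [← cancel_epi π, hx, hx', Category.assoc, hg.zero, comp_zero, comp_zero]
  · exact epi_of_epi_fac (cokernel.π_desc a b hab)
  · obtain ⟨r, hr⟩ := (IsExt.of_epi b).exists_desc (cokernel.π a ≫ t) (by
      rw [← Category.assoc, ← hf, Category.assoc, ht, comp_zero])
    exact ⟨r, by rw [← cancel_epi (cokernel.π a), cokernel.π_desc_assoc, hr]⟩

theorem nonempty_subCoker_equiv_quotKer (s : MonoEpi M L F) :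
    Nonempty (SubCoker N s ≃ QuotKer N s) := by
  choose φ hφ using fun f : SubCoker N s => exists_quotKer_of_subCoker N f
  choose ψ hψ using fun g : QuotKer N s => exists_subCoker_of_quotKer N g
  refine ⟨⟨φ, ψ, fun f => Subtype.ext ?_, fun g => Subtype.ext ?_⟩⟩
  · have := (φ f).2.epi
    rw [← cancel_epi (φ f).1, hφ, hψ]
  · have := (ψ g).2.mono
    rw [← cancel_mono (ψ g).1, hφ, hψ]

variable (M L F)

/-- The composite F ⟶ E ⟶ M and the inclusion of L form the mono-epi pair. The object E is then a
cokernel of the inclusion, and the remaining freedom is the isomorphism with E. -/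
theorem nonempty_equiv_subCoker (E : C) :
    Nonempty (HallPair M N E × HallPair E L F ≃
      Σ t : Σ s : MonoEpi M L F, SubCoker N s, (cokernel t.1.1.1 ≅ E)) := by
  let φ : (Σ t : Σ s : MonoEpi M L F, SubCoker N s, (cokernel t.1.1.1 ≅ E)) →
      HallPair M N E × HallPair E L F := fun t =>
    ⟨⟨(t.1.2.1 ≫ t.2.hom, t.2.inv ≫ cokernel.desc t.1.1.1.1 t.1.1.1.2 t.1.1.2.2.2),
      t.1.2.2.iso_middle t.2⟩,
      ⟨(t.1.1.1.1, cokernel.π t.1.1.1.1 ≫ t.2.hom),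
        have := t.1.1.2.1
        (IsExt.of_mono t.1.1.1.1).iso_right t.2⟩⟩
  refine ⟨(Equiv.ofBijective φ ⟨?_, ?_⟩).symm⟩
  · rintro ⟨⟨⟨⟨a, b⟩, ha, hb, hab⟩, f, hf⟩, e⟩ ⟨⟨⟨⟨a', b'⟩, ha', hb', hab'⟩, f', hf'⟩, e'⟩ h
    simp only [φ, Prod.mk.injEq, Subtype.mk.injEq] at h
    obtain ⟨⟨h₁, h₂⟩, h₃, h₄⟩ := h
    subst h₃
    have he : e = e' := by
      ext
      simpa using h₄
    subst he
    have hf : f = f' := by simpa using h₁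
    subst hf
    have hd : cokernel.desc a b hab = cokernel.desc a b' hab' := by simpa using h₂
    have hb : b = b' := by
      rw [← cokernel.π_desc a b hab, hd, cokernel.π_desc]
    subst hb
    rfl
  · rintro ⟨⟨⟨f, g⟩, hfg⟩, ⟨⟨a, b⟩, hab⟩⟩
    dsimp only at hfg hab
    have := hab.mono
    have := hab.epi
    have := hfg.epi
    obtain ⟨e, he⟩ := (IsExt.of_mono a).exists_iso_right hab
    have hz : a ≫ b ≫ g = 0 := by rw [reassoc_of% hab.zero, zero_comp]
    have hd : cokernel.desc a (b ≫ g) hz = e.hom ≫ g := by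
      rw [← cancel_epi (cokernel.π a), cokernel.π_desc, reassoc_of% he]
    refine ⟨⟨⟨⟨(a, b ≫ g), inferInstance, epi_comp _ _, hz⟩,
      ⟨f ≫ e.inv, ?_⟩⟩, e⟩, ?_⟩
    · dsimp only
      rw [hd]
      exact hfg.iso_middle e.symm
    · simp only [φ, Prod.mk.injEq, Subtype.mk.injEq]
      simp [hd, he]

/-- Dual bookkeeping: E is now the kernel of F ⟶ M, and N is a quotient of it. -/
theorem nonempty_equiv_quotKer (E : C) :
    Nonempty (HallPair N L E × HallPair M E F ≃
      Σ t : Σ s : MonoEpi M L F, QuotKer N s, (kernel t.1.1.2 ≅ E)) := by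
  let φ : (Σ t : Σ s : MonoEpi M L F, QuotKer N s, (kernel t.1.1.2 ≅ E)) →
      HallPair N L E × HallPair M E F := fun t =>
    ⟨⟨(kernel.lift t.1.1.1.2 t.1.1.1.1 t.1.1.2.2.2 ≫ t.2.hom, t.2.inv ≫ t.1.2.1),
      t.1.2.2.iso_middle t.2⟩,
      ⟨(t.2.inv ≫ kernel.ι t.1.1.1.2, t.1.1.1.2),
        have := t.1.1.2.2.1
        (IsExt.of_epi t.1.1.1.2).iso_left t.2.symm⟩⟩
  refine ⟨(Equiv.ofBijective φ ⟨?_, ?_⟩).symm⟩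
  · rintro ⟨⟨⟨⟨a, b⟩, ha, hb, hab⟩, f, hf⟩, e⟩ ⟨⟨⟨⟨a', b'⟩, ha', hb', hab'⟩, f', hf'⟩, e'⟩ h
    simp only [φ, Prod.mk.injEq, Subtype.mk.injEq] at h
    obtain ⟨⟨h₁, h₂⟩, h₃, h₄⟩ := h
    subst h₄
    have he : e = e' := by
      have : e.inv = e'.inv := by simpa [cancel_mono] using h₃
      rw [← Iso.symm_symm_eq e, ← Iso.symm_symm_eq e']
      congr 1
      ext
      simp [this]
    subst he
    have hf : f = f' := by simpa using h₂
    subst hf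
    have hd : kernel.lift b a hab = kernel.lift b a' hab' := by simpa using h₁
    have hb : a = a' := by
      rw [← kernel.lift_ι b a hab, hd, kernel.lift_ι]
    subst hb
    rfl
  · rintro ⟨⟨⟨f, g⟩, hfg⟩, ⟨⟨a, b⟩, hab⟩⟩
    dsimp only at hfg hab
    have := hab.mono
    have := hab.epi
    have := hfg.mono
    obtain ⟨e, he⟩ := hab.exists_iso_left (IsExt.of_epi b)
    have hz : (f ≫ a) ≫ b = 0 := by rw [Category.assoc, hab.zero, comp_zero]
    have hd : kernel.lift b (f ≫ a) hz = f ≫ e.inv := by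
      rw [← cancel_mono (kernel.ι b), kernel.lift_ι, ← he]
      simp
    refine ⟨⟨⟨⟨(f ≫ a, b), mono_comp _ _, inferInstance, hz⟩,
      ⟨e.hom ≫ g, ?_⟩⟩, e⟩, ?_⟩
    · dsimp only
      rw [hd]
      exact hfg.iso_middle e.symm
    · simp only [φ, Prod.mk.injEq, Subtype.mk.injEq]
      simp [hd, ← he]

end Assoc

end Abelian

/-! ### Weighted sums over isomorphism classes. -/

variable [∀ M N : C, Finite (M ⟶ N)]

instance finite_iso (X Y : C) : Finite (X ≅ Y) :=
  Finite.of_injective (fun e : X ≅ Y => e.hom) fun _ _ h => Iso.ext h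

theorem autCard_pos (X : C) : 0 < autCard X :=
  have : Finite (Aut X) := finite_iso X X
  have : Nonempty (Aut X) := ⟨Iso.refl X⟩
  Nat.card_pos

theorem autCard_ne_zero (X : C) : (autCard X : ℝ) ≠ 0 := Nat.cast_ne_zero.2 (autCard_pos X).ne'

/-- Only the class of X contributes, and there the isomorphisms form a torsor under the automorphism
group. -/
theorem sum_card_iso_div (X : C) (Q : Finset (IsoClass C)) (hX : isoClass X ∈ Q) :
    ∑ e ∈ Q, (Nat.card (X ≅ e.out) : ℝ) / autCard e.out = 1 := by
  rw [Finset.sum_eq_single (isoClass X)]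
  · obtain ⟨e⟩ := nonempty_iso_out X
    rw [← Nat.card_congr (isoCongr e (Iso.refl _))]
    exact div_self (autCard_ne_zero _)
  · intro e _ he
    have : IsEmpty (X ≅ e.out) := ⟨fun i => he (by rw [isoClass_eq_iff.2 ⟨i⟩, isoClass_out])⟩
    simp
  · exact fun h => absurd hX h

/-- If each configuration t determines the object E up to a chosen isomorphism, then summing with
weight 1 / aut(E) removes E from the count. -/
theorem sum_card_div_of_equiv {T : Type*} [Finite T] (Y : T → C) (X : C → Type*)
    (eqv : ∀ E : C, Nonempty (X E ≃ Σ t, (Y t ≅ E))) (Q : Finset (IsoClass C))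
    (hQ : ∀ t, isoClass (Y t) ∈ Q) :
    ∑ e ∈ Q, (Nat.card (X e.out) : ℝ) / autCard e.out = Nat.card T := by
  have := Fintype.ofFinite T
  have h (e : IsoClass C) : (Nat.card (X e.out) : ℝ) / autCard e.out =
      ∑ t, (Nat.card (Y t ≅ e.out) : ℝ) / autCard e.out := by
    obtain ⟨φ⟩ := eqv e.out
    rw [Nat.card_congr φ, Nat.card_sigma, Nat.cast_sum, Finset.sum_div]
  simp_rw [h]
  rw [Finset.sum_comm]
  simp_rw [fun t => sum_card_iso_div (Y t) Q (hQ t)]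
  simp

variable [Abelian C]

theorem hallP_ne_zero {M N E : C} (z : HallPair M N E) : hallP M N E ≠ 0 :=
  have : Nonempty (HallPair M N E) := ⟨z⟩
  (Nat.card_pos (α := HallPair M N E)).ne'

/-- After elimination of the middle object both sides count pairs L ⟶ F ⟶ M with zero composite
together with an identification of the subquotient with N. The finite sets only have to contain the
supports. -/
theorem hallP_assoc (M N L F : C) (Q Q' : Finset (IsoClass C)) (hQ : ∀ e, hallP M N e.out ≠ 0 → e ∈ Q)
    (hQ' : ∀ e, hallP N L e.out ≠ 0 → e ∈ Q') :
    ∑ e ∈ Q, (hallP M N e.out * hallP e.out L F : ℝ) / autCard e.out =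
      ∑ e ∈ Q', (hallP N L e.out * hallP M e.out F : ℝ) / autCard e.out := by
  have h₁ := sum_card_div_of_equiv (fun t : Σ s : MonoEpi M L F, SubCoker N s => cokernel t.1.1.1)
    (fun E => HallPair M N E × HallPair E L F) (nonempty_equiv_subCoker M N L F) Q (by
      intro t
      obtain ⟨e⟩ := nonempty_iso_out (cokernel t.1.1.1)
      apply hQ
      rw [hallP_congr (Iso.refl M) (Iso.refl N) e]
      exact hallP_ne_zero ⟨(t.2.1, _), t.2.2⟩)
  have h₂ := sum_card_div_of_equiv (fun t : Σ s : MonoEpi M L F, QuotKer N s => kernel t.1.1.2)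
    (fun E => HallPair N L E × HallPair M E F) (nonempty_equiv_quotKer M N L F) Q' (by
      intro t
      obtain ⟨e⟩ := nonempty_iso_out (kernel t.1.1.2)
      apply hQ'
      rw [hallP_congr (Iso.refl N) (Iso.refl L) e]
      exact hallP_ne_zero ⟨(_, t.2.1), t.2.2⟩)
  have h₃ : Nat.card (Σ s : MonoEpi M L F, SubCoker N s) =
      Nat.card (Σ s : MonoEpi M L F, QuotKer N s) :=
    Nat.card_congr (Equiv.sigmaCongrRight fun s =>
      (nonempty_subCoker_equiv_quotKer N s).some)
  rw [← h₃, ← h₁] at h₂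
  simpa [hallP_eq] using h₂.symm

end Counting

/-! ### Crosses and frames of three by three diagrams -/

section Green

open Limits Abelian

variable {C : Type u} [Category.{v} C] [Abelian C]

/-- The cross conditions say that f and f' factor through each other, so they define the same
subobject, and likewise g and g' the same quotient. -/
theorem IsExt.exists_isos {N N' E M M' : C} {f : N ⟶ E} {g : E ⟶ M} {f' : N' ⟶ E} {g' : E ⟶ M'}
    (h : IsExt f g) (h' : IsExt f' g') (h₁ : f ≫ g' = 0) (h₂ : f' ≫ g = 0) :
    ∃ (a : N ≅ N') (b : M ≅ M'), a.inv ≫ f = f' ∧ g ≫ b.hom = g' := by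
  have := h.mono
  have := h'.mono
  have := h.epi
  have := h'.epi
  obtain ⟨s, hs⟩ := h.exists_lift f' h₂
  obtain ⟨t, ht⟩ := h'.exists_lift f h₁
  obtain ⟨s', hs'⟩ := h.exists_desc g' h₁
  obtain ⟨t', ht'⟩ := h'.exists_desc g h₂
  refine ⟨⟨t, s, ?_, ?_⟩, ⟨s', t', ?_, ?_⟩, hs, hs'⟩
  · rw [← cancel_mono f]; simp [ht, hs]
  · rw [← cancel_mono f']; simp [ht, hs]
  · rw [← cancel_epi g]; simp [reassoc_of% hs', ht']
  · rw [← cancel_epi g']; simp [reassoc_of% ht', hs']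

/-- Two short exact sequences with the same middle term. -/
abbrev Cross (A B X D E : C) : Type v := HallPair A B E × HallPair X D E

/-- The four outer short exact sequences of a three by three diagram. -/
abbrev Frame (A B X D A₁ A₂ B₁ B₂ : C) : Type v :=
  (HallPair B₁ B₂ B × HallPair A₂ B₂ D) × (HallPair A₁ B₁ X × HallPair A₁ A₂ A)

variable {A B X D E A₁ A₂ B₁ B₂ : C}

/-- The outer sequences and the two middle sequences form a commutative diagram. -/
structure Compat (r : Frame A B X D A₁ A₂ B₁ B₂) (c : Cross A B X D E) : Prop where
  topLeft : r.1.1.1.1 ≫ c.1.1.1 = r.1.2.1.1 ≫ c.2.1.1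
  topRight : c.1.1.1 ≫ c.2.1.2 = r.1.1.1.2 ≫ r.2.1.1.1
  bottomLeft : c.2.1.1 ≫ c.1.1.2 = r.1.2.1.2 ≫ r.2.2.1.1
  bottomRight : c.1.1.2 ≫ r.2.2.1.2 = c.2.1.2 ≫ r.2.1.1.2

/-- The rows of the diagram are B₂ → B → B₁, D → E → X and A₂ → A → A₁; its columns are B₂ → D → A₂,
B → E → A and B₁ → X → A₁. With φ the composite B → E → X, the corners are the kernel, coimage and
cokernel of φ for B₂, B₁ and A₁, and D / B₂ for A₂. -/
theorem exists_compat_frame (c : Cross A B X D E) :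
    ∃ (A₁ A₂ B₁ B₂ : C) (r : Frame A B X D A₁ A₂ B₁ B₂), Compat r c := by
  obtain ⟨⟨⟨f, g⟩, hf⟩, ⟨⟨f', g'⟩, hf'⟩⟩ := c
  dsimp only at hf hf'
  have := hf.mono
  have := hf.epi
  have := hf'.mono
  have := hf'.epi
  let φ : B ⟶ X := f ≫ g'
  let b : kernel φ ⟶ B := kernel.ι φ
  have hb : b ≫ f ≫ g' = 0 := kernel.condition φ
  let c : Abelian.coimage φ ⟶ X := Abelian.factorThruCoimage φ
  have hc : cokernel.π b ≫ c = f ≫ g' := Abelian.coimage.fac φ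
  have hcE : IsExt c (cokernel.π φ) := by
    refine IsExt.of_desc ?_ inferInstance inferInstance fun T t ht => ?_
    · rw [← cancel_epi (cokernel.π b), reassoc_of% hc, comp_zero]
      exact (Category.assoc _ _ _).symm.trans (cokernel.condition φ)
    · refine ⟨cokernel.desc φ t ?_, cokernel.π_desc _ _ _⟩
      simp only [φ]
      rw [← hc, Category.assoc, ht, comp_zero]
  obtain ⟨d, hd⟩ := hf'.exists_lift (b ≫ f) (by rw [Category.assoc, hb])
  have : Mono d := by
    have : Mono (d ≫ f') := by rw [hd]; infer_instance
    exact mono_of_mono d f'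
  have hdg : d ≫ f' ≫ g = 0 := by rw [reassoc_of% hd, hf.zero, comp_zero]
  let a : cokernel d ⟶ A := cokernel.desc d (f' ≫ g) hdg
  have ha : cokernel.π d ≫ a = f' ≫ g := cokernel.π_desc _ _ _
  obtain ⟨a', ha'⟩ := hf.exists_desc (g' ≫ cokernel.π φ) (by
    exact (Category.assoc _ _ _).symm.trans (cokernel.condition φ))
  have haE : IsExt a a' := by
    refine IsExt.of_desc ?_ ?_ ?_ fun T t ht => ?_
    · rw [← cancel_epi (cokernel.π d), reassoc_of% ha, ha', reassoc_of% hf'.zero, zero_comp,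
        comp_zero]
    · refine Preadditive.mono_of_cancel_zero _ fun {T} t ht => ?_
      obtain ⟨T', π, hπ, x, hx⟩ := surjective_up_to_refinements_of_epi (cokernel.π d) t
      obtain ⟨s, hs⟩ := hf.exists_lift (x ≫ f') (by
        rw [Category.assoc, ← ha, ← reassoc_of% hx, ht, comp_zero])
      have hsφ : s ≫ φ = 0 := by
        simp only [φ]
        rw [reassoc_of% hs, hf'.zero, comp_zero]
      have hx' : x = kernel.lift φ s hsφ ≫ d := by
        rw [← cancel_mono f', Category.assoc, hd, kernel.lift_ι_assoc, hs]
      rw [← cancel_epi π, hx, hx', Category.assoc, cokernel.condition, comp_zero, comp_zero]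
    · exact epi_of_epi_fac ha'
    · obtain ⟨s, hs⟩ := hf'.exists_desc (g ≫ t) (by
        rw [← Category.assoc, ← ha, Category.assoc, ht, comp_zero])
      obtain ⟨s', hs'⟩ := hcE.exists_desc s (by
        rw [← cancel_epi (cokernel.π b), reassoc_of% hc, hs, reassoc_of% hf.zero, zero_comp,
          comp_zero])
      exact ⟨s', by rw [← cancel_epi g, reassoc_of% ha', hs', hs]⟩
  exact ⟨_, _, _, _, ((⟨(b, cokernel.π b), IsExt.of_mono b⟩, ⟨(d, cokernel.π d), IsExt.of_mono d⟩),
    (⟨(c, cokernel.π φ), hcE⟩, ⟨(a, a'), haE⟩)), ⟨hd.symm, hc.symm, ha.symm, ha'⟩⟩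

/-- The corners are forced by the cross as kernels and quotients, so two compatible frames differ by
exactly one isomorphism at each corner. -/
theorem nonempty_frame_equiv {A₁' A₂' B₁' B₂' : C} {c : Cross A B X D E}
    {r : Frame A B X D A₁ A₂ B₁ B₂} (hr : Compat r c) :
    Nonempty ({s : Frame A B X D A₁' A₂' B₁' B₂' // Compat s c} ≃
      ((A₁ ≅ A₁') × (A₂ ≅ A₂')) × ((B₁ ≅ B₁') × (B₂ ≅ B₂'))) := by
  obtain ⟨⟨⟨f, g⟩, hf⟩, ⟨⟨f', g'⟩, hf'⟩⟩ := c
  obtain ⟨⟨⟨⟨b, b'⟩, hb⟩, ⟨⟨d, d'⟩, hd⟩⟩, ⟨⟨⟨x, x'⟩, hx⟩, ⟨⟨a, a'⟩, ha⟩⟩⟩ := r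
  obtain ⟨h₁, h₂, h₃, h₄⟩ := hr
  dsimp only at hf hf' hb hd hx ha h₁ h₂ h₃ h₄
  have := hf.mono
  have := hf.epi
  have := hf'.mono
  have := hf'.epi
  have := hb.mono
  have := hb.epi
  have := hd.epi
  have := ha.epi
  let φ (i : ((A₁ ≅ A₁') × (A₂ ≅ A₂')) × ((B₁ ≅ B₁') × (B₂ ≅ B₂'))) :
      {s : Frame A B X D A₁' A₂' B₁' B₂' //
        Compat s ((⟨(f, g), hf⟩, ⟨(f', g'), hf'⟩) : Cross A B X D E)} :=
    ⟨((⟨(i.2.2.inv ≫ b, b' ≫ i.2.1.hom), (hb.iso_left i.2.2.symm).iso_right i.2.1⟩,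
        ⟨(i.2.2.inv ≫ d, d' ≫ i.1.2.hom), (hd.iso_left i.2.2.symm).iso_right i.1.2⟩),
      (⟨(i.2.1.inv ≫ x, x' ≫ i.1.1.hom), (hx.iso_left i.2.1.symm).iso_right i.1.1⟩,
        ⟨(i.1.2.inv ≫ a, a' ≫ i.1.1.hom), (ha.iso_left i.1.2.symm).iso_right i.1.1⟩)),
      ⟨by simp [h₁], by simp [h₂], by simp [h₃], by simp [reassoc_of% h₄]⟩⟩
  refine ⟨(Equiv.ofBijective φ ⟨?_, ?_⟩).symm⟩
  · rintro ⟨⟨α₁, α₂⟩, ⟨β₁, β₂⟩⟩ ⟨⟨α₁', α₂'⟩, ⟨β₁', β₂'⟩⟩ h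
    simp only [φ, Prod.mk.injEq, Subtype.mk.injEq] at h
    obtain ⟨⟨⟨e₁, e₂⟩, ⟨e₃, e₄⟩⟩, ⟨e₅, e₆⟩, ⟨e₇, e₈⟩⟩ := h
    simp only [Prod.mk.injEq]
    refine ⟨⟨Iso.ext ?_, Iso.ext ?_⟩, Iso.ext ?_, ?_⟩
    · exact (cancel_epi a').1 e₈
    · exact (cancel_epi d').1 e₄
    · exact (cancel_epi b').1 e₂
    · exact Iso.ext_inv ((cancel_mono b).1 e₁)
  · rintro ⟨⟨⟨⟨⟨p, p'⟩, hp⟩, ⟨⟨q, q'⟩, hq⟩⟩, ⟨⟨⟨y, y'⟩, hy⟩, ⟨⟨o, o'⟩, ho⟩⟩⟩, ⟨k₁, k₂, k₃, k₄⟩⟩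
    dsimp only at hp hq hy ho k₁ k₂ k₃ k₄
    have := hx.mono
    have := hy.mono
    obtain ⟨β₂, β₁, e₁, e₂⟩ := hb.exists_isos hp
      (by rw [← cancel_mono y, Category.assoc, ← k₂, h₂, reassoc_of% hb.zero, zero_comp, zero_comp])
      (by rw [← cancel_mono x, Category.assoc, ← h₂, k₂, reassoc_of% hp.zero, zero_comp, zero_comp])
    have e₃ : β₂.inv ≫ d = q := by
      rw [← cancel_mono f', Category.assoc, ← h₁, reassoc_of% e₁, k₁]
    have e₅ : β₁.inv ≫ x = y := by
      rw [Iso.inv_comp_eq, ← cancel_epi b', reassoc_of% e₂, ← k₂, h₂]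
    obtain ⟨β, α₂, -, e₄⟩ := hd.exists_isos hq
      (by rw [← cancel_epi β₂.inv, reassoc_of% e₃, hq.zero, comp_zero])
      (by rw [← e₃, Category.assoc, hd.zero, comp_zero])
    have e₇ : α₂.inv ≫ a = o := by
      rw [Iso.inv_comp_eq, ← cancel_epi d', reassoc_of% e₄, ← k₃, h₃]
    obtain ⟨α, α₁, -, e₈⟩ := ha.exists_isos ho
      (by rw [← cancel_epi α₂.inv, reassoc_of% e₇, ho.zero, comp_zero])
      (by rw [← e₇, Category.assoc, ha.zero, comp_zero])
    have e₆ : x' ≫ α₁.hom = y' := by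
      rw [← cancel_epi g', ← k₄, ← e₈, reassoc_of% h₄]
    refine ⟨((α₁, α₂), (β₁, β₂)), Subtype.ext ?_⟩
    simp only [φ, e₁, e₂, e₃, e₄, e₅, e₆, e₇, e₈]

/-! ### Completing a frame -/

section Completion

variable (r : Frame A B X D A₁ A₂ B₁ B₂)

/-- The amalgamated sum of the two subobjects of the middle term. -/
noncomputable abbrev Frame.po : C := pushout r.1.1.1.1 r.1.2.1.1

/-- The fibre product of the two quotients of the middle term. -/
noncomputable abbrev Frame.pb : C := pullback r.2.2.1.2 r.2.1.1.2

/-- The map from the amalgamated sum onto the sum of the off-diagonal corners. -/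
noncomputable def Frame.toSum : r.po ⟶ B₁ ⊞ A₂ :=
  pushout.desc (r.1.1.1.2 ≫ biprod.inl) (r.1.2.1.2 ≫ biprod.inr)
    (by rw [reassoc_of% r.1.1.2.zero, reassoc_of% r.1.2.2.zero, zero_comp, zero_comp])

/-- The map from the sum of the off-diagonal corners to the fibre product. -/
noncomputable def Frame.ofSum : B₁ ⊞ A₂ ⟶ r.pb :=
  biprod.desc (pullback.lift 0 r.2.1.1.1 (by rw [r.2.1.2.zero, zero_comp]))
    (pullback.lift r.2.2.1.1 0 (by rw [r.2.2.2.zero, zero_comp]))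

theorem Frame.inl_toSum : pushout.inl _ _ ≫ r.toSum = r.1.1.1.2 ≫ biprod.inl :=
  pushout.inl_desc _ _ _

theorem Frame.inr_toSum : pushout.inr _ _ ≫ r.toSum = r.1.2.1.2 ≫ biprod.inr :=
  pushout.inr_desc _ _ _

theorem Frame.ofSum_fst : r.ofSum ≫ pullback.fst _ _ = biprod.snd ≫ r.2.2.1.1 := by
  refine biprod.hom_ext' _ _ ?_ ?_
  · rw [Frame.ofSum, biprod.inl_desc_assoc, biprod.inl_snd_assoc, zero_comp]
    exact pullback.lift_fst _ _ _
  · rw [Frame.ofSum, biprod.inr_desc_assoc, biprod.inr_snd_assoc]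
    exact pullback.lift_fst _ _ _

theorem Frame.ofSum_snd : r.ofSum ≫ pullback.snd _ _ = biprod.fst ≫ r.2.1.1.1 := by
  refine biprod.hom_ext' _ _ ?_ ?_
  · rw [Frame.ofSum, biprod.inl_desc_assoc, biprod.inl_fst_assoc]
    exact pullback.lift_snd _ _ _
  · rw [Frame.ofSum, biprod.inr_desc_assoc, biprod.inr_fst_assoc, zero_comp]
    exact pullback.lift_snd _ _ _

/-- Amalgamating B and D over B₂ and dividing by B₂ leaves the sum of the quotients B / B₂ = B₁ and
D / B₂ = A₂. -/
theorem Frame.isExt_toSum : IsExt (r.1.1.1.1 ≫ pushout.inl _ _) r.toSum := by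
  have := r.1.1.2.mono
  have := r.1.1.2.epi
  have := r.1.2.2.mono
  have := r.1.2.2.epi
  refine IsExt.of_desc ?_ (mono_comp _ _) ?_ fun T t ht => ?_
  · rw [Category.assoc, r.inl_toSum, reassoc_of% r.1.1.2.zero, zero_comp]
  · refine Preadditive.epi_of_cancel_zero _ fun {T} t ht => ?_
    refine biprod.hom_ext' _ _ ?_ ?_
    · rw [← cancel_epi r.1.1.1.2, ← reassoc_of% r.inl_toSum, ht]
      simp
    · rw [← cancel_epi r.1.2.1.2, ← reassoc_of% r.inr_toSum, ht]
      simp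
  · obtain ⟨s, hs⟩ := r.1.1.2.exists_desc (pushout.inl _ _ ≫ t) (by simpa using ht)
    obtain ⟨s', hs'⟩ := r.1.2.2.exists_desc (pushout.inr _ _ ≫ t) (by
      rw [← pushout.condition_assoc]
      simpa using ht)
    refine ⟨biprod.desc s s', pushout.hom_ext ?_ ?_⟩
    · rw [reassoc_of% r.inl_toSum, biprod.inl_desc, hs]
    · rw [reassoc_of% r.inr_toSum, biprod.inr_desc, hs']

theorem Frame.isExt_ofSum : IsExt r.ofSum (pullback.fst _ _ ≫ r.2.2.1.2) := by
  have := r.2.1.2.mono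
  have := r.2.1.2.epi
  have := r.2.2.2.mono
  have := r.2.2.2.epi
  refine IsExt.of_lift ?_ ?_ (epi_comp _ _) fun T t ht => ?_
  · rw [reassoc_of% r.ofSum_fst, r.2.2.2.zero, comp_zero]
  · refine Preadditive.mono_of_cancel_zero _ fun {T} t ht => ?_
    refine biprod.hom_ext _ _ ?_ ?_
    · rw [← cancel_mono r.2.1.1.1, Category.assoc, ← r.ofSum_snd, reassoc_of% ht]
      simp
    · rw [← cancel_mono r.2.2.1.1, Category.assoc, ← r.ofSum_fst, reassoc_of% ht]
      simp
  · obtain ⟨s, hs⟩ := r.2.2.2.exists_lift (t ≫ pullback.fst _ _) (by simpa using ht)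
    obtain ⟨s', hs'⟩ := r.2.1.2.exists_lift (t ≫ pullback.snd _ _) (by
      rw [Category.assoc, ← pullback.condition]
      exact ht)
    refine ⟨biprod.lift s' s, pullback.hom_ext ?_ ?_⟩
    · rw [Category.assoc, r.ofSum_fst, biprod.lift_snd_assoc, hs]
    · rw [Category.assoc, r.ofSum_snd, biprod.lift_fst_assoc, hs']

theorem Frame.isExt_inl : IsExt (pushout.inl _ _) (r.toSum ≫ biprod.snd) := by
  have := r.1.2.2.mono
  have := r.isExt_toSum.epi
  refine IsExt.of_desc ?_ inferInstance (epi_comp _ _) fun T t ht => ?_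
  · rw [reassoc_of% r.inl_toSum, biprod.inl_snd, comp_zero]
  · obtain ⟨s, hs⟩ := r.1.2.2.exists_desc (pushout.inr _ _ ≫ t) (by
      rw [← pushout.condition_assoc, ht, comp_zero])
    refine ⟨s, pushout.hom_ext ?_ ?_⟩
    · rw [Category.assoc, reassoc_of% r.inl_toSum, biprod.inl_snd_assoc, zero_comp, comp_zero, ht]
    · rw [Category.assoc, reassoc_of% r.inr_toSum, biprod.inr_snd_assoc, hs]

theorem Frame.isExt_inr : IsExt (pushout.inr _ _) (r.toSum ≫ biprod.fst) := by
  have := r.1.1.2.mono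
  have := r.isExt_toSum.epi
  refine IsExt.of_desc ?_ inferInstance (epi_comp _ _) fun T t ht => ?_
  · rw [reassoc_of% r.inr_toSum, biprod.inr_fst, comp_zero]
  · obtain ⟨s, hs⟩ := r.1.1.2.exists_desc (pushout.inl _ _ ≫ t) (by
      rw [pushout.condition_assoc, ht, comp_zero])
    refine ⟨s, pushout.hom_ext ?_ ?_⟩
    · rw [Category.assoc, reassoc_of% r.inl_toSum, biprod.inl_fst_assoc, hs]
    · rw [Category.assoc, reassoc_of% r.inr_toSum, biprod.inr_fst_assoc, zero_comp, comp_zero, ht]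

/-- The extension of the last corner by the sum of the off-diagonal corners. -/
noncomputable def Frame.pbPair : HallPair A₁ (B₁ ⊞ A₂) r.pb :=
  ⟨(r.ofSum, pullback.fst _ _ ≫ r.2.2.1.2), r.isExt_ofSum⟩

/-- Recovers the cross: B and D enter E through the amalgamated sum, and A and X are quotients
through the fibre product. Exactness follows from the kernels of the two projections from the
amalgamated sum, B and D themselves. -/
theorem Frame.isExt_of_extHom (z : HallPair A₁ r.po E) (p : ExtHom z r.pbPair r.toSum) :
    IsExt (pushout.inl _ _ ≫ z.1.1) (p.1 ≫ pullback.fst _ _) ∧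
      IsExt (pushout.inr _ _ ≫ z.1.1) (p.1 ≫ pullback.snd _ _) := by
  obtain ⟨⟨i, π⟩, hz⟩ := z
  obtain ⟨p, hp₁, hp₂⟩ := p
  dsimp only [Frame.pbPair] at hz hp₁ hp₂ ⊢
  have := hz.mono
  have := hz.epi
  have := r.1.1.2.mono
  have := r.1.2.2.mono
  have := r.2.1.2.mono
  have := r.2.1.2.epi
  have := r.2.2.2.mono
  have := r.2.2.2.epi
  -- Surjectivity as in the five lemma: p is an epimorphism on the subobjects and the identity on
  -- the quotients A₁.
  have hep : Epi p := by
    refine Preadditive.epi_of_cancel_zero _ fun {T} t ht => ?_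
    have := r.isExt_toSum.epi
    obtain ⟨s, hs⟩ := r.isExt_ofSum.exists_desc t (by
      rw [← cancel_epi r.toSum, ← reassoc_of% hp₁, ht, comp_zero, comp_zero])
    have hs0 : s = 0 := by
      rw [← cancel_epi π, ← hp₂, Category.assoc, hs, ht, comp_zero]
    rw [← hs, hs0, comp_zero]
  have key₁ : i ≫ p ≫ pullback.fst _ _ = (r.toSum ≫ biprod.snd) ≫ r.2.2.1.1 := by
    rw [reassoc_of% hp₁, r.ofSum_fst, Category.assoc]
  have key₂ : i ≫ p ≫ pullback.snd _ _ = (r.toSum ≫ biprod.fst) ≫ r.2.1.1.1 := by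
    rw [reassoc_of% hp₁, r.ofSum_snd, Category.assoc]
  constructor
  · refine IsExt.of_lift ?_ (mono_comp _ _) (epi_comp _ _) fun T t ht => ?_
    · rw [Category.assoc, key₁, ← Category.assoc, r.isExt_inl.zero, zero_comp]
    · obtain ⟨s, hs⟩ := hz.exists_lift t (by
        rw [← hp₂, ← Category.assoc p, ← Category.assoc t, ht, zero_comp])
      obtain ⟨s', hs'⟩ := r.isExt_inl.exists_lift s (by
        rw [← cancel_mono r.2.2.1.1, Category.assoc, ← key₁, reassoc_of% hs, ht, zero_comp])
      exact ⟨s', by rw [reassoc_of% hs', hs]⟩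
  · refine IsExt.of_lift ?_ (mono_comp _ _) (epi_comp _ _) fun T t ht => ?_
    · rw [Category.assoc, key₂, ← Category.assoc, r.isExt_inr.zero, zero_comp]
    · obtain ⟨s, hs⟩ := hz.exists_lift t (by
        rw [← hp₂, pullback.condition, ← Category.assoc p, ← Category.assoc t, ht, zero_comp])
      obtain ⟨s', hs'⟩ := r.isExt_inr.exists_lift s (by
        rw [← cancel_mono r.2.1.1.1, Category.assoc, ← key₂, reassoc_of% hs, ht, zero_comp])
      exact ⟨s', by rw [reassoc_of% hs', hs]⟩

/-- Filling in the middle of a frame means giving B ⊔ D → E and E → A × X over the corners. The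
first map has cokernel A₁, and the pair is a map of extensions of A₁ lying over `toSum`. This turns
the count into one about Ext¹. -/
theorem Frame.nonempty_cross_equiv (E : C) :
    Nonempty ({c : Cross A B X D E // Compat r c} ≃
      Σ z : HallPair A₁ r.po E, ExtHom z r.pbPair r.toSum) := by
  let φ (s : Σ z : HallPair A₁ r.po E, ExtHom z r.pbPair r.toSum) :
      {c : Cross A B X D E // Compat r c} :=
    ⟨(⟨(pushout.inl _ _ ≫ s.1.1.1, s.2.1 ≫ pullback.fst _ _), (r.isExt_of_extHom s.1 s.2).1⟩,
      ⟨(pushout.inr _ _ ≫ s.1.1.1, s.2.1 ≫ pullback.snd _ _), (r.isExt_of_extHom s.1 s.2).2⟩), by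
      constructor
      · exact pushout.condition_assoc _
      · have := s.2.2.1
        dsimp only [Frame.pbPair] at this ⊢
        rw [Category.assoc, reassoc_of% this, reassoc_of% r.inl_toSum, r.ofSum_snd,
          biprod.inl_fst_assoc]
      · have := s.2.2.1
        dsimp only [Frame.pbPair] at this ⊢
        rw [Category.assoc, reassoc_of% this, reassoc_of% r.inr_toSum, r.ofSum_fst,
          biprod.inr_snd_assoc]
      · dsimp only
        rw [Category.assoc, pullback.condition, Category.assoc]⟩
  refine ⟨(Equiv.ofBijective φ ⟨?_, ?_⟩).symm⟩
  · rintro ⟨⟨⟨i, π⟩, hz⟩, ⟨p, hp₁, hp₂⟩⟩ ⟨⟨⟨i', π'⟩, hz'⟩, ⟨p', hp₁', hp₂'⟩⟩ h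
    simp only [φ, Prod.mk.injEq, Subtype.mk.injEq] at h
    obtain ⟨⟨e₁, e₂⟩, e₃, e₄⟩ := h
    obtain rfl : i = i' := pushout.hom_ext e₁ e₃
    obtain rfl : p = p' := pullback.hom_ext e₂ e₄
    obtain rfl : π = π' := hp₂.symm.trans hp₂'
    rfl
  · rintro ⟨⟨⟨⟨f, g⟩, hf⟩, ⟨⟨f', g'⟩, hf'⟩⟩, ⟨h₁, h₂, h₃, h₄⟩⟩
    dsimp only at hf hf' h₁ h₂ h₃ h₄
    have := hf.mono
    have := hf.epi
    have := r.1.1.2.mono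
    have := r.1.2.2.epi
    have := r.2.2.2.epi
    have := r.isExt_ofSum.mono
    let i : r.po ⟶ E := pushout.desc f f' h₁
    let p : E ⟶ r.pb := pullback.lift g g' h₄
    have hif : pushout.inl _ _ ≫ i = f := pushout.inl_desc _ _ _
    have hif' : pushout.inr _ _ ≫ i = f' := pushout.inr_desc _ _ _
    have hpg : p ≫ pullback.fst _ _ = g := pullback.lift_fst _ _ _
    have hpg' : p ≫ pullback.snd _ _ = g' := pullback.lift_snd _ _ _
    have hip : i ≫ p = r.toSum ≫ r.ofSum := by
      refine pushout.hom_ext ?_ ?_ <;> refine pullback.hom_ext ?_ ?_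
      · simp [hpg, reassoc_of% hif, hf.zero, r.ofSum_fst, reassoc_of% r.inl_toSum]
      · simp [hpg', reassoc_of% hif, h₂, r.ofSum_snd, reassoc_of% r.inl_toSum]
      · simp [hpg, reassoc_of% hif', h₃, r.ofSum_fst, reassoc_of% r.inr_toSum]
      · simp [hpg', reassoc_of% hif', hf'.zero, r.ofSum_snd, reassoc_of% r.inr_toSum]
    have hi : IsExt i (g ≫ r.2.2.1.2) := by
      refine IsExt.of_desc ?_ ?_ (epi_comp _ _) fun T t ht => ?_
      · refine pushout.hom_ext ?_ ?_
        · rw [reassoc_of% hif, reassoc_of% hf.zero, zero_comp, comp_zero]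
        · rw [reassoc_of% hif', reassoc_of% h₃, r.2.2.2.zero, comp_zero, comp_zero]
      · refine Preadditive.mono_of_cancel_zero _ fun {T} t ht => ?_
        obtain ⟨s, hs⟩ := r.isExt_toSum.exists_lift t (by
          rw [← cancel_mono r.ofSum, Category.assoc, ← hip, reassoc_of% ht, zero_comp, zero_comp])
        have hs0 : s = 0 := by
          rw [← cancel_mono r.1.1.1.1, ← cancel_mono f, zero_comp, zero_comp, ← ht, ← hs]
          simp [hif]
        rw [← hs, hs0, zero_comp]
      · have ht₁ : f ≫ t = 0 := by rw [← hif, Category.assoc, ht, comp_zero]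
        have ht₂ : f' ≫ t = 0 := by rw [← hif', Category.assoc, ht, comp_zero]
        obtain ⟨s, hs⟩ := hf.exists_desc t ht₁
        obtain ⟨s', hs'⟩ := r.2.2.2.exists_desc s (by
          rw [← cancel_epi r.1.2.1.2, ← reassoc_of% h₃, hs, ht₂, comp_zero])
        exact ⟨s', by rw [Category.assoc, hs', hs]⟩
    refine ⟨⟨⟨(i, g ≫ r.2.2.1.2), hi⟩, ⟨p, hip, ?_⟩⟩, Subtype.ext ?_⟩
    · dsimp only [Frame.pbPair]
      rw [reassoc_of% hpg]
    · simp only [φ, hif, hif', hpg, hpg']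

end Completion

end Green

/-! ### Cardinalities of `Ext` groups -/

section CardExact

theorem AddMonoidHom.card_ker_mul_card_range {G H : Type*} [AddGroup G] [AddGroup H] (f : G →+ H) :
    Nat.card f.ker * Nat.card f.range = Nat.card G := by
  rw [← AddSubgroup.index_ker, AddSubgroup.card_mul_index]

/-- The alternating product of orders along an exact sequence. It ends in a kernel, so nothing is
assumed about surjectivity of the last map. -/
theorem card_mul_card_of_exact {A₀ A₁ A₂ A₃ A₄ A₅ : Type*} [AddGroup A₀] [AddGroup A₁]
    [AddGroup A₂] [AddGroup A₃] [AddGroup A₄] [AddGroup A₅] (f₀ : A₀ →+ A₁) (f₁ : A₁ →+ A₂)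
    (f₂ : A₂ →+ A₃) (f₃ : A₃ →+ A₄) (f₄ : A₄ →+ A₅) (h₀ : Function.Injective f₀)
    (h₁ : f₀.range = f₁.ker) (h₂ : f₁.range = f₂.ker) (h₃ : f₂.range = f₃.ker)
    (h₄ : f₃.range = f₄.ker) :
    Nat.card A₀ * Nat.card A₂ * Nat.card f₄.ker = Nat.card A₁ * Nat.card A₃ := by
  rw [← f₁.card_ker_mul_card_range, ← f₂.card_ker_mul_card_range, ← f₃.card_ker_mul_card_range,
    ← h₁, ← h₂, ← h₃, ← h₄, Nat.card_congr (AddMonoidHom.ofInjective h₀).toEquiv]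
  ring

end CardExact

section ExtCard

open Limits Abelian

variable {C : Type u} [Category.{v} C] [Abelian C] [HasExt.{w} C]

theorem card_ext_covariant (T : C) {S : ShortComplex C} (hS : S.ShortExact) :
    Nat.card (Ext.{w} T S.X₁ 0) * Nat.card (Ext.{w} T S.X₃ 0) *
        Nat.card ((Ext.mk₀ S.g).postcomp T (add_zero 1)).ker =
      Nat.card (Ext.{w} T S.X₂ 0) * Nat.card (Ext.{w} T S.X₁ 1) := by
  have := hS.mono_f
  exact card_mul_card_of_exact ((Ext.mk₀ S.f).postcomp T (add_zero 0))
    ((Ext.mk₀ S.g).postcomp T (add_zero 0)) (hS.extClass.postcomp T (zero_add 1))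
    ((Ext.mk₀ S.f).postcomp T (add_zero 1)) ((Ext.mk₀ S.g).postcomp T (add_zero 1))
    (Ext.postcomp_mk₀_injective_of_mono T S.f)
    (ShortComplex.ab_exact_iff_range_eq_ker.1 (Ext.covariant_sequence_exact₂' T hS 0))
    (ShortComplex.ab_exact_iff_range_eq_ker.1 (Ext.covariant_sequence_exact₃' T hS 0 1 rfl))
    (ShortComplex.ab_exact_iff_range_eq_ker.1 (Ext.covariant_sequence_exact₁' T hS 0 1 rfl))
    (ShortComplex.ab_exact_iff_range_eq_ker.1 (Ext.covariant_sequence_exact₂' T hS 1))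

theorem card_ext_contravariant (T : C) {S : ShortComplex C} (hS : S.ShortExact) :
    Nat.card (Ext.{w} S.X₃ T 0) * Nat.card (Ext.{w} S.X₁ T 0) *
        Nat.card ((Ext.mk₀ S.f).precomp T (zero_add 1)).ker =
      Nat.card (Ext.{w} S.X₂ T 0) * Nat.card (Ext.{w} S.X₃ T 1) := by
  have := hS.epi_g
  exact card_mul_card_of_exact ((Ext.mk₀ S.g).precomp T (zero_add 0))
    ((Ext.mk₀ S.f).precomp T (zero_add 0)) (hS.extClass.precomp T (add_zero 1))
    ((Ext.mk₀ S.g).precomp T (zero_add 1)) ((Ext.mk₀ S.f).precomp T (zero_add 1))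
    (Ext.precomp_mk₀_injective_of_epi T S.g)
    (ShortComplex.ab_exact_iff_range_eq_ker.1 (Ext.contravariant_sequence_exact₂' hS T 0))
    (ShortComplex.ab_exact_iff_range_eq_ker.1 (Ext.contravariant_sequence_exact₁' hS T 0 1 rfl))
    (ShortComplex.ab_exact_iff_range_eq_ker.1 (Ext.contravariant_sequence_exact₃' hS T 0 1 rfl))
    (ShortComplex.ab_exact_iff_range_eq_ker.1 (Ext.contravariant_sequence_exact₂' hS T 1))

theorem card_ext_zero (M N : C) : Nat.card (Ext.{w} M N 0) = Nat.card (M ⟶ N) :=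
  Nat.card_congr Ext.homEquiv₀

theorem card_fiber_eq_card_ker {G H : Type*} [AddGroup G] [AddGroup H] (f : G →+ H)
    (hf : Function.Surjective f) (y : H) : Nat.card {x // f x = y} = Nat.card f.ker := by
  obtain ⟨x₀, rfl⟩ := hf y
  refine Nat.card_congr
    { toFun := fun x => ⟨x.1 - x₀, by simp [AddMonoidHom.mem_ker, x.2]⟩
      invFun := fun x => ⟨x.1 + x₀, by simp [(AddMonoidHom.mem_ker).1 x.2]⟩
      left_inv := fun x => by simp
      right_inv := fun x => by simp }

variable [∀ M N : C, Subsingleton (Ext.{w} M N 2)]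

/-- The obstruction to lifting lies in Ext²(T, X₁), which vanishes. -/
theorem postcomp_surjective_of_subsingleton (T : C) {S : ShortComplex C} (hS : S.ShortExact) :
    Function.Surjective ((Ext.mk₀ S.g).postcomp T (add_zero 1)) := fun x =>
  Ext.covariant_sequence_exact₃ T hS x (n₁ := 2) rfl (Subsingleton.elim _ _)

theorem precomp_surjective_of_subsingleton (T : C) {S : ShortComplex C} (hS : S.ShortExact) :
    Function.Surjective ((Ext.mk₀ S.f).precomp T (zero_add 1)) := fun x =>
  Ext.contravariant_sequence_exact₁ hS T x (n₁ := 2) rfl (Subsingleton.elim _ _)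

theorem card_euler_covariant (T : C) {S : ShortComplex C} (hS : S.ShortExact) :
    Nat.card (Ext.{w} T S.X₁ 0) * Nat.card (Ext.{w} T S.X₃ 0) * Nat.card (Ext.{w} T S.X₂ 1) =
      Nat.card (Ext.{w} T S.X₂ 0) * Nat.card (Ext.{w} T S.X₁ 1) * Nat.card (Ext.{w} T S.X₃ 1) := by
  rw [← ((Ext.mk₀ S.g).postcomp T (add_zero 1)).card_ker_mul_card_range, ← card_ext_covariant T hS,
    AddMonoidHom.range_eq_top.2 (postcomp_surjective_of_subsingleton T hS), AddSubgroup.card_top]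
  ring

theorem card_euler_contravariant (T : C) {S : ShortComplex C} (hS : S.ShortExact) :
    Nat.card (Ext.{w} S.X₃ T 0) * Nat.card (Ext.{w} S.X₁ T 0) * Nat.card (Ext.{w} S.X₂ T 1) =
      Nat.card (Ext.{w} S.X₂ T 0) * Nat.card (Ext.{w} S.X₃ T 1) * Nat.card (Ext.{w} S.X₁ T 1) := by
  rw [← ((Ext.mk₀ S.f).precomp T (zero_add 1)).card_ker_mul_card_range,
    ← card_ext_contravariant T hS,
    AddMonoidHom.range_eq_top.2 (precomp_surjective_of_subsingleton T hS), AddSubgroup.card_top]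
  ring

end ExtCard

/-! ### Green's formula -/

section GreenFormula

open Limits Abelian

variable {C : Type u} [Category.{v} C] [Abelian C] [∀ M N : C, Finite (M ⟶ N)]

/-! ### Riedtmann's formula. -/

section Riedtmann

variable [HasExt.{w} C] [EnoughInjectives C] {M N : C}

/-- Fix an extension E of class ξ. An isomorphism E ≅ E' transports it to an extension on E' of the
same class, and each such extension arises from |Hom(M, N)| isomorphisms. Dividing by aut(E') and
summing over E' gives 1. -/
theorem sum_card_cls_eq (ξ : Ext.{w} M N 1) (Q : Finset (IsoClass C))
    (hQ : ∀ (e : IsoClass C) (z : HallPair M N e.out), z.cls = ξ → e ∈ Q) :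
    ∑ e ∈ Q, (Nat.card {z : HallPair M N e.out // z.cls = ξ} : ℝ) / autCard e.out =
      1 / Nat.card (M ⟶ N) := by
  obtain ⟨E, z, rfl⟩ := HallPair.exists_cls_eq ξ
  have hpos : (Nat.card (M ⟶ N) : ℝ) ≠ 0 := Nat.cast_ne_zero.2 Nat.card_pos.ne'
  have key (E' : C) : Nat.card (E ≅ E') =
      Nat.card {z' : HallPair M N E' // z'.cls = z.cls} * Nat.card (M ⟶ N) := by
    have := Fintype.ofFinite {z' : HallPair M N E' // z'.cls = z.cls}
    have hfin (z' : {z' : HallPair M N E' // z'.cls = z.cls}) : Finite (ExtHom z z'.1 (𝟙 N)) :=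
      inferInstanceAs (Finite {p : E ⟶ E' // _})
    rw [Nat.card_congr (z.isoEquiv E'), Nat.card_sigma]
    have (z' : {z' : HallPair M N E' // z'.cls = z.cls}) :
        Nat.card (ExtHom z z'.1 (𝟙 N)) = Nat.card (M ⟶ N) :=
      ExtHom.card_eq _ _ _ (ExtHom.nonempty _ _ _ (by rw [Ext.comp_mk₀_id, z'.2]))
    simp [this]
  have hE : isoClass E ∈ Q := by
    obtain ⟨i⟩ := nonempty_iso_out E
    let s := z.isoEquiv _ i.symm
    exact hQ _ s.1.1 s.1.2
  rw [eq_div_iff hpos, Finset.sum_mul, ← sum_card_iso_div E Q hE]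
  refine Finset.sum_congr rfl fun e _ => ?_
  rw [key]
  push_cast
  ring

theorem sum_card_cls_mem [∀ M N : C, Finite (Ext.{w} M N 1)] (p : Ext.{w} M N 1 → Prop) (Q : Finset (IsoClass C))
    (hQ : ∀ (e : IsoClass C) (z : HallPair M N e.out), p z.cls → e ∈ Q) :
    ∑ e ∈ Q, (Nat.card {z : HallPair M N e.out // p z.cls} : ℝ) / autCard e.out =
      Nat.card {ξ : Ext.{w} M N 1 // p ξ} / Nat.card (M ⟶ N) := by
  have := Fintype.ofFinite {ξ : Ext.{w} M N 1 // p ξ}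
  have key (e : IsoClass C) : Nat.card {z : HallPair M N e.out // p z.cls} =
      ∑ ξ : {ξ : Ext.{w} M N 1 // p ξ}, Nat.card {z : HallPair M N e.out // z.cls = ξ.1} := by
    rw [← Nat.card_sigma]
    exact Nat.card_congr
      { toFun := fun z => ⟨⟨z.1.cls, z.2⟩, ⟨z.1, rfl⟩⟩
        invFun := fun s => ⟨s.2.1, by rw [s.2.2]; exact s.1.2⟩
        left_inv := fun z => rfl
        right_inv := by
          rintro ⟨⟨ξ, hξ⟩, ⟨z, hz⟩⟩
          dsimp only at hz
          subst hz
          rfl }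
  simp_rw [key, Nat.cast_sum, Finset.sum_div]
  rw [Finset.sum_comm, Finset.sum_congr rfl fun ξ _ => sum_card_cls_eq ξ.1 Q
    fun e z hz => hQ e z (by rw [hz]; exact ξ.2)]
  simp [Finset.sum_const, div_eq_mul_inv]

end Riedtmann

variable {A B X D : C}

theorem Finset.sum_product_product_mul {ι R : Type*} [CommSemiring R] (s : Finset ι)
    (f₁ f₂ f₃ f₄ : ι → R) :
    ∑ p ∈ (s ×ˢ s) ×ˢ (s ×ˢ s), (f₁ p.1.1 * f₂ p.1.2) * (f₃ p.2.1 * f₄ p.2.2) =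
      ((∑ i ∈ s, f₁ i) * ∑ i ∈ s, f₂ i) * ((∑ i ∈ s, f₃ i) * ∑ i ∈ s, f₄ i) := by
  rw [Finset.sum_mul_sum, Finset.sum_mul_sum, ← Finset.sum_product', ← Finset.sum_product',
    Finset.sum_mul_sum, ← Finset.sum_product']

/-- The compatible frames with prescribed corners are a product of four sets of isomorphisms, and
each weighted sum is 1. Hence frames may be inserted into a count of crosses at no cost. -/
theorem sum_card_compat_frame {E : C} (c : Cross A B X D E) (R : Finset (IsoClass C))
    (hA : ∀ m n : IsoClass C, hallP m.out n.out A ≠ 0 → m ∈ R ∧ n ∈ R)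
    (hB : ∀ m n : IsoClass C, hallP m.out n.out B ≠ 0 → m ∈ R ∧ n ∈ R) :
    ∑ p ∈ (R ×ˢ R) ×ˢ (R ×ˢ R),
      (Nat.card {r : Frame A B X D p.1.1.out p.1.2.out p.2.1.out p.2.2.out // Compat r c} : ℝ) /
        (autCard p.1.1.out * autCard p.1.2.out * (autCard p.2.1.out * autCard p.2.2.out)) = 1 := by
  obtain ⟨A₁, A₂, B₁, B₂, r, hr⟩ := exists_compat_frame c
  have mem {M N E : C} (z : HallPair M N E)
      (hE : ∀ m n : IsoClass C, hallP m.out n.out E ≠ 0 → m ∈ R ∧ n ∈ R) :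
      isoClass M ∈ R ∧ isoClass N ∈ R := by
    apply hE
    rw [hallP_congr (nonempty_iso_out M).some (nonempty_iso_out N).some (Iso.refl E)]
    exact hallP_ne_zero z
  obtain ⟨hA₁, hA₂⟩ := mem r.2.2 hA
  obtain ⟨hB₁, hB₂⟩ := mem r.1.1 hB
  have key (p : (IsoClass C × IsoClass C) × (IsoClass C × IsoClass C)) :
      (Nat.card {r : Frame A B X D p.1.1.out p.1.2.out p.2.1.out p.2.2.out // Compat r c} : ℝ) /
        (autCard p.1.1.out * autCard p.1.2.out * (autCard p.2.1.out * autCard p.2.2.out)) =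
      ((Nat.card (A₁ ≅ p.1.1.out) : ℝ) / autCard p.1.1.out *
        ((Nat.card (A₂ ≅ p.1.2.out) : ℝ) / autCard p.1.2.out)) *
      ((Nat.card (B₁ ≅ p.2.1.out) : ℝ) / autCard p.2.1.out *
        ((Nat.card (B₂ ≅ p.2.2.out) : ℝ) / autCard p.2.2.out)) := by
    obtain ⟨φ⟩ := nonempty_frame_equiv (A₁' := p.1.1.out) (A₂' := p.1.2.out) (B₁' := p.2.1.out)
      (B₂' := p.2.2.out) hr
    rw [Nat.card_congr φ, Nat.card_prod, Nat.card_prod, Nat.card_prod]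
    push_cast
    rw [div_mul_div_comm, div_mul_div_comm, div_mul_div_comm]
  simp_rw [key]
  have hsum := Finset.sum_product_product_mul R
    (fun e => (Nat.card (A₁ ≅ e.out) : ℝ) / autCard e.out)
    (fun e => (Nat.card (A₂ ≅ e.out) : ℝ) / autCard e.out)
    (fun e => (Nat.card (B₁ ≅ e.out) : ℝ) / autCard e.out)
    (fun e => (Nat.card (B₂ ≅ e.out) : ℝ) / autCard e.out)
  refine hsum.trans ?_
  rw [sum_card_iso_div _ _ hA₁, sum_card_iso_div _ _ hA₂, sum_card_iso_div _ _ hB₁,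
    sum_card_iso_div _ _ hB₂]
  norm_num

variable [HasExt.{w} C] [∀ M N : C, Finite (Ext.{w} M N 1)] [EnoughInjectives C]
  [∀ M N : C, Subsingleton (Ext.{w} M N 2)]

/-- Let P be the amalgamated sum. The admissible classes form a fibre of Ext¹(A₁, P) → Ext¹(A₁, B₁ ⊕
A₂), which is onto because Ext² = 0, so the fibre has the size of the kernel. Each extension of
admissible class carries |Hom(A₁, B₁ ⊕ A₂)| maps. The long exact sequence of B₂ → P → B₁ ⊕ A₂ then
cancels everything except the terms in B₂. -/
theorem sum_card_compat_cross {A₁ A₂ B₁ B₂ : C} (r : Frame A B X D A₁ A₂ B₁ B₂)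
    (Q : Finset (IsoClass C)) (hQ : ∀ e : IsoClass C, hallP A B e.out ≠ 0 → e ∈ Q) :
    ∑ e ∈ Q, (Nat.card {c : Cross A B X D e.out // Compat r c} : ℝ) / autCard e.out =
      Nat.card (Ext.{w} A₁ B₂ 1) / Nat.card (A₁ ⟶ B₂) := by
  classical
  let p (ξ : Ext.{w} A₁ r.po 1) : Prop :=
    ξ.comp (Ext.mk₀ r.toSum) (add_zero 1) = r.pbPair.cls
  have hfin {E : C} (z : HallPair A₁ r.po E) : Finite (ExtHom z r.pbPair r.toSum) :=
    inferInstanceAs (Finite {p : E ⟶ _ // _})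
  have key (e : IsoClass C) : Nat.card {c : Cross A B X D e.out // Compat r c} =
      Nat.card {z : HallPair A₁ r.po e.out // p z.cls} * Nat.card (A₁ ⟶ B₁ ⊞ A₂) := by
    have := Fintype.ofFinite (HallPair A₁ r.po e.out)
    have := Fintype.ofFinite {z : HallPair A₁ r.po e.out // p z.cls}
    rw [Nat.card_congr (r.nonempty_cross_equiv e.out).some, Nat.card_sigma]
    simp_rw [ExtHom.card_eq_ite]
    rw [← Finset.sum_filter, Finset.sum_const, smul_eq_mul,
      Nat.card_eq_fintype_card (α := {z : HallPair A₁ r.po e.out // p z.cls}),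
      Fintype.card_subtype]
  have hQ' (e : IsoClass C) (z : HallPair A₁ r.po e.out) (hz : p z.cls) : e ∈ Q := by
    obtain ⟨q⟩ := ExtHom.nonempty z r.pbPair r.toSum hz
    exact hQ e (hallP_ne_zero ((r.nonempty_cross_equiv e.out).some.symm ⟨z, q⟩).1.1)
  have hS := r.isExt_toSum.shortExact
  have hker : Nat.card {ξ : Ext.{w} A₁ r.po 1 // p ξ} =
      Nat.card ((Ext.mk₀ r.toSum).postcomp A₁ (add_zero 1)).ker :=
    card_fiber_eq_card_ker _ (postcomp_surjective_of_subsingleton A₁ hS) _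
  have hcard := card_ext_covariant A₁ hS
  rw [card_ext_zero, card_ext_zero, card_ext_zero] at hcard
  dsimp only at hcard
  rw [← hker] at hcard
  have h₁ : (Nat.card (A₁ ⟶ B₂) : ℝ) ≠ 0 := Nat.cast_ne_zero.2 Nat.card_pos.ne'
  have h₂ : (Nat.card (A₁ ⟶ r.po) : ℝ) ≠ 0 := Nat.cast_ne_zero.2 Nat.card_pos.ne'
  have hsum := sum_card_cls_mem p Q hQ'
  rw [Finset.sum_congr rfl fun e _ => show
    (Nat.card {c : Cross A B X D e.out // Compat r c} : ℝ) / autCard e.out =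
      (Nat.card {z : HallPair A₁ r.po e.out // p z.cls} : ℝ) / autCard e.out *
        Nat.card (A₁ ⟶ B₁ ⊞ A₂) by rw [key]; push_cast; ring, ← Finset.sum_mul, hsum]
  have hcard' : (Nat.card (A₁ ⟶ B₂) : ℝ) * Nat.card (A₁ ⟶ B₁ ⊞ A₂) *
      Nat.card {ξ : Ext.{w} A₁ r.po 1 // p ξ} =
      Nat.card (A₁ ⟶ r.po) * Nat.card (Ext.{w} A₁ B₂ 1) := by exact_mod_cast hcard
  field_simp
  linarith

/-- Pairs of a cross and a compatible frame are counted twice: summing first over frames gives the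
left side, summing first over the middle object E gives the right side. -/
theorem hallP_green (A B X D : C) (Q R : Finset (IsoClass C))
    (hQ : ∀ e : IsoClass C, hallP A B e.out ≠ 0 → e ∈ Q)
    (hA : ∀ m n : IsoClass C, hallP m.out n.out A ≠ 0 → m ∈ R ∧ n ∈ R)
    (hB : ∀ m n : IsoClass C, hallP m.out n.out B ≠ 0 → m ∈ R ∧ n ∈ R) :
    ∑ e ∈ Q, (hallP A B e.out * hallP X D e.out : ℝ) / autCard e.out =
      ∑ p ∈ (R ×ˢ R) ×ˢ (R ×ˢ R),
        (Nat.card (Ext.{w} p.1.1.out p.2.2.out 1) : ℝ) / Nat.card (p.1.1.out ⟶ p.2.2.out) *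
        (hallP p.2.1.out p.2.2.out B * hallP p.1.2.out p.2.2.out D *
          (hallP p.1.1.out p.2.1.out X * hallP p.1.1.out p.1.2.out A)) /
        (autCard p.1.1.out * autCard p.1.2.out * (autCard p.2.1.out * autCard p.2.2.out)) := by
  have hleft (e : IsoClass C) : (hallP A B e.out * hallP X D e.out : ℝ) / autCard e.out =
      ∑ p ∈ (R ×ˢ R) ×ˢ (R ×ˢ R), (Nat.card (Σ c : Cross A B X D e.out,
        {r : Frame A B X D p.1.1.out p.1.2.out p.2.1.out p.2.2.out // Compat r c}) : ℝ) /
        (autCard p.1.1.out * autCard p.1.2.out * (autCard p.2.1.out * autCard p.2.2.out)) /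
        autCard e.out := by
    have := Fintype.ofFinite (Cross A B X D e.out)
    rw [← Finset.sum_div]
    congr 1
    simp_rw [Nat.card_sigma, Nat.cast_sum, Finset.sum_div]
    rw [Finset.sum_comm, Finset.sum_congr rfl fun c _ => sum_card_compat_frame c R hA hB]
    rw [hallP_eq, hallP_eq, ← Nat.cast_mul, ← Nat.card_prod]
    simp
  rw [Finset.sum_congr rfl fun e _ => hleft e, Finset.sum_comm]
  refine Finset.sum_congr rfl fun p _ => ?_
  have := Fintype.ofFinite (Frame A B X D p.1.1.out p.1.2.out p.2.1.out p.2.2.out)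
  have hswap (e : IsoClass C) : Nat.card (Σ c : Cross A B X D e.out,
        {r : Frame A B X D p.1.1.out p.1.2.out p.2.1.out p.2.2.out // Compat r c}) =
      ∑ r : Frame A B X D p.1.1.out p.1.2.out p.2.1.out p.2.2.out,
        Nat.card {c : Cross A B X D e.out // Compat r c} := by
    rw [← Nat.card_sigma]
    exact Nat.card_congr
      { toFun := fun s => ⟨s.2.1, ⟨s.1, s.2.2⟩⟩
        invFun := fun s => ⟨s.2.1, ⟨s.1, s.2.2⟩⟩
        left_inv := fun s => rfl
        right_inv := fun s => rfl }
  simp_rw [hswap, Nat.cast_sum, Finset.sum_div]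
  rw [Finset.sum_comm]
  simp_rw [div_right_comm, ← Finset.sum_div, fun r => sum_card_compat_cross r Q hQ]
  rw [Finset.sum_const, nsmul_eq_mul, Finset.card_univ, ← Nat.card_eq_fintype_card,
    Nat.card_prod, Nat.card_prod, Nat.card_prod]
  simp only [hallP_eq]
  push_cast
  ring

end GreenFormula

/-! ### Finiteness properties of the category of representations -/

section FiniteClasses

open Limits Abelian

variable {C : Type u} [Category.{v} C] [Abelian C]

/-- Extensions with equal class have isomorphic middle terms, so the middle terms inject into the
finite group Ext¹(M, N). -/
theorem finite_setOf_hallP_middle [HasExt.{w} C] (M N : C) [Finite (Ext.{w} M N 1)] :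
    {e : IsoClass C | hallP M N e.out ≠ 0}.Finite := by
  have z (e : {e : IsoClass C | hallP M N e.out ≠ 0}) : HallPair M N (e.1.out : C) :=
    (exists_of_hallP_ne_zero e.2).some
  refine Set.finite_coe_iff.1 (Finite.of_injective (fun e => (z e).cls) fun e e' h => ?_)
  obtain ⟨p, h₁, h₂⟩ := ExtHom.nonempty (z e) (z e') (𝟙 N) (by rw [Ext.comp_mk₀_id]; exact h)
  have := HallPair.isIso_of_comp p (by simpa using h₁) h₂
  have := isoClass_eq_iff.2 ⟨asIso p⟩
  rw [isoClass_out, isoClass_out] at this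
  exact Subtype.ext this

/-- A subobject determines both ends of the sequence up to isomorphism. -/
theorem finite_setOf_hallP_ends (E : C) [Finite (Subobject E)] :
    {p : IsoClass C × IsoClass C | hallP p.1.out p.2.out E ≠ 0}.Finite := by
  have z (p : {p : IsoClass C × IsoClass C | hallP p.1.out p.2.out E ≠ 0}) :
      HallPair (p.1.1.out : C) p.1.2.out E := (exists_of_hallP_ne_zero p.2).some
  have hz (p) : Mono (z p).1.1 := (z p).2.mono
  refine Set.finite_coe_iff.1
    (Finite.of_injective (fun p => Subobject.mk (z p).1.1) fun p p' h => ?_)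
  let a := Subobject.isoOfMkEqMk _ _ h
  have ha : a.hom ≫ (z p').1.1 = (z p).1.1 := Subobject.ofMkLEMk_comp _
  have h' := (z p').2.iso_left a
  rw [ha] at h'
  obtain ⟨b, -⟩ := (z p).2.exists_iso_right h'
  have h₁ := isoClass_eq_iff.2 ⟨a⟩
  have h₂ := isoClass_eq_iff.2 ⟨b⟩
  rw [isoClass_out, isoClass_out] at h₁ h₂
  exact Subtype.ext (Prod.ext h₂ h₁)

end FiniteClasses

/-! ### Dimension, finiteness and the Euler form of representations. -/

namespace QuiverRep

open Limits Abelian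

variable {k : Type u} [Field k] {V : Type u} [Quiver.{u} V]

section Dim

variable [Fintype (Paths V)]

/-- The total dimension of a representation. -/
noncomputable def dim (M : QuiverRep k V) : ℕ := ∑ x : Paths V, Module.finrank k (M.obj x)

theorem dim_eq_add {S : ShortComplex (QuiverRep k V)} (hS : S.ShortExact) :
    dim S.X₂ = dim S.X₁ + dim S.X₃ := by
  rw [dim, dim, dim, ← Finset.sum_add_distrib]
  refine Finset.sum_congr rfl fun x _ => ?_
  have h := (hS.map_of_exact ((evaluation (Paths V) (FGModuleCat k)).obj x)).map_of_exact
    (forget₂ (FGModuleCat k) (ModuleCat.{u} k))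
  have : Module.Finite k ((S.map ((evaluation (Paths V) (FGModuleCat k)).obj x)).map
      (forget₂ (FGModuleCat k) (ModuleCat.{u} k))).X₁ :=
    inferInstanceAs (Module.Finite k (S.X₁.obj x))
  have : Module.Finite k ((S.map ((evaluation (Paths V) (FGModuleCat k)).obj x)).map
      (forget₂ (FGModuleCat k) (ModuleCat.{u} k))).X₃ :=
    inferInstanceAs (Module.Finite k (S.X₃.obj x))
  exact ModuleCat.free_shortExact_finrank_add h rfl rfl

theorem isZero_of_dim_eq_zero {M : QuiverRep k V} (h : dim M = 0) : IsZero M := by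
  refine Functor.isZero _ fun x => ?_
  have h0 : Module.finrank k (M.obj x) = 0 := Finset.sum_eq_zero_iff.1 h x (Finset.mem_univ _)
  have := Module.finrank_zero_iff.1 h0
  rw [IsZero.iff_id_eq_zero]
  ext y
  exact Subsingleton.elim _ _

end Dim

theorem exists_factor {N N' E : QuiverRep k V} (f : N ⟶ E) (g : N' ⟶ E) [Mono g]
    (h : ∀ x : Paths V, LinearMap.range (f.app x).hom.hom ≤ LinearMap.range (g.app x).hom.hom) :
    ∃ s : N ⟶ N', s ≫ g = f := by
  refine (IsExt.of_mono g).exists_lift f ?_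
  ext x y
  obtain ⟨y', hy'⟩ := h x ⟨y, rfl⟩
  have h0 : (g.app x ≫ (cokernel.π g).app x) = 0 := by
    rw [← NatTrans.comp_app, cokernel.condition]; rfl
  have h1 : ((cokernel.π g).app x).hom.hom ((g.app x).hom.hom y') = 0 :=
    congrArg (fun t => t.hom.hom y') h0
  rw [hy'] at h1
  exact h1

section FiniteField

variable [Finite V]

instance finite_hom [Finite k] (M N : QuiverRep k V) : Finite (M ⟶ N) := by
  have : Finite (Paths V) := inferInstanceAs (Finite V)
  have (W : FGModuleCat.{u} k) : Finite W := Module.finite_of_finite k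
  refine Finite.of_injective
    (fun (f : M ⟶ N) (x : Paths V) (y : M.obj x) => (f.app x).hom.hom y) fun f g h => ?_
  ext x y
  exact congrFun (congrFun h x) y

/-- A subobject is determined by its ranges at the vertices, which are subspaces of finite sets. -/
instance finite_subobject [Finite k] (E : QuiverRep k V) : Finite (Subobject E) := by
  have : Finite (Paths V) := inferInstanceAs (Finite V)
  have (W : FGModuleCat.{u} k) : Finite W := Module.finite_of_finite k
  have (W : FGModuleCat.{u} k) : Finite (Submodule k W) :=
    Finite.of_injective (fun S => (S : Set W)) SetLike.coe_injective
  refine Finite.of_injective (fun (S : Subobject E) (x : Paths V) =>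
    LinearMap.range (S.arrow.app x).hom.hom) fun S T h => ?_
  have le {S T : Subobject E} (h : ∀ x : Paths V, LinearMap.range (S.arrow.app x).hom.hom =
      LinearMap.range (T.arrow.app x).hom.hom) : S ≤ T := by
    obtain ⟨s, hs⟩ := exists_factor S.arrow T.arrow fun x => (h x).le
    exact Subobject.le_of_comm s hs
  exact le_antisymm (le fun x => congrFun h x) (le fun x => (congrFun h x).symm)

variable [∀ x y : V, Finite (Quiver.Path x y)]

instance enoughInjectives : EnoughInjectives (QuiverRep k V) where
  presentation M := by
    obtain ⟨I, i, hI, hi⟩ := Paths.exists_mono_injective M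
    exact ⟨⟨I, hI, i, hi⟩⟩

theorem subsingleton_ext (M N : QuiverRep k V) (i : ℕ) (hi : 2 ≤ i) :
    Subsingleton (repExt M N i) :=
  have := Paths.hasInjectiveDimensionLT_two N
  HasInjectiveDimensionLT.subsingleton N 2 i hi M

instance subsingleton_ext_two (M N : QuiverRep k V) : Subsingleton (repExt M N 2) :=
  subsingleton_ext M N 2 le_rfl

theorem eulerForm_eq (M N : QuiverRep k V) : eulerForm M N =
    (Module.finrank k (repExt M N 0) : ℤ) - Module.finrank k (repExt M N 1) := by
  rw [eulerForm, finsum_eq_sum_of_support_subset (s := Finset.range 2)]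
  · simp [Finset.sum_range_succ, sub_eq_add_neg]
  · intro i hi
    by_contra h
    have := subsingleton_ext M N i (by rw [Finset.coe_range, Set.mem_Iio] at h; omega)
    simp [Module.finrank_zero_of_subsingleton] at hi

variable [Finite k]

instance finite_ext_zero (M N : QuiverRep k V) : Finite (repExt M N 0) :=
  Finite.of_equiv _ Ext.homEquiv₀.symm

/-- Dimension shifting: for an injective I containing N, the group Hom(M, I/N) maps onto Ext¹(M, N).
-/
instance finite_ext_one (M N : QuiverRep k V) : Finite (repExt M N 1) := by
  have hS := (IsExt.of_mono (Injective.ι N)).shortExact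
  refine Finite.of_surjective (hS.extClass.postcomp M (zero_add 1)) fun x => ?_
  exact Ext.covariant_sequence_exact₁ _ hS x (Ext.eq_zero_of_injective _) (zero_add 1)

theorem finite_ext (M N : QuiverRep k V) (i : ℕ) : Finite (repExt M N i) := by
  match i with
  | 0 => infer_instance
  | 1 => infer_instance
  | i + 2 => have := subsingleton_ext M N (i + 2) (by omega); infer_instance

theorem card_ext (M N : QuiverRep k V) (i : ℕ) :
    Nat.card (repExt M N i) = Nat.card k ^ Module.finrank k (repExt M N i) :=
  have := finite_ext M N i
  Module.natCard_eq_pow_finrank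

/-- Identifies the weight in Green's formula with the coefficient of the braiding. -/
theorem cardUnit_zpow_neg_eulerForm (M N : QuiverRep k V) :
    ((cardUnit k ^ (-eulerForm M N) : ℝˣ) : ℝ) =
      (Nat.card (repExt M N 1) : ℝ) / Nat.card (M ⟶ N) := by
  have h0 : (Nat.card k : ℝ) ≠ 0 := Nat.cast_ne_zero.2 Nat.card_pos.ne'
  rw [← card_ext_zero.{u + 1}, card_ext, card_ext, Nat.cast_pow, Nat.cast_pow, eulerForm_eq, neg_sub,
    Units.val_zpow_eq_zpow_val, cardUnit, Units.val_mk0, zpow_sub₀ h0, zpow_natCast, zpow_natCast]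

/-- The long exact sequence gives an equality of powers of |k| > 1, and exponents can be compared.
-/
theorem eulerForm_add_right (T : QuiverRep k V) {S : ShortComplex (QuiverRep k V)}
    (hS : S.ShortExact) : eulerForm T S.X₂ = eulerForm T S.X₁ + eulerForm T S.X₃ := by
  have h := card_euler_covariant T hS
  simp only [card_ext, ← pow_add] at h
  have := Nat.pow_right_injective (Finite.one_lt_card (α := k)) h
  simp only [eulerForm_eq]
  omega

theorem eulerForm_add_left (T : QuiverRep k V) {S : ShortComplex (QuiverRep k V)}
    (hS : S.ShortExact) : eulerForm S.X₂ T = eulerForm S.X₁ T + eulerForm S.X₃ T := by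
  have h := card_euler_contravariant T hS
  simp only [card_ext, ← pow_add] at h
  have := Nat.pow_right_injective (Finite.one_lt_card (α := k)) h
  simp only [eulerForm_eq]
  omega

end FiniteField

end QuiverRep

/-! ### The Euler form on the Grothendieck group -/

section GrothendieckGroup

open Limits ZeroObject

variable {C : Type w} [Category.{v} C] [Abelian C] {A : Type*} [AddCommGroup A]

/-- An isomorphism X ≅ Y is a short exact sequence with third term 0, so φ Y = φ X + φ 0. The case X
= Y = 0 shows φ 0 = 0. -/
theorem eq_of_iso_of_additive (φ : C → A)
    (h : ∀ S : ShortComplex C, S.ShortExact → φ S.X₂ = φ S.X₁ + φ S.X₃) {X Y : C} (e : X ≅ Y) :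
    φ X = φ Y := by
  have key {X Y : C} (e : X ≅ Y) : φ Y = φ X + φ (0 : C) := by
    refine h (ShortComplex.mk e.hom (0 : Y ⟶ 0) comp_zero)
      (ShortComplex.ShortExact.mk' ?_ inferInstance ?_)
    · exact (ShortComplex.exact_iff_epi _ rfl).2 inferInstance
    · exact ⟨fun _ _ _ => (isZero_zero C).eq_of_src _ _⟩
  have h0 : φ (0 : C) = 0 := by simpa using key (Iso.refl (0 : C))
  rw [key e, h0, add_zero]

/-- The homomorphism from the Grothendieck group given by a function that is additive on short
exact sequences. -/
noncomputable def K0.lift (φ : C → A)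
    (h : ∀ S : ShortComplex C, S.ShortExact → φ S.X₂ = φ S.X₁ + φ S.X₃) : K0 C →+ A :=
  QuotientAddGroup.lift _
    (FreeAbelianGroup.lift (Quotient.lift φ fun _ _ e => eq_of_iso_of_additive φ h e.some)) <| by
    rw [AddSubgroup.closure_le]
    rintro _ ⟨S, hS, rfl⟩
    simp [h S hS]

theorem K0.lift_of (φ : C → A)
    (h : ∀ S : ShortComplex C, S.ShortExact → φ S.X₂ = φ S.X₁ + φ S.X₃) (M : C) :
    K0.lift φ h (K0.of M) = φ M := by
  simp [K0.lift, K0.of, K0.ofClass]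

theorem K0.of_add {S : ShortComplex C} (hS : S.ShortExact) :
    K0.of S.X₂ = K0.of S.X₁ + K0.of S.X₃ := by
  have : (QuotientAddGroup.mk (FreeAbelianGroup.of (isoClass S.X₁) +
      FreeAbelianGroup.of (isoClass S.X₃) - FreeAbelianGroup.of (isoClass S.X₂)) : K0 C) = 0 :=
    (QuotientAddGroup.eq_zero_iff _).2 (AddSubgroup.subset_closure ⟨S, hS, rfl⟩)
  exact (sub_eq_zero.1 this).symm

theorem K0.hom_ext {f g : K0 C →+ A} (h : ∀ M : C, f (K0.of M) = g (K0.of M)) : f = g := by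
  refine QuotientAddGroup.addMonoidHom_ext _ (FreeAbelianGroup.lift_ext _ _ fun x => ?_)
  obtain ⟨M, rfl⟩ := Quotient.exists_rep x
  exact h M

theorem K0.exists_bilinear (φ : C → C → A)
    (hl : ∀ (T : C) (S : ShortComplex C), S.ShortExact → φ S.X₂ T = φ S.X₁ T + φ S.X₃ T)
    (hr : ∀ (T : C) (S : ShortComplex C), S.ShortExact → φ T S.X₂ = φ T S.X₁ + φ T S.X₃) :
    ∃ χ : K0 C →+ K0 C →+ A, ∀ M N : C, χ (K0.of M) (K0.of N) = φ M N :=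
  ⟨K0.lift (fun M => K0.lift (φ M) (hr M)) fun S hS => K0.hom_ext fun N => by
    simp [K0.lift_of, hl N S hS], fun M N => by rw [K0.lift_of, K0.lift_of]⟩

end GrothendieckGroup

/-! ### The Hall algebra and coalgebra of a family of structure constants -/

section TensorFunctional

variable {M N M' N' : Type*} [AddCommMonoid M] [Module ℝ M] [AddCommMonoid N] [Module ℝ N]
  [AddCommMonoid M'] [Module ℝ M'] [AddCommMonoid N'] [Module ℝ N']

/-- The functional `x ⊗ y ↦ f x * g y`. -/
noncomputable def tensorFunctional (f : M →ₗ[ℝ] ℝ) (g : N →ₗ[ℝ] ℝ) : M ⊗[ℝ] N →ₗ[ℝ] ℝ :=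
  LinearMap.mul' ℝ ℝ ∘ₗ TensorProduct.map f g

@[simp]
theorem tensorFunctional_tmul (f : M →ₗ[ℝ] ℝ) (g : N →ₗ[ℝ] ℝ) (x : M) (y : N) :
    tensorFunctional f g (x ⊗ₜ y) = f x * g y := rfl

theorem tensorFunctional_map (f : M' →ₗ[ℝ] ℝ) (g : N' →ₗ[ℝ] ℝ) (F : M →ₗ[ℝ] M')
    (G : N →ₗ[ℝ] N') (t : M ⊗[ℝ] N) :
    tensorFunctional f g (TensorProduct.map F G t) = tensorFunctional (f ∘ₗ F) (g ∘ₗ G) t :=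
  LinearMap.congr_fun (TensorProduct.ext' fun _ _ => rfl :
    tensorFunctional f g ∘ₗ TensorProduct.map F G = tensorFunctional (f ∘ₗ F) (g ∘ₗ G)) t

theorem tensorFunctional_add_left (f f' : M →ₗ[ℝ] ℝ) (g : N →ₗ[ℝ] ℝ) :
    tensorFunctional (f + f') g = tensorFunctional f g + tensorFunctional f' g :=
  TensorProduct.ext' fun _ _ => by simp [add_mul]

theorem tensorFunctional_add_right (f : M →ₗ[ℝ] ℝ) (g g' : N →ₗ[ℝ] ℝ) :
    tensorFunctional f (g + g') = tensorFunctional f g + tensorFunctional f g' :=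
  TensorProduct.ext' fun _ _ => by simp [mul_add]

theorem tensorFunctional_smul_left (r : ℝ) (f : M →ₗ[ℝ] ℝ) (g : N →ₗ[ℝ] ℝ) :
    tensorFunctional (r • f) g = r • tensorFunctional f g :=
  TensorProduct.ext' fun _ _ => by simp [mul_assoc]

theorem tensorFunctional_smul_right (r : ℝ) (f : M →ₗ[ℝ] ℝ) (g : N →ₗ[ℝ] ℝ) :
    tensorFunctional f (r • g) = r • tensorFunctional f g :=
  TensorProduct.ext' fun _ _ => by simp [mul_left_comm]

theorem coord_tensorProduct {ι κ : Type*} (b : Module.Basis ι ℝ M) (c : Module.Basis κ ℝ N) (i : ι)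
    (j : κ) : (b.tensorProduct c).coord (i, j) = tensorFunctional (b.coord i) (c.coord j) :=
  TensorProduct.ext' fun _ _ => by simp [mul_comm]

theorem ext_tensorFunctional {ι κ : Type*} (b : Module.Basis ι ℝ M) (c : Module.Basis κ ℝ N)
    {t s : M ⊗[ℝ] N} (h : ∀ i j, tensorFunctional (b.coord i) (c.coord j) t =
      tensorFunctional (b.coord i) (c.coord j) s) : t = s := by
  refine (b.tensorProduct c).ext_elem fun ⟨i, j⟩ => ?_
  have := h i j
  rwa [← coord_tensorProduct] at this

end TensorFunctional

/-- Structure constants `P m n e` of a Hall algebra, with `a m` in the role of the number of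
automorphisms of `m`. -/
structure HallConstants (ι : Type u) where
  P : ι → ι → ι → ℝ
  a : ι → ℝ
  mid : ι → ι → Finset ι
  ends : ι → Finset (ι × ι)
  zero : ι
  size : ι → ℕ
  a_ne_zero (m : ι) : a m ≠ 0
  a_zero : a zero = 1
  mem_mid {m n e : ι} : P m n e ≠ 0 → e ∈ mid m n
  mem_ends {m n e : ι} : P m n e ≠ 0 → (m, n) ∈ ends e
  P_zero_right (m : ι) : P m zero m = a m
  P_zero_left (m : ι) : P zero m m = a m
  eq_of_P_zero_right {m e : ι} : P m zero e ≠ 0 → e = m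
  eq_of_P_zero_left {m e : ι} : P zero m e ≠ 0 → e = m
  size_eq {m n e : ι} : P m n e ≠ 0 → size e = size m + size n
  eq_zero_of_size {m : ι} : size m = 0 → m = zero
  assoc (m n l f : ι) : ∑ e ∈ mid m n, P m n e * P e l f / a e =
    ∑ e ∈ mid n l, P n l e * P m e f / a e

namespace HallConstants

variable {ι : Type u} (d : HallConstants ι)

/-- The basis vector given by an index. -/
noncomputable abbrev vec (m : ι) : ι →₀ ℝ := Finsupp.single m 1

/-- The multiplication. -/
noncomputable def mul : (ι →₀ ℝ) ⊗[ℝ] (ι →₀ ℝ) →ₗ[ℝ] ι →₀ ℝ :=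
  TensorProduct.lift <| Finsupp.linearCombination ℝ fun m => Finsupp.linearCombination ℝ fun n =>
    ∑ e ∈ d.mid m n, (d.P m n e / (d.a m * d.a n)) • vec e

theorem mul_vec (m n : ι) : d.mul (vec m ⊗ₜ vec n) =
    ∑ e ∈ d.mid m n, (d.P m n e / (d.a m * d.a n)) • vec e := by
  simp [mul]

theorem sum_mid_eq [DecidableEq ι] (m n : ι) (f : ι → ℝ) (e : ι) :
    (∑ e' ∈ d.mid m n, if e' = e then d.P m n e' * f e' else 0) = d.P m n e * f e := by
  rw [Finset.sum_ite_eq', ite_eq_left_iff]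
  intro h
  rw [not_not.1 (mt d.mem_mid h), zero_mul]

theorem mul_vec_apply (m n e : ι) :
    d.mul (vec m ⊗ₜ vec n) e = d.P m n e / (d.a m * d.a n) := by
  classical
  rw [mul_vec, Finsupp.finsetSum_apply]
  simpa [Finsupp.single_apply, div_eq_mul_inv] using d.sum_mid_eq m n (fun _ => (d.a m * d.a n)⁻¹) e

theorem vec_induction {p : (ι →₀ ℝ) → Prop} (x : ι →₀ ℝ) (zero : p 0)
    (add : ∀ x y, p x → p y → p (x + y)) (smul : ∀ (r : ℝ) x, p x → p (r • x))
    (vec : ∀ m, p (vec m)) : p x := by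
  induction x using Finsupp.induction_linear with
  | zero => exact zero
  | add x y hx hy => exact add x y hx hy
  | single m r => simpa [HallConstants.vec] using smul r _ (vec m)

theorem mul_assoc (x y z : ι →₀ ℝ) :
    d.mul (d.mul (x ⊗ₜ y) ⊗ₜ z) = d.mul (x ⊗ₜ d.mul (y ⊗ₜ z)) := by
  have key : d.mul ∘ₗ TensorProduct.map d.mul LinearMap.id = d.mul ∘ₗ
      TensorProduct.map LinearMap.id d.mul ∘ₗ
        (TensorProduct.assoc ℝ (ι →₀ ℝ) (ι →₀ ℝ) (ι →₀ ℝ)).toLinearMap := by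
    ext m n l f
    simp only [LinearMap.comp_apply, TensorProduct.AlgebraTensorModule.curry_apply,
      TensorProduct.curry_apply, LinearMap.restrictScalars_self, Finsupp.lsingle_apply,
      TensorProduct.map_tmul, LinearMap.id_apply, LinearEquiv.coe_coe, TensorProduct.assoc_tmul]
    rw [mul_vec, mul_vec, TensorProduct.sum_tmul, TensorProduct.tmul_sum, map_sum, map_sum,
      Finsupp.finsetSum_apply, Finsupp.finsetSum_apply]
    simp_rw [TensorProduct.tmul_smul, ← TensorProduct.smul_tmul', map_smul, Finsupp.smul_apply,
      mul_vec_apply, smul_eq_mul]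
    have h := d.assoc m n l f
    have h' := congrArg (fun t => t / (d.a m * d.a n * d.a l)) h
    simp only [Finset.sum_div] at h'
    convert h' using 2
    · ring
    · ring
  exact LinearMap.congr_fun key ((x ⊗ₜ y) ⊗ₜ z)

theorem P_zero_right_eq [DecidableEq ι] (m e : ι) :
    d.P m d.zero e = if e = m then d.a m else 0 := by
  split_ifs with h
  · rw [h, d.P_zero_right]
  · exact not_not.1 (mt d.eq_of_P_zero_right h)

theorem P_zero_left_eq [DecidableEq ι] (m e : ι) :
    d.P d.zero m e = if e = m then d.a m else 0 := by
  split_ifs with h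
  · rw [h, d.P_zero_left]
  · exact not_not.1 (mt d.eq_of_P_zero_left h)

theorem mul_zero (x : ι →₀ ℝ) : d.mul (x ⊗ₜ vec d.zero) = x := by
  classical
  induction x using vec_induction with
  | zero => simp
  | add x y hx hy => rw [TensorProduct.add_tmul, map_add, hx, hy]
  | smul r x hx => rw [← TensorProduct.smul_tmul', map_smul, hx]
  | vec m =>
    ext e
    have := d.a_ne_zero m
    rw [mul_vec_apply, P_zero_right_eq, d.a_zero, Finsupp.single_apply]
    simp only [eq_comm (a := e)]
    split_ifs <;> simp [this]

theorem zero_mul (x : ι →₀ ℝ) : d.mul (vec d.zero ⊗ₜ x) = x := by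
  classical
  induction x using vec_induction with
  | zero => simp
  | add x y hx hy => rw [TensorProduct.tmul_add, map_add, hx, hy]
  | smul r x hx => rw [TensorProduct.tmul_smul, map_smul, hx]
  | vec m =>
    ext e
    have := d.a_ne_zero m
    rw [mul_vec_apply, P_zero_left_eq, d.a_zero, Finsupp.single_apply]
    simp only [eq_comm (a := e)]
    split_ifs <;> simp [this]

/-! The comultiplication is the transpose of the multiplication with respect to the bilinear form
for which the basis is orthogonal and `m` has the square length `(a m)⁻¹`. -/

/-- The bilinear form. -/
noncomputable def pair : (ι →₀ ℝ) →ₗ[ℝ] (ι →₀ ℝ) →ₗ[ℝ] ℝ :=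
  Finsupp.linearCombination ℝ fun m => (d.a m)⁻¹ • Finsupp.lapply m

theorem pair_vec (m : ι) (x : ι →₀ ℝ) : d.pair (vec m) x = (d.a m)⁻¹ * x m := by
  simp [pair]

theorem pair_vec_right (m : ι) (x : ι →₀ ℝ) : d.pair x (vec m) = (d.a m)⁻¹ * x m := by
  classical
  induction x using vec_induction with
  | zero => simp
  | add x y hx hy => simp [hx, hy, mul_add]
  | smul r x hx => simp [hx, mul_left_comm]
  | vec n =>
    rw [pair_vec, Finsupp.single_apply, Finsupp.single_apply]
    simp only [eq_comm (a := n)]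
    split_ifs with h <;> simp [h]

theorem pair_vec_eq_smul_coord (m : ι) :
    d.pair (vec m) = (d.a m)⁻¹ • (Finsupp.basisSingleOne (R := ℝ)).coord m := by
  ext
  simp [pair_vec]

theorem coord_eq_smul_pair_vec (m : ι) :
    (Finsupp.basisSingleOne (R := ℝ)).coord m = d.a m • d.pair (vec m) := by
  rw [pair_vec_eq_smul_coord, smul_smul, mul_inv_cancel₀ (d.a_ne_zero m), one_smul]

theorem ext_pair {x y : ι →₀ ℝ} (h : ∀ z, d.pair z x = d.pair z y) : x = y := by
  ext m
  have := h (vec m)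
  rw [pair_vec, pair_vec] at this
  exact mul_left_cancel₀ (inv_ne_zero (d.a_ne_zero m)) this

theorem ext_pair₂ {t s : (ι →₀ ℝ) ⊗[ℝ] (ι →₀ ℝ)}
    (h : ∀ x y, tensorFunctional (d.pair (vec x)) (d.pair (vec y)) t =
      tensorFunctional (d.pair (vec x)) (d.pair (vec y)) s) : t = s := by
  refine ext_tensorFunctional Finsupp.basisSingleOne Finsupp.basisSingleOne fun i j => ?_
  simp only [d.coord_eq_smul_pair_vec, tensorFunctional_smul_left, tensorFunctional_smul_right,
    LinearMap.smul_apply, h]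

theorem ext_pair₃ {t s : (ι →₀ ℝ) ⊗[ℝ] ((ι →₀ ℝ) ⊗[ℝ] (ι →₀ ℝ))}
    (h : ∀ x y z, tensorFunctional (d.pair x) (tensorFunctional (d.pair y) (d.pair z)) t =
      tensorFunctional (d.pair x) (tensorFunctional (d.pair y) (d.pair z)) s) : t = s := by
  let b : Module.Basis ι ℝ (ι →₀ ℝ) := Finsupp.basisSingleOne
  have hb (m : ι) : b.coord m = d.a m • d.pair (vec m) := d.coord_eq_smul_pair_vec m
  refine ext_tensorFunctional b (b.tensorProduct b) fun i j => ?_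
  obtain ⟨j, l⟩ := j
  simp only [coord_tensorProduct, hb, tensorFunctional_smul_left,
    tensorFunctional_smul_right, LinearMap.smul_apply, h]

/-- The comultiplication. -/
noncomputable def comul : (ι →₀ ℝ) →ₗ[ℝ] (ι →₀ ℝ) ⊗[ℝ] (ι →₀ ℝ) :=
  Finsupp.linearCombination ℝ fun e =>
    ∑ p ∈ d.ends e, (d.P p.1 p.2 e / d.a e) • (vec p.2 ⊗ₜ[ℝ] vec p.1)

theorem comul_vec (e : ι) : d.comul (vec e) =
    ∑ p ∈ d.ends e, (d.P p.1 p.2 e / d.a e) • (vec p.2 ⊗ₜ[ℝ] vec p.1) := by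
  simp [comul]

theorem sum_ends_eq [DecidableEq ι] (m n e : ι) (f : ι → ι → ℝ) :
    (∑ p ∈ d.ends e, if p = (m, n) then d.P p.1 p.2 e * f p.1 p.2 else 0) =
      d.P m n e * f m n := by
  rw [Finset.sum_ite_eq', ite_eq_left_iff]
  intro h
  rw [not_not.1 (mt d.mem_ends h), MulZeroClass.zero_mul]

theorem finsuppTensorFinsupp_comul_vec (m n e : ι) :
    finsuppTensorFinsupp' ℝ ι ι (d.comul (vec e)) (n, m) = d.P m n e / d.a e := by
  classical
  rw [comul_vec, map_sum, Finsupp.finsetSum_apply, div_eq_mul_inv,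
    ← d.sum_ends_eq m n e fun _ _ => (d.a e)⁻¹]
  refine Finset.sum_congr rfl fun p _ => ?_
  rw [map_smul, Finsupp.smul_apply, finsuppTensorFinsupp'_single_tmul_single,
    Finsupp.single_apply, smul_eq_mul, div_eq_mul_inv]
  obtain ⟨p₁, p₂⟩ := p
  simp only [Prod.mk.injEq, and_comm (a := p₂ = n)]
  split_ifs <;> simp

/-- The transposition property. The factors are swapped because the coproduct puts the subobject
before the quotient, while the product puts the quotient first. -/
theorem tensorFunctional_pair_comul (x y u : ι →₀ ℝ) :
    tensorFunctional (d.pair y) (d.pair x) (d.comul u) = d.pair (d.mul (x ⊗ₜ y)) u := by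
  classical
  induction u using vec_induction with
  | zero => simp
  | add u v hu hv => rw [map_add, map_add, map_add, hu, hv]
  | smul r u hu => rw [map_smul, map_smul, map_smul, hu]
  | vec e =>
  induction x using vec_induction with
  | zero => simp [tensorFunctional]
  | add u v hu hv => rw [map_add, tensorFunctional_add_right, LinearMap.add_apply, hu, hv,
      TensorProduct.add_tmul, map_add, map_add, LinearMap.add_apply]
  | smul r u hu => rw [map_smul, tensorFunctional_smul_right, LinearMap.smul_apply, hu,
      ← TensorProduct.smul_tmul', map_smul, map_smul, LinearMap.smul_apply]
  | vec m =>
  induction y using vec_induction with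
  | zero => simp [tensorFunctional]
  | add u v hu hv => rw [map_add, tensorFunctional_add_left, LinearMap.add_apply, hu, hv,
      TensorProduct.tmul_add, map_add, map_add, LinearMap.add_apply]
  | smul r u hu => rw [map_smul, tensorFunctional_smul_left, LinearMap.smul_apply, hu,
      TensorProduct.tmul_smul, map_smul, map_smul, LinearMap.smul_apply]
  | vec n =>
    rw [pair_vec_right, mul_vec_apply, comul_vec, map_sum]
    refine Eq.trans ?_ ((d.sum_ends_eq m n e fun _ _ => (d.a e)⁻¹ * (d.a m * d.a n)⁻¹).trans
      (by ring))
    refine Finset.sum_congr rfl fun p _ => ?_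
    rw [map_smul, tensorFunctional_tmul, pair_vec, pair_vec, Finsupp.single_apply,
      Finsupp.single_apply, smul_eq_mul]
    obtain ⟨p₁, p₂⟩ := p
    simp only [Prod.mk.injEq]
    by_cases h₁ : p₁ = m <;> by_cases h₂ : p₂ = n <;> simp [h₁, h₂, div_eq_mul_inv]
    ring

/-- Pairing with three vectors turns both sides into pairings of u with the two bracketings of their
product. -/
theorem comul_assoc (u : ι →₀ ℝ) :
    TensorProduct.map LinearMap.id d.comul (d.comul u) =
      TensorProduct.assoc ℝ _ _ _ (TensorProduct.map d.comul LinearMap.id (d.comul u)) := by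
  refine d.ext_pair₃ fun x y z => ?_
  have h (f g h : (ι →₀ ℝ) →ₗ[ℝ] ℝ) (t : ((ι →₀ ℝ) ⊗[ℝ] (ι →₀ ℝ)) ⊗[ℝ] (ι →₀ ℝ)) :
      tensorFunctional f (tensorFunctional g h) (TensorProduct.assoc ℝ _ _ _ t) =
        tensorFunctional (tensorFunctional f g) h t :=
    LinearMap.congr_fun (TensorProduct.ext_threefold fun x y z => by simp [_root_.mul_assoc] :
      tensorFunctional f (tensorFunctional g h) ∘ₗ (TensorProduct.assoc ℝ _ _ _).toLinearMap =
        tensorFunctional (tensorFunctional f g) h) t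
  have h' (x y : ι →₀ ℝ) : tensorFunctional (d.pair y) (d.pair x) ∘ₗ d.comul =
      d.pair (d.mul (x ⊗ₜ y)) := LinearMap.ext fun u => d.tensorFunctional_pair_comul x y u
  rw [h, tensorFunctional_map, tensorFunctional_map, h', h', LinearMap.comp_id, LinearMap.comp_id,
    tensorFunctional_pair_comul, tensorFunctional_pair_comul, mul_assoc]

theorem pair_zero : d.pair (vec d.zero) = Finsupp.lapply d.zero := by
  ext; simp [pair_vec, d.a_zero]

theorem counit_comul (u : ι →₀ ℝ) :
    TensorProduct.map (Finsupp.lapply d.zero) LinearMap.id (d.comul u) = 1 ⊗ₜ u := by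
  have h (x : ι →₀ ℝ) (t : ℝ ⊗[ℝ] (ι →₀ ℝ)) :
      d.pair x (TensorProduct.lid ℝ _ t) = tensorFunctional LinearMap.id (d.pair x) t :=
    LinearMap.congr_fun (TensorProduct.ext' fun r y => by simp :
      d.pair x ∘ₗ (TensorProduct.lid ℝ _).toLinearMap =
        tensorFunctional LinearMap.id (d.pair x)) t
  refine (TensorProduct.lid ℝ _).injective (d.ext_pair fun x => ?_)
  rw [h, tensorFunctional_map, LinearMap.id_comp, LinearMap.comp_id, ← pair_zero,
    tensorFunctional_pair_comul, mul_zero, TensorProduct.lid_tmul, one_smul]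

theorem comul_counit (u : ι →₀ ℝ) :
    TensorProduct.map LinearMap.id (Finsupp.lapply d.zero) (d.comul u) = u ⊗ₜ 1 := by
  have h (x : ι →₀ ℝ) (t : (ι →₀ ℝ) ⊗[ℝ] ℝ) :
      d.pair x (TensorProduct.rid ℝ _ t) = tensorFunctional (d.pair x) LinearMap.id t :=
    LinearMap.congr_fun (TensorProduct.ext' fun y r => by simp [mul_comm] :
      d.pair x ∘ₗ (TensorProduct.rid ℝ _).toLinearMap =
        tensorFunctional (d.pair x) LinearMap.id) t
  refine (TensorProduct.rid ℝ _).injective (d.ext_pair fun x => ?_)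
  rw [h, tensorFunctional_map, LinearMap.id_comp, LinearMap.comp_id, ← pair_zero,
    tensorFunctional_pair_comul, zero_mul, TensorProduct.rid_tmul, one_smul]

/-- Sizes are natural numbers adding up to the size of the zero index, which is 0. -/
theorem eq_zero_of_P_zero {m n : ι} (h : d.P m n d.zero ≠ 0) : m = d.zero ∧ n = d.zero := by
  have h₀ : d.size d.zero = 0 := by
    have := d.size_eq (m := d.zero) (n := d.zero) (e := d.zero) (by
      rw [d.P_zero_right, d.a_zero]; exact one_ne_zero)
    omega
  have := d.size_eq h
  exact ⟨d.eq_zero_of_size (by omega), d.eq_zero_of_size (by omega)⟩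

theorem comul_zero : d.comul (vec d.zero) = vec d.zero ⊗ₜ vec d.zero := by
  rw [comul_vec, Finset.sum_eq_single (d.zero, d.zero)]
  · rw [d.P_zero_right, div_self (d.a_ne_zero _), one_smul]
  · rintro ⟨m, n⟩ - hp
    have : d.P m n d.zero = 0 := by
      by_contra h
      exact hp (Prod.ext (d.eq_zero_of_P_zero h).1 (d.eq_zero_of_P_zero h).2)
    rw [this, zero_div, zero_smul]
  · refine fun h => absurd (d.mem_ends ?_) h
    rw [d.P_zero_right]
    exact d.a_ne_zero _

/-- Multiplicativity of the counit, the transpose of the fact that the zero vector is group-like. -/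
theorem mul_apply_zero (x y : ι →₀ ℝ) : d.mul (x ⊗ₜ y) d.zero = x d.zero * y d.zero := by
  have := d.tensorFunctional_pair_comul x y (vec d.zero)
  rw [comul_zero, tensorFunctional_tmul, pair_vec_right, pair_vec_right, pair_vec_right,
    d.a_zero] at this
  simpa [mul_comm] using this.symm

/-- Pairing with D and X turns the coproduct of a product into the left side of a Green-type
identity with weights κ, and the product of coproducts into its right side. -/
theorem comul_mul_vec (κ : ι → ι → ℝ)
    (hκ : ∀ A B X D : ι, ∑ e ∈ d.mid A B, d.P A B e * d.P X D e / d.a e =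
      ∑ p ∈ d.ends A, ∑ r ∈ d.ends B, κ p.1 r.2 *
        (d.P r.1 r.2 B * d.P p.2 r.2 D * (d.P p.1 r.1 X * d.P p.1 p.2 A)) /
          (d.a p.1 * d.a p.2 * (d.a r.1 * d.a r.2))) (A B : ι) :
    d.comul (d.mul (vec A ⊗ₜ vec B)) = ∑ p ∈ d.ends A, ∑ r ∈ d.ends B,
      (d.P p.1 p.2 A / d.a A * (d.P r.1 r.2 B / d.a B) * κ p.1 r.2) •
        (d.mul (vec p.2 ⊗ₜ vec r.2) ⊗ₜ d.mul (vec p.1 ⊗ₜ vec r.1)) := by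
  refine d.ext_pair₂ fun D X => ?_
  rw [tensorFunctional_pair_comul, d.mul_vec A B, map_sum, map_sum]
  simp_rw [map_sum, map_smul, tensorFunctional_tmul, pair_vec, pair_vec_right, mul_vec_apply,
    smul_eq_mul]
  have h := congrArg (fun t => t / (d.a A * d.a B * (d.a X * d.a D))) (hκ A B X D)
  simp only [Finset.sum_div] at h
  convert h using 2
  · ring
  · refine Finset.sum_congr rfl fun r _ => ?_
    ring

/-! ### Inverses under convolution, by recursion on the size -/

section Recursion

variable {H : Type*} [AddCommGroup H] [Module ℝ H]

/-- The solution of `∑ p ∈ S e, c e p • β p.2 (T p.1) = r e`; see `sum_solve`. -/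
noncomputable def solve (size : ι → ℕ) (S : ι → Finset (ι × ι)) (c : ι → ι × ι → ℝ) (β : ι → H →ₗ[ℝ] H)
    (r : ι → H) (e : ι) : H :=
  r e - ∑ p ∈ S e, if _ : size p.1 < size e then c e p • β p.2 (solve size S c β r p.1) else 0
termination_by size e

/-- The system is triangular. In a term with nonzero coefficient and p.2 not the zero index, p.1 has
strictly smaller size; the only other such term is (e, zero), which contributes the unknown at e
with coefficient 1. -/
theorem sum_solve (S : ι → Finset (ι × ι)) (c : ι → ι × ι → ℝ) (β : ι → H →ₗ[ℝ] H) (r : ι → H)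
    (hS : ∀ e, (e, d.zero) ∈ S e) (hc : ∀ e, c e (e, d.zero) = 1)
    (hc' : ∀ e m, c e (m, d.zero) ≠ 0 → m = e)
    (hsize : ∀ e p, c e p ≠ 0 → d.size e = d.size p.1 + d.size p.2)
    (hβ : β d.zero = LinearMap.id) (e : ι) :
    ∑ p ∈ S e, c e p • β p.2 (solve d.size S c β r p.1) = r e := by
  classical
  -- One unfolding of the recursion. Its size test is there for termination and, among nonzero
  -- terms, excludes only the diagonal one.
  have key : solve d.size S c β r e =
      r e - ∑ p ∈ S e, if d.size p.1 < d.size e then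
        c e p • β p.2 (solve d.size S c β r p.1) else 0 := by
    rw [solve]
    simp only [dite_eq_ite]
  have h₁ : ∑ p ∈ S e, c e p • β p.2 (solve d.size S c β r p.1) =
      (∑ p ∈ S e, if d.size p.1 < d.size e then
        c e p • β p.2 (solve d.size S c β r p.1) else 0) +
      ∑ p ∈ S e, if p = (e, d.zero) then solve d.size S c β r e else 0 := by
    rw [← Finset.sum_add_distrib]
    refine Finset.sum_congr rfl fun p _ => ?_
    obtain ⟨m, n⟩ := p
    by_cases h0 : c e (m, n) = 0
    · have hne : (m, n) ≠ (e, d.zero) := by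
        rintro h
        rw [h, hc] at h0
        exact one_ne_zero h0
      simp [h0, hne]
    have hs := hsize e _ h0
    dsimp only at hs ⊢
    by_cases hn : n = d.zero
    · subst hn
      obtain rfl := hc' e m h0
      simp [hc, hβ]
    · have : d.size n ≠ 0 := fun h => hn (d.eq_zero_of_size h)
      simp [hn, show d.size m < d.size e by omega]
  rw [h₁, Finset.sum_ite_eq', if_pos (hS e)]
  rw [key]
  abel

/-- Ensures that the antipode preserves degrees. -/
theorem solve_mem (S : ι → Finset (ι × ι)) (c : ι → ι × ι → ℝ) (β : ι → H →ₗ[ℝ] H) (r : ι → H)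
    (W : ι → Submodule ℝ H) (hr : ∀ e, r e ∈ W e)
    (hβ : ∀ e p, c e p ≠ 0 → ∀ x ∈ W p.1, β p.2 x ∈ W e) (e : ι) :
    solve d.size S c β r e ∈ W e := by
  induction h : d.size e using Nat.strong_induction_on generalizing e with
  | _ n ih =>
    rw [solve]
    refine sub_mem (hr e) (sum_mem fun p _ => ?_)
    split_ifs with hp
    · by_cases h0 : c e p = 0
      · rw [h0, zero_smul]
        exact zero_mem _
      · exact Submodule.smul_mem _ _ (hβ e p h0 _ (ih _ (h ▸ hp) _ rfl))
    · exact zero_mem _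

end Recursion

end HallConstants

/-! ### The Hopf algebra object -/

theorem KVect.lin_tensorμ_tmul {K : Type w} [AddCommGroup K] {χ : K →+ K →+ ℤ} {q : ℝˣ}
    {X₁ X₂ Y₁ Y₂ : KVect χ q} {n m : K} (x₁ : X₁.carrier) {x₂ : X₂.carrier} {y₁ : Y₁.carrier}
    (y₂ : Y₂.carrier) (hx : x₂ ∈ X₂.piece n) (hy : y₁ ∈ Y₁.piece m) :
    KVect.lin (tensorμ X₁ X₂ Y₁ Y₂) ((x₁ ⊗ₜ[ℝ] x₂) ⊗ₜ[ℝ] (y₁ ⊗ₜ[ℝ] y₂)) =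
      ((q ^ (-χ n m) : ℝˣ) : ℝ) • ((x₁ ⊗ₜ[ℝ] y₁) ⊗ₜ[ℝ] (x₂ ⊗ₜ[ℝ] y₂)) := by
  change (TensorProduct.assoc ℝ X₁.carrier Y₁.carrier (X₂.carrier ⊗[ℝ] Y₂.carrier)).symm
    (x₁ ⊗ₜ TensorProduct.assoc ℝ Y₁.carrier X₂.carrier Y₂.carrier
      (KVect.lin (KVect.braidIso X₂ Y₁).hom (x₂ ⊗ₜ y₁) ⊗ₜ y₂)) = _
  rw [KVect.braidIso_tmul hx hy, ← TensorProduct.smul_tmul', map_smul, TensorProduct.tmul_smul,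
    map_smul]
  rfl

namespace HallConstants

/-! ### Graded structure maps, bialgebra axioms and antipode. -/

section Graded

variable {C : Type w} [Category.{v} C] [Abelian C] {χ : K0 C →+ K0 C →+ ℤ} {q : ℝˣ}

theorem vec_mem_piece (m : IsoClass C) : vec m ∈ (hallObj χ q).piece (K0.ofClass m) :=
  Finsupp.single_mem_supported ℝ 1 rfl

theorem map_mem_of_vec {M : Type*} [AddCommGroup M] [Module ℝ M]
    (F : (IsoClass C →₀ ℝ) →ₗ[ℝ] M) (W : Submodule ℝ M) (n : K0 C)
    (h : ∀ c : IsoClass C, K0.ofClass c = n → F (vec c) ∈ W) (x : IsoClass C →₀ ℝ)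
    (hx : x ∈ (hallObj χ q).piece n) : F x ∈ W := by
  have hx' : x ∈ Finsupp.supported ℝ ℝ {c : IsoClass C | K0.ofClass c = n} := hx
  rw [Finsupp.supported_eq_span_single] at hx'
  have : Submodule.span ℝ ((fun i => Finsupp.single i (1 : ℝ)) ''
      {c : IsoClass C | K0.ofClass c = n}) ≤ W.comap F := by
    refine Submodule.span_le.2 ?_
    rintro _ ⟨c, hc, rfl⟩
    exact h c hc
  exact this hx'

variable (d : HallConstants (IsoClass C))

theorem mul_vec_mem
    (hdeg : ∀ m n e : IsoClass C, d.P m n e ≠ 0 → K0.ofClass e = K0.ofClass m + K0.ofClass n)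
    (m n : IsoClass C) : d.mul (vec m ⊗ₜ vec n) ∈
    (hallObj χ q).piece (K0.ofClass m + K0.ofClass n) := by
  rw [mul_vec]
  refine sum_mem fun e _ => ?_
  by_cases h : d.P m n e = 0
  · rw [h, zero_div, zero_smul]
    exact zero_mem _
  · rw [← hdeg m n e h]
    exact Submodule.smul_mem _ _ (vec_mem_piece e)

theorem ofClass_zero
    (hdeg : ∀ m n e : IsoClass C, d.P m n e ≠ 0 → K0.ofClass e = K0.ofClass m + K0.ofClass n) :
    K0.ofClass d.zero = 0 := by
  have := hdeg d.zero d.zero d.zero (by rw [d.P_zero_right]; exact d.a_ne_zero _)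
  simpa using this

theorem smul_zero_mem_piece (e : IsoClass C) :
    (vec e) d.zero • vec d.zero ∈ (hallObj χ q).piece (K0.ofClass e) := by
  by_cases h : e = d.zero
  · rw [h]
    exact Submodule.smul_mem _ _ (vec_mem_piece _)
  · rw [Finsupp.single_eq_of_ne' h, zero_smul]
    exact zero_mem _

variable
  (hdeg : ∀ m n e : IsoClass C, d.P m n e ≠ 0 → K0.ofClass e = K0.ofClass m + K0.ofClass n)

/-- The multiplication, as a morphism of graded vector spaces. -/
noncomputable def mulHom : hallObj χ q ⊗ hallObj χ q ⟶ hallObj χ q where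
  lin := d.mul
  map_mem := KVect.mapsTo_of_tmul (V := hallObj χ q) (W := hallObj χ q) d.mul
    (hallObj χ q).piece fun i j x hx y hy => by
      refine map_mem_of_vec (d.mul ∘ₗ (TensorProduct.mk ℝ _ _).flip y) _ i ?_ x hx
      rintro m rfl
      refine map_mem_of_vec (d.mul ∘ₗ TensorProduct.mk ℝ _ _ (vec m)) _ j ?_ y hy
      rintro n rfl
      exact d.mul_vec_mem hdeg m n

/-- The comultiplication, as a morphism of graded vector spaces. -/
noncomputable def comulHom : hallObj χ q ⟶ hallObj χ q ⊗ hallObj χ q where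
  lin := d.comul
  map_mem i x hx := by
    refine map_mem_of_vec d.comul (KVect.tensorPiece (hallObj χ q) (hallObj χ q) i) i ?_ x hx
    rintro e rfl
    rw [comul_vec]
    refine sum_mem fun p _ => ?_
    by_cases h : d.P p.1 p.2 e = 0
    · rw [h, zero_div, zero_smul]
      exact zero_mem _
    · rw [hdeg _ _ _ h, add_comm]
      exact Submodule.smul_mem _ _
        (KVect.tmul_mem_tensorPiece (vec_mem_piece p.2) (vec_mem_piece p.1))

/-- The unit, as a morphism of graded vector spaces. -/
noncomputable def oneHom : 𝟙_ (KVect χ q) ⟶ hallObj χ q where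
  lin := LinearMap.toSpanSingleton ℝ _ (vec d.zero) ∘ₗ ULift.moduleEquiv.toLinearMap
  map_mem i x hx := by
    by_cases h : i = 0
    · subst h
      refine Submodule.smul_mem _ _ ?_
      rw [← d.ofClass_zero hdeg]
      exact vec_mem_piece _
    · have hx' : x = 0 := by
        have : x ∈ (KVect.unit : KVect χ q).piece i := hx
        rwa [KVect.unit_piece_of_ne h, Submodule.mem_bot] at this
      rw [hx', map_zero]
      exact zero_mem _

/-- The counit, as a morphism of graded vector spaces. -/
noncomputable def counitHom : hallObj χ q ⟶ 𝟙_ (KVect χ q) where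
  lin := ULift.moduleEquiv.symm.toLinearMap ∘ₗ Finsupp.lapply d.zero
  map_mem i x hx := by
    refine map_mem_of_vec (ULift.moduleEquiv.symm.toLinearMap ∘ₗ Finsupp.lapply d.zero)
      ((KVect.unit : KVect χ q).piece i) i ?_ x hx
    rintro m rfl
    by_cases h : m = d.zero
    · rw [h, d.ofClass_zero hdeg]
      exact KVect.mem_unit_piece_zero _
    · have h₀ : (vec m) d.zero = 0 := Finsupp.single_eq_of_ne' h
      change ULift.up ((vec m) d.zero) ∈ (KVect.unit : KVect χ q).piece _
      rw [h₀]
      exact zero_mem _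

/-- The monoid object. -/
noncomputable abbrev monObj : MonObj (hallObj χ q) where
  one := d.oneHom hdeg
  mul := d.mulHom hdeg
  one_mul := KVect.hom_ext <| TensorProduct.ext' fun r x => by
    change d.mul ((r.down • vec d.zero) ⊗ₜ x) = r.down • x
    rw [← TensorProduct.smul_tmul', map_smul, zero_mul]
  mul_one := KVect.hom_ext <| TensorProduct.ext' fun x r => by
    change d.mul (x ⊗ₜ (r.down • vec d.zero)) = r.down • x
    rw [TensorProduct.tmul_smul, map_smul, mul_zero]
  mul_assoc := KVect.hom_ext <| TensorProduct.ext_threefold fun x y z => d.mul_assoc x y z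

/-- The comonoid object. -/
noncomputable abbrev comonObj : ComonObj (hallObj χ q) where
  counit := d.counitHom hdeg
  comul := d.comulHom hdeg
  counit_comul := KVect.hom_ext <| LinearMap.ext fun x => by
    have h := congrArg (TensorProduct.map
      (ULift.moduleEquiv.{0, 0, w} (R := ℝ) (M := ℝ)).symm.toLinearMap LinearMap.id)
      (d.counit_comul x)
    rw [← LinearMap.comp_apply, ← TensorProduct.map_comp] at h
    exact h
  comul_counit := KVect.hom_ext <| LinearMap.ext fun x => by
    have h := congrArg (TensorProduct.map LinearMap.id
      (ULift.moduleEquiv.{0, 0, w} (R := ℝ) (M := ℝ)).symm.toLinearMap)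
      (d.comul_counit x)
    rw [← LinearMap.comp_apply, ← TensorProduct.map_comp] at h
    exact h
  comul_assoc := KVect.hom_ext <| LinearMap.ext fun x => d.comul_assoc x

theorem vec_ext₂ {M : Type*} [AddCommGroup M] [Module ℝ M] {ι : Type*}
    {f g : (ι →₀ ℝ) ⊗[ℝ] (ι →₀ ℝ) →ₗ[ℝ] M}
    (h : ∀ m n, f (vec m ⊗ₜ vec n) = g (vec m ⊗ₜ vec n)) : f = g := by
  ext m n
  exact h m n

/-- With coproduct terms A₂ ⊗ A₁ and B₂ ⊗ B₁, the product in the braided tensor square moves A₁ past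
B₂; the power of q this costs is the weight in `hgreen`. -/
theorem comul_mul_eq_tensorμ
    (hgreen : ∀ A B X D : IsoClass C, ∑ e ∈ d.mid A B, d.P A B e * d.P X D e / d.a e =
      ∑ p ∈ d.ends A, ∑ r ∈ d.ends B,
        ((q ^ (-χ (K0.ofClass p.1) (K0.ofClass r.2)) : ℝˣ) : ℝ) *
        (d.P r.1 r.2 B * d.P p.2 r.2 D * (d.P p.1 r.1 X * d.P p.1 p.2 A)) /
          (d.a p.1 * d.a p.2 * (d.a r.1 * d.a r.2))) (A B : IsoClass C) :
    d.comul (d.mul (vec A ⊗ₜ vec B)) = TensorProduct.map d.mul d.mul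
      (KVect.lin (tensorμ (hallObj χ q) (hallObj χ q) (hallObj χ q) (hallObj χ q))
        (d.comul (vec A) ⊗ₜ d.comul (vec B))) := by
  rw [d.comul_mul_vec (fun m n => ((q ^ (-χ (K0.ofClass m) (K0.ofClass n)) : ℝˣ) : ℝ)) hgreen,
    d.comul_vec A, d.comul_vec B, TensorProduct.sum_tmul, map_sum, map_sum]
  refine Finset.sum_congr rfl fun p _ => ?_
  rw [TensorProduct.tmul_sum, map_sum, map_sum]
  refine Finset.sum_congr rfl fun r _ => ?_
  have h := KVect.lin_tensorμ_tmul (χ := χ) (q := q) (X₁ := hallObj χ q) (X₂ := hallObj χ q)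
    (Y₁ := hallObj χ q) (Y₂ := hallObj χ q) (vec p.2) (vec r.1) (vec_mem_piece p.1)
    (vec_mem_piece r.2)
  rw [TensorProduct.smul_tmul_smul, map_smul, map_smul]
  erw [h]
  rw [map_smul, smul_smul]
  rfl

/-- The bimonoid object. -/
noncomputable abbrev bimonObj
    (hgreen : ∀ A B X D : IsoClass C, ∑ e ∈ d.mid A B, d.P A B e * d.P X D e / d.a e =
      ∑ p ∈ d.ends A, ∑ r ∈ d.ends B,
        ((q ^ (-χ (K0.ofClass p.1) (K0.ofClass r.2)) : ℝˣ) : ℝ) *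
        (d.P r.1 r.2 B * d.P p.2 r.2 D * (d.P p.1 r.1 X * d.P p.1 p.2 A)) /
          (d.a p.1 * d.a p.2 * (d.a r.1 * d.a r.2))) : BimonObj (hallObj χ q) where
  __ := d.monObj hdeg
  __ := d.comonObj hdeg
  mul_comul := KVect.hom_ext <| vec_ext₂ fun A B => by
    exact d.comul_mul_eq_tensorμ hgreen A B
  one_comul := KVect.hom_ext <| LinearMap.ext fun r => by
    change d.comul (r.down • vec d.zero) = (1 : ℝ) • vec d.zero ⊗ₜ (r.down • vec d.zero)
    rw [map_smul, comul_zero, one_smul, TensorProduct.tmul_smul]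
  mul_counit := KVect.hom_ext <| TensorProduct.ext' fun (x y : IsoClass C →₀ ℝ) => by
    change ULift.up (d.mul (x ⊗ₜ y) d.zero) = ULift.up (x d.zero * y d.zero)
    rw [mul_apply_zero]
  one_counit := KVect.hom_ext <| LinearMap.ext fun r => by
    exact congrArg ULift.up (by simp : (r.down • vec d.zero) d.zero = r.down)

theorem exists_left_antipode
    (hdeg : ∀ m n e : IsoClass C, d.P m n e ≠ 0 → K0.ofClass e = K0.ofClass m + K0.ofClass n) :
    ∃ S : hallObj χ q ⟶ hallObj χ q, ∀ x : IsoClass C →₀ ℝ,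
    d.mul (TensorProduct.map (KVect.lin S) LinearMap.id (d.comul x)) = x d.zero • vec d.zero := by
  -- The pairs in `ends` are (quotient, subobject), and the left antipode acts on the subobject, the
  -- first tensor factor. The swap puts it in the position of the unknown.
  let T := solve d.size (fun e => (d.ends e).map (Equiv.prodComm _ _).toEmbedding)
    (fun e p => d.P p.2 p.1 e / d.a e) (fun j => d.mul ∘ₗ (TensorProduct.mk ℝ _ _).flip (vec j))
    (fun e => vec e d.zero • vec d.zero)
  have hT (e : IsoClass C) : T e ∈ (hallObj χ q).piece (K0.ofClass e) :=
    d.solve_mem _ _ _ _ (fun e => (hallObj χ q).piece (K0.ofClass e)) (d.smul_zero_mem_piece)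
      (fun e p hp x hx => by
        rw [hdeg _ _ _ (left_ne_zero_of_mul hp), add_comm]
        exact (d.mulHom (χ := χ) (q := q) hdeg).map_mem _ _
          (KVect.tmul_mem_tensorPiece hx (vec_mem_piece p.2))) e
  refine ⟨⟨Finsupp.linearCombination ℝ T, fun n => map_mem_of_vec _ _ n ?_⟩, fun x => ?_⟩
  · rintro e rfl
    simpa using hT e
  · change d.mul (TensorProduct.map (Finsupp.linearCombination ℝ T) LinearMap.id (d.comul x)) = _
    induction x using vec_induction with
    | zero => simp
    | add x y hx hy => simp only [map_add, hx, hy, Finsupp.add_apply, add_smul]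
    | smul r x hx => simp only [map_smul, hx, Finsupp.smul_apply, smul_eq_mul, mul_smul]
    | vec e =>
      rw [comul_vec, map_sum, map_sum]
      refine Eq.trans ?_ (d.sum_solve (fun e => (d.ends e).map (Equiv.prodComm _ _).toEmbedding)
        (fun e p => d.P p.2 p.1 e / d.a e)
        (fun j => d.mul ∘ₗ (TensorProduct.mk ℝ _ _).flip (vec j))
        (fun e => vec e d.zero • vec d.zero) ?_ ?_ ?_ ?_ ?_ e)
      · rw [Finset.sum_map]
        refine Finset.sum_congr rfl fun p _ => ?_
        rw [map_smul, map_smul, TensorProduct.map_tmul, Finsupp.linearCombination_single, one_smul]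
        rfl
      · intro e
        refine Finset.mem_map.2 ⟨(d.zero, e), d.mem_ends ?_, rfl⟩
        rw [d.P_zero_left]
        exact d.a_ne_zero e
      · intro e
        exact (congrArg (· / d.a e) (d.P_zero_left e)).trans (div_self (d.a_ne_zero e))
      · exact fun e m h => (d.eq_of_P_zero_left (left_ne_zero_of_mul h)).symm
      · exact fun e p h => (d.size_eq (left_ne_zero_of_mul h)).trans (add_comm _ _)
      · exact LinearMap.ext fun x => d.mul_zero x

theorem exists_right_antipode
    (hdeg : ∀ m n e : IsoClass C, d.P m n e ≠ 0 → K0.ofClass e = K0.ofClass m + K0.ofClass n) :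
    ∃ S : hallObj χ q ⟶ hallObj χ q, ∀ x : IsoClass C →₀ ℝ,
    d.mul (TensorProduct.map LinearMap.id (KVect.lin S) (d.comul x)) = x d.zero • vec d.zero := by
  let T := solve d.size d.ends
    (fun e p => d.P p.1 p.2 e / d.a e) (fun j => d.mul ∘ₗ TensorProduct.mk ℝ _ _ (vec j))
    (fun e => vec e d.zero • vec d.zero)
  have hT (e : IsoClass C) : T e ∈ (hallObj χ q).piece (K0.ofClass e) :=
    d.solve_mem _ _ _ _ (fun e => (hallObj χ q).piece (K0.ofClass e)) (d.smul_zero_mem_piece)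
      (fun e p hp x hx => by
        rw [hdeg _ _ _ (left_ne_zero_of_mul hp), add_comm]
        exact (d.mulHom (χ := χ) (q := q) hdeg).map_mem _ _
          (KVect.tmul_mem_tensorPiece (vec_mem_piece p.2) hx)) e
  refine ⟨⟨Finsupp.linearCombination ℝ T, fun n => map_mem_of_vec _ _ n ?_⟩, fun x => ?_⟩
  · rintro e rfl
    simpa using hT e
  · change d.mul (TensorProduct.map LinearMap.id (Finsupp.linearCombination ℝ T) (d.comul x)) = _
    induction x using vec_induction with
    | zero => simp
    | add x y hx hy => simp only [map_add, hx, hy, Finsupp.add_apply, add_smul]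
    | smul r x hx => simp only [map_smul, hx, Finsupp.smul_apply, smul_eq_mul, mul_smul]
    | vec e =>
      rw [comul_vec, map_sum, map_sum]
      refine Eq.trans ?_ (d.sum_solve d.ends (fun e p => d.P p.1 p.2 e / d.a e)
        (fun j => d.mul ∘ₗ TensorProduct.mk ℝ _ _ (vec j))
        (fun e => vec e d.zero • vec d.zero) ?_ ?_ ?_ ?_ ?_ e)
      · refine Finset.sum_congr rfl fun p _ => ?_
        rw [map_smul, map_smul, TensorProduct.map_tmul, Finsupp.linearCombination_single, one_smul]
        rfl
      · refine fun e => d.mem_ends ?_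
        rw [d.P_zero_right]
        exact d.a_ne_zero e
      · intro e
        exact (congrArg (· / d.a e) (d.P_zero_right e)).trans (div_self (d.a_ne_zero e))
      · exact fun e m h => (d.eq_of_P_zero_right (left_ne_zero_of_mul h)).symm
      · exact fun e p h => d.size_eq (left_ne_zero_of_mul h)
      · exact LinearMap.ext fun x => d.zero_mul x

/-- A left and a right inverse of the identity in the convolution monoid agree, so the two one-sided
recursive solutions give one antipode. -/
theorem exists_hopfObj
    (hgreen : ∀ A B X D : IsoClass C, ∑ e ∈ d.mid A B, d.P A B e * d.P X D e / d.a e =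
      ∑ p ∈ d.ends A, ∑ r ∈ d.ends B,
        ((q ^ (-χ (K0.ofClass p.1) (K0.ofClass r.2)) : ℝˣ) : ℝ) *
        (d.P r.1 r.2 B * d.P p.2 r.2 D * (d.P p.1 r.1 X * d.P p.1 p.2 A)) /
          (d.a p.1 * d.a p.2 * (d.a r.1 * d.a r.2))) :
    ∃ h : HopfObj (hallObj χ q), h.toBimonObj = d.bimonObj hdeg hgreen := by
  let B : BimonObj (hallObj χ q) := d.bimonObj hdeg hgreen
  obtain ⟨L, hL⟩ := d.exists_left_antipode (χ := χ) (q := q) hdeg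
  obtain ⟨R, hR⟩ := d.exists_right_antipode (χ := χ) (q := q) hdeg
  have hL' : ComonObj.comul ≫ L ▷ hallObj χ q ≫ MonObj.mul =
      ComonObj.counit (X := hallObj χ q) ≫ MonObj.one :=
    KVect.hom_ext (LinearMap.ext hL)
  have hR' : ComonObj.comul ≫ hallObj χ q ◁ R ≫ MonObj.mul =
      ComonObj.counit (X := hallObj χ q) ≫ MonObj.one :=
    KVect.hom_ext (LinearMap.ext hR)
  have h : L = R := by
    let L₀ : Conv (hallObj χ q) (hallObj χ q) := L
    let R₀ : Conv (hallObj χ q) (hallObj χ q) := R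
    let I₀ : Conv (hallObj χ q) (hallObj χ q) := 𝟙 (hallObj χ q)
    have h₁ : L₀ * I₀ = 1 := by
      rw [Conv.mul_eq, whiskerLeft_id, Category.id_comp]
      exact hL'
    have h₂ : I₀ * R₀ = 1 := by
      rw [Conv.mul_eq, id_whiskerRight, Category.id_comp]
      exact hR'
    have h₃ : L₀ = R₀ := left_inv_eq_right_inv h₁ h₂
    exact h₃
  exact ⟨{ antipode := L, antipode_left := hL', antipode_right := by rw [h]; exact hR' }, rfl⟩

end Graded

/-- Such an e is primitive, so the antipode identity reads S(e) + e = 0. -/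
theorem map_vec_eq_neg {ι : Type u} (d : HallConstants ι) (S : (ι →₀ ℝ) →ₗ[ℝ] ι →₀ ℝ)
    (hS : ∀ x, d.mul (TensorProduct.map S LinearMap.id (d.comul x)) = x d.zero • vec d.zero)
    {e : ι} (he : e ≠ d.zero) (h : ∀ m n, d.P m n e ≠ 0 → m = d.zero ∨ n = d.zero) :
    S (vec e) = -vec e := by
  have h₀ : S (vec d.zero) = vec d.zero := by
    simpa [comul_zero, mul_zero] using hS (vec d.zero)
  have h₁ : d.comul (vec e) = vec e ⊗ₜ vec d.zero + vec d.zero ⊗ₜ vec e := by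
    classical
    rw [comul_vec, ← Finset.sum_subset (s₁ := {(d.zero, e), (e, d.zero)})]
    · rw [Finset.sum_pair (by simpa using fun h : d.zero = e => absurd h.symm he), d.P_zero_left,
        d.P_zero_right, div_self (d.a_ne_zero e), one_smul, one_smul]
    · intro p hp
      obtain rfl | rfl : p = (d.zero, e) ∨ p = (e, d.zero) := by simpa using hp
      · exact d.mem_ends (by rw [d.P_zero_left]; exact d.a_ne_zero e)
      · exact d.mem_ends (by rw [d.P_zero_right]; exact d.a_ne_zero e)
    · rintro ⟨m, n⟩ - hp
      suffices d.P m n e = 0 by rw [this, zero_div, zero_smul]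
      by_contra hP
      obtain rfl | rfl := h m n hP
      · exact hp (by simp [d.eq_of_P_zero_left hP])
      · exact hp (by simp [d.eq_of_P_zero_right hP])
  have h₂ := hS (vec e)
  rw [h₁, map_add, map_add, TensorProduct.map_tmul, TensorProduct.map_tmul, h₀, LinearMap.id_apply,
    LinearMap.id_apply, mul_zero, zero_mul, Finsupp.single_eq_of_ne' he, zero_smul] at h₂
  exact eq_neg_of_add_eq_zero_left h₂

end HallConstants

/-! ### The Hall algebra of a quiver -/

section HallNumbers

open Limits

variable {C : Type u} [Category.{v} C]

theorem autCard_of_isZero {Z : C} (hZ : IsZero Z) : autCard Z = 1 :=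
  Nat.card_eq_one_iff_unique.2
    ⟨⟨fun _ _ => Iso.ext (hZ.eq_of_src _ _)⟩, ⟨Iso.refl Z⟩⟩

variable [Abelian C]

/-- Together with `isExt_zero_right`, this identifies Hall numbers with one zero end as automorphism
counts, which gives the unit and counit laws. -/
theorem isExt_zero_left {Z M : C} (hZ : IsZero Z) {f : Z ⟶ M} {N : C} {g : M ⟶ N} :
    IsExt f g ↔ IsIso g := by
  refine ⟨fun h => ?_, fun h => ?_⟩
  · have := h.epi
    have : Mono g := Preadditive.mono_of_cancel_zero _ fun t ht => by
      obtain ⟨s, rfl⟩ := h.exists_lift t ht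
      rw [hZ.eq_of_src f 0, comp_zero]
    exact isIso_of_mono_of_epi g
  · refine IsExt.of_lift (hZ.eq_of_src _ _) ⟨fun _ _ _ => hZ.eq_of_tgt _ _⟩ inferInstance
      fun T t ht => ⟨0, ?_⟩
    rw [zero_comp, (cancel_mono g).1 (ht.trans zero_comp.symm)]

theorem isExt_zero_right {Z M : C} (hZ : IsZero Z) {g : M ⟶ Z} {N : C} {f : N ⟶ M} :
    IsExt f g ↔ IsIso f := by
  refine ⟨fun h => ?_, fun h => ?_⟩
  · have := h.mono
    have : Epi f := Preadditive.epi_of_cancel_zero _ fun t ht => by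
      obtain ⟨s, rfl⟩ := h.exists_desc t ht
      rw [hZ.eq_of_tgt g 0, zero_comp]
    exact isIso_of_mono_of_epi f
  · refine IsExt.of_desc (hZ.eq_of_tgt _ _) inferInstance ⟨fun _ _ _ => hZ.eq_of_src _ _⟩
      fun T t ht => ⟨0, ?_⟩
    rw [comp_zero, (cancel_epi f).1 (ht.trans comp_zero.symm)]

theorem hallP_zero_right {Z : C} (hZ : IsZero Z) (M : C) : hallP M Z M = autCard M :=
  Nat.card_congr
    { toFun := fun z =>
        have : IsIso z.1.2 := (isExt_zero_left hZ).1 z.2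
        (asIso z.1.2 : M ≅ M)
      invFun := fun e => ⟨(hZ.to_ M, e.hom), (isExt_zero_left hZ).2 (Iso.isIso_hom e)⟩
      left_inv := fun _ => Subtype.ext (Prod.ext (hZ.eq_of_src _ _) rfl)
      right_inv := fun _ => Iso.ext rfl }

theorem hallP_zero_left {Z : C} (hZ : IsZero Z) (M : C) : hallP Z M M = autCard M :=
  Nat.card_congr
    { toFun := fun z =>
        have : IsIso z.1.1 := (isExt_zero_right hZ).1 z.2
        (asIso z.1.1 : M ≅ M)
      invFun := fun e => ⟨(e.hom, hZ.from_ M), (isExt_zero_right hZ).2 (Iso.isIso_hom e)⟩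
      left_inv := fun _ => Subtype.ext (Prod.ext rfl (hZ.eq_of_tgt _ _))
      right_inv := fun _ => Iso.ext rfl }

theorem nonempty_iso_of_hallP_zero_right {Z M E : C} (hZ : IsZero Z) (h : hallP M Z E ≠ 0) :
    Nonempty (E ≅ M) := by
  obtain ⟨z⟩ := exists_of_hallP_ne_zero h
  have : IsIso z.1.2 := (isExt_zero_left hZ).1 z.2
  exact ⟨asIso z.1.2⟩

theorem nonempty_iso_of_hallP_zero_left {Z M E : C} (hZ : IsZero Z) (h : hallP Z M E ≠ 0) :
    Nonempty (E ≅ M) := by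
  obtain ⟨z⟩ := exists_of_hallP_ne_zero h
  have : IsIso z.1.1 := (isExt_zero_right hZ).1 z.2
  exact ⟨(asIso z.1.1).symm⟩

theorem isZero_or_isZero_of_simple {M N E : C} [Simple E] (h : hallP M N E ≠ 0) :
    IsZero M ∨ IsZero N := by
  obtain ⟨⟨f, g⟩, hz⟩ := exists_of_hallP_ne_zero h
  have := hz.mono
  have := hz.epi
  by_cases hf : f = 0
  · exact Or.inr (IsZero.of_mono_eq_zero f hf)
  · have := isIso_of_mono_of_nonzero hf
    refine Or.inl (IsZero.of_epi_eq_zero g ?_)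
    rw [← cancel_epi f, hz.zero, comp_zero]

theorem K0.of_eq_add_of_hallP {C : Type w} [Category.{v} C] [Abelian C] {M N E : C}
    (h : hallP M N E ≠ 0) : K0.of E = K0.of M + K0.of N := by
  obtain ⟨z⟩ := exists_of_hallP_ne_zero h
  exact (K0.of_add z.2.shortExact).trans (add_comm _ _)

theorem K0.of_out {C : Type w} [Category.{v} C] [Abelian C] (e : IsoClass C) :
    K0.of e.out = K0.ofClass e := by
  rw [K0.of, isoClass_out]

end HallNumbers

namespace QuiverRep

open Limits ZeroObject

variable {k : Type u} [Field k] {V : Type u} [Quiver.{u} V]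

theorem isZero_out_zero : IsZero (isoClass (0 : QuiverRep k V)).out :=
  (isZero_zero _).of_iso (nonempty_iso_out _).some

variable [Finite k] [Finite V] [∀ x y : V, Finite (Quiver.Path x y)]

variable (k V) in
/-- The Hall numbers of the category of representations. -/
noncomputable def hallConstants [Fintype (Paths V)] : HallConstants (IsoClass (QuiverRep k V)) where
  P m n e := hallP m.out n.out e.out
  a m := autCard m.out
  mid m n := (finite_setOf_hallP_middle.{u + 1} m.out n.out).toFinset
  ends e := (finite_setOf_hallP_ends e.out).toFinset
  zero := isoClass 0
  size m := dim m.out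
  a_ne_zero m := autCard_ne_zero _
  a_zero := by rw [autCard_of_isZero isZero_out_zero, Nat.cast_one]
  mem_mid h := (Set.Finite.mem_toFinset _).2 (Nat.cast_ne_zero.1 h)
  mem_ends h := (Set.Finite.mem_toFinset _).2 (Nat.cast_ne_zero.1 h)
  P_zero_right m := by rw [hallP_zero_right isZero_out_zero]
  P_zero_left m := by rw [hallP_zero_left isZero_out_zero]
  eq_of_P_zero_right {m e} h := by
    have := isoClass_eq_iff.2
      (nonempty_iso_of_hallP_zero_right isZero_out_zero (Nat.cast_ne_zero.1 h))
    rwa [isoClass_out, isoClass_out] at this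
  eq_of_P_zero_left {m e} h := by
    have := isoClass_eq_iff.2
      (nonempty_iso_of_hallP_zero_left isZero_out_zero (Nat.cast_ne_zero.1 h))
    rwa [isoClass_out, isoClass_out] at this
  size_eq h := by
    obtain ⟨z⟩ := exists_of_hallP_ne_zero (Nat.cast_ne_zero.1 h)
    exact (dim_eq_add z.2.shortExact).trans (add_comm _ _)
  eq_zero_of_size {m} h := by
    rw [← isoClass_out m]
    exact isoClass_eq_iff.2 ⟨(isZero_of_dim_eq_zero h).iso (isZero_zero _)⟩
  assoc m n l f := hallP_assoc _ _ _ _ _ _ (fun _ h => (Set.Finite.mem_toFinset _).2 h)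
    fun _ h => (Set.Finite.mem_toFinset _).2 h

theorem hallConstants_green [Fintype (Paths V)]
    {χ : K0 (QuiverRep k V) →+ K0 (QuiverRep k V) →+ ℤ}
    (hχ : ∀ M N : QuiverRep k V, χ (K0.of M) (K0.of N) = eulerForm M N)
    (A B X D : IsoClass (QuiverRep k V)) :
    let d := hallConstants k V
    ∑ e ∈ d.mid A B, d.P A B e * d.P X D e / d.a e =
      ∑ p ∈ d.ends A, ∑ r ∈ d.ends B,
        ((cardUnit k ^ (-χ (K0.ofClass p.1) (K0.ofClass r.2)) : ℝˣ) : ℝ) *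
        (d.P r.1 r.2 B * d.P p.2 r.2 D * (d.P p.1 r.1 X * d.P p.1 p.2 A)) /
          (d.a p.1 * d.a p.2 * (d.a r.1 * d.a r.2)) := by
  classical
  intro d
  let U := d.ends A ∪ d.ends B
  let R := U.image Prod.fst ∪ U.image Prod.snd
  have hR {p : IsoClass (QuiverRep k V) × IsoClass (QuiverRep k V)} (hp : p ∈ U) :
      p.1 ∈ R ∧ p.2 ∈ R :=
    ⟨Finset.mem_union_left _ (Finset.mem_image_of_mem _ hp),
      Finset.mem_union_right _ (Finset.mem_image_of_mem _ hp)⟩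
  have hA {m n : IsoClass (QuiverRep k V)} (h : hallP m.out n.out A.out ≠ 0) : (m, n) ∈ d.ends A :=
    d.mem_ends (Nat.cast_ne_zero.2 h)
  have hB {m n : IsoClass (QuiverRep k V)} (h : hallP m.out n.out B.out ≠ 0) : (m, n) ∈ d.ends B :=
    d.mem_ends (Nat.cast_ne_zero.2 h)
  have key := hallP_green.{u + 1} A.out B.out X.out D.out (d.mid A B) R
    (fun e h => d.mem_mid (Nat.cast_ne_zero.2 h))
    (fun m n h => hR (Finset.mem_union_left _ (hA h)))
    (fun m n h => hR (Finset.mem_union_right _ (hB h)))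
  refine key.trans ?_
  rw [← Finset.sum_product']
  symm
  -- Green's formula sums over all quadruples from R. A quadruple outside `ends A × ends B` has a
  -- vanishing Hall number for A or for B.
  refine Finset.sum_subset_zero_on_sdiff ?_ ?_ ?_
  · rintro ⟨p, r⟩ h
    obtain ⟨hp, hr⟩ := Finset.mem_product.1 h
    exact Finset.mem_product.2 ⟨Finset.mem_product.2 (hR (Finset.mem_union_left _ hp)),
      Finset.mem_product.2 (hR (Finset.mem_union_right _ hr))⟩
  · rintro ⟨p, r⟩ h
    have h' := (Finset.mem_sdiff.1 h).2
    by_cases h₁ : hallP p.1.out p.2.out A.out = 0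
    · simp [h₁]
    · by_cases h₂ : hallP r.1.out r.2.out B.out = 0
      · simp [h₂]
      · exact absurd (Finset.mem_product.2 ⟨hA h₁, hB h₂⟩) h'
  · rintro ⟨p, r⟩ -
    dsimp only
    rw [← K0.of_out, ← K0.of_out, hχ, cardUnit_zpow_neg_eulerForm]
    rfl

end QuiverRep

theorem mainTheorem1 {k : Type u} [Field k] [Finite k] {V : Type u} [Quiver.{u} V]
    (hQ : IsSimplyLacedDynkin V) :
    (∀ (M N : QuiverRep k V) (i : ℕ), Module.Finite k (repExt M N i)) ∧
    (∀ (M N : QuiverRep k V) (i : ℕ), 2 ≤ i → Subsingleton (repExt M N i)) ∧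
    ∃ χ : K0 (QuiverRep k V) →+ K0 (QuiverRep k V) →+ ℤ,
      (∀ M N : QuiverRep k V, χ (K0.of M) (K0.of N) = eulerForm M N) ∧
      ∃ _ : HopfObj (hallObj χ (cardUnit k)),
        (∀ M N E : QuiverRep k V,
          KVect.lin (MonObj.mul (X := hallObj χ (cardUnit k)))
              (hallBasis M ⊗ₜ[ℝ] hallBasis N) (isoClass E) =
            (hallP M N E : ℝ) / (autCard M * autCard N)) ∧
        (∀ M N E : QuiverRep k V,
          finsuppTensorFinsupp' ℝ (IsoClass (QuiverRep k V)) (IsoClass (QuiverRep k V))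
              (KVect.lin (ComonObj.comul (X := hallObj χ (cardUnit k))) (hallBasis E))
              (isoClass N, isoClass M) =
            (hallP M N E : ℝ) / autCard E) ∧
        (∀ Z : QuiverRep k V, Limits.IsZero Z →
          KVect.lin (MonObj.one (X := hallObj χ (cardUnit k))) (ULift.up 1) = hallBasis Z) ∧
        (∀ M : QuiverRep k V,
          (Limits.IsZero M →
            KVect.lin (ComonObj.counit (X := hallObj χ (cardUnit k))) (hallBasis M) =
              ULift.up 1) ∧
          (¬ Limits.IsZero M →
            KVect.lin (ComonObj.counit (X := hallObj χ (cardUnit k))) (hallBasis M) =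
              ULift.up 0)) ∧
        (∀ M : QuiverRep k V, Simple M →
          KVect.lin (HopfObj.antipode (X := hallObj χ (cardUnit k))) (hallBasis M) =
            -hallBasis M) := by
  have := hQ.finite_vertices
  have := hQ.finite_path
  have : Finite (Paths V) := inferInstanceAs (Finite V)
  have := Fintype.ofFinite (Paths V)
  refine ⟨fun M N i => have := QuiverRep.finite_ext M N i; Module.Finite.of_finite,
    QuiverRep.subsingleton_ext, ?_⟩
  obtain ⟨χ, hχ⟩ := K0.exists_bilinear (C := QuiverRep k V) eulerForm
    (fun T _ hS => QuiverRep.eulerForm_add_left T hS)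
    (fun T _ hS => QuiverRep.eulerForm_add_right T hS)
  refine ⟨χ, hχ, ?_⟩
  -- The constants are defined on chosen representatives of the classes; `hP` and `ha` transfer them
  -- to arbitrary representations.
  let d := QuiverRep.hallConstants k V
  have hdeg (m n e : IsoClass (QuiverRep k V)) (h : d.P m n e ≠ 0) :
      K0.ofClass e = K0.ofClass m + K0.ofClass n := by
    rw [← K0.of_out, ← K0.of_out, ← K0.of_out]
    exact K0.of_eq_add_of_hallP (Nat.cast_ne_zero.1 h)
  obtain ⟨H, hH⟩ := d.exists_hopfObj (q := cardUnit k) hdeg (QuiverRep.hallConstants_green hχ)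
  have hmul : KVect.lin (MonObj.mul (X := hallObj χ (cardUnit k))) = d.mul := by rw [hH]; rfl
  have hcomul : KVect.lin (ComonObj.comul (X := hallObj χ (cardUnit k))) = d.comul := by
    rw [hH]; rfl
  have hone : KVect.lin (MonObj.one (X := hallObj χ (cardUnit k))) (ULift.up 1) =
      HallConstants.vec d.zero := by
    rw [hH]; exact one_smul ℝ _
  have hcounit (x : IsoClass (QuiverRep k V) →₀ ℝ) :
      KVect.lin (ComonObj.counit (X := hallObj χ (cardUnit k))) x = ULift.up (x d.zero) := by
    rw [hH]; rfl
  have hP (M N E : QuiverRep k V) :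
      d.P (isoClass M) (isoClass N) (isoClass E) = hallP M N E :=
    congrArg Nat.cast (hallP_congr (nonempty_iso_out M).some (nonempty_iso_out N).some
      (nonempty_iso_out E).some)
  have ha (M : QuiverRep k V) : d.a (isoClass M) = autCard M :=
    congrArg Nat.cast (autCard_congr (nonempty_iso_out M).some)
  have hzero (M : QuiverRep k V) : isoClass M = d.zero ↔ Limits.IsZero M :=
    isoClass_eq_iff.trans ⟨fun ⟨e⟩ => (Limits.isZero_zero _).of_iso e,
      fun h => ⟨h.iso (Limits.isZero_zero _)⟩⟩
  refine ⟨H, fun M N E => ?_, fun M N E => ?_, fun Z hZ => ?_, fun M => ⟨fun hM => ?_, fun hM => ?_⟩,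
    fun M hM => ?_⟩
  · rw [hmul, ← hP, ← ha, ← ha]
    exact d.mul_vec_apply _ _ _
  · rw [hcomul, ← hP, ← ha]
    exact d.finsuppTensorFinsupp_comul_vec _ _ _
  · rw [hone, ← (hzero Z).2 hZ, hallBasis]
  · rw [hcounit, hallBasis, (hzero M).2 hM, Finsupp.single_eq_same]
  · rw [hcounit, hallBasis, Finsupp.single_eq_of_ne' (mt (hzero M).1 hM)]
  -- The left antipode axiom is translated into an identity of linear maps, and in a sequence with
  -- simple middle term one end is zero.
  · refine d.map_vec_eq_neg _ (fun x => ?_) (mt (hzero M).1 (Simple.not_isZero M))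
      fun m n h => ?_
    · have h := LinearMap.congr_fun (congrArg KVect.lin
        (HopfObj.antipode_left (hallObj χ (cardUnit k)))) x
      rw [KVect.lin_comp, KVect.lin_comp, KVect.lin_comp, LinearMap.comp_apply,
        LinearMap.comp_apply, LinearMap.comp_apply, hmul, hcomul, hcounit] at h
      refine h.trans ?_
      have h₁ := map_smul (KVect.lin (MonObj.one (X := hallObj χ (cardUnit k)))) (x d.zero)
        (ULift.up 1)
      rw [hone] at h₁
      rw [← h₁]
      congr 1
      exact congrArg ULift.up (mul_one _).symm
    · rw [← isoClass_out m, ← isoClass_out n, hP] at h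
      rw [← isoClass_out m, ← isoClass_out n, hzero, hzero]
      exact isZero_or_isZero_of_simple (Nat.cast_ne_zero.1 h)
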